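/- Let $n\ge 1$, $1\le j\le n$, and let $x\cdot\xi$, $|\cdot|$ be the Euclidean inner product and norm of $\mathbb R^n$. **Heat kernel.** On the Heisenberg group $\mathbb H^n=\mathbb C^n\times\mathbb R\ni(z,t)$, $z=x+iy$, let $$\mathcal L=\sum_{j=1}^n\Big[\Big(\tfrac{\partial}{\partial x_j}+\tfrac{y_j}{2}\tfrac{\partial}{\partial t}\Big)^2+\Big(\tfrac{\partial}{\partial y_j}-\tfrac{x_j}{2}\tfrac{\partial}{\partial t}\Big)^2\Big],$$ $$\tilde X_j=\tfrac{\partial}{\partial x_j}-\tfrac{y_j}{2}\tfrac{\partial}{\partial t},\quad \tilde Y_j=\tfrac{\partial}{\partial y_j}+\tfrac{x_j}{2}\tfrac{\partial}{\partial t},\quad \tilde Z_j=i\tilde X_j+\tilde Y_j,\quad \tilde Z_j^*=i\tilde X_j-\tilde Y_j .$$ For $s>0$ let $$p_s(z,t)=\frac1{2\pi}\int_{\mathbb R}e^{-i\lambda t}q_s(z,\lambda)\,d\lambda,\qquad q_s(z,\lambda)=(4\pi)^{-n}\Big(\frac{\lambda}{\sinh \lambda s}\Big)^n e^{-\frac14\lambda\coth(\lambda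 s)|z|^2}.$$ Then $p_s$ is the heat kernel of $\mathcal L$: each $p_s$ is $C^2$, $\partial_sp_s=\mathcal Lp_s$, $p_s\in L^1(\mathbb H^n)$ with $\sup_{s>0}\|p_s\|_1<\infty$, and $\int_{\mathbb H^n} p_s\varphi\,dz\,dt\to\varphi(0)$ as $s\to0^+$ for every bounded continuous $\varphi:\mathbb H^n\to\mathbb R$. **Truncated Riesz transforms.** For $\lambda\ne0$ let $A_j(\lambda)=-\partial_{\xi_j}+\lambda\xi_j$, $A_j(\lambda)^*=\partial_{\xi_j}+\lambda\xi_j$, and let $e^{-rH(\lambda)}$, $r>0$, be the semigroup of the scaled Hermite operator $H(\lambda)=-\Delta+\lambda^2|\xi|^2$ on $L^2(\mathbb R^n)$, that is, $e^{-rH(\lambda)}\varphi=\sum_{\alpha\in\mathbb N^n}e^{-(2|\alpha|+n)|\lambda|r}(\varphi,\Phi_\alpha^\lambda)\Phi_\alpha^\lambda$ with the normalized scaled Hermite functions $\Phi^\lambda_\alpha$. For $\epsilon>0$ put $$R_j^\epsilon(\lambda)=\frac{A_j(\lambda)}{\sqrt\pi}\int_{\epsilon^2}^{1/\epsilon^2}e^{-rH(\lambda)}r^{-1/2}\,dr,\qquad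 R_j^{*\epsilon}(\lambda)=\frac{A_j(\lambda)^*}{\sqrt\pi}\int_{\epsilon^2}^{1/\epsilon^2}e^{-rH(\lambda)}r^{-1/2}\,dr ,$$ where the integrals are taken over the set $\epsilon^2<r<1/\epsilon^2$ (empty if $\epsilon\ge1$). For $f\in L^2(\mathbb R^n\times\mathbb R)$ let $f^\lambda(\xi)=\int_{\mathbb R}f(\xi,\eta)e^{i\lambda\eta}\,d\eta$ (in the $L^2$ sense) and $$R_j^\epsilon f(\xi,\eta)=\frac1{2\pi}\int_{\mathbb R}e^{-i\lambda\eta}R_j^\epsilon(\lambda)f^\lambda(\xi)\,d\lambda,\qquad R_j^{*\epsilon} f(\xi,\eta)=\frac1{2\pi}\int_{\mathbb R}e^{-i\lambda\eta}R_j^{*\epsilon}(\lambda)f^\lambda(\xi)\,d\lambda .$$ **Proposition.** Put $$T_\epsilon^{(z,t)}f(\xi,\eta)=\int_{\epsilon<|r|<1/\epsilon}f\Big(\xi+ry,\ \eta-r\,x\cdot\xi-r^2\big(t+\tfrac{x\cdot y}{2}\big)\Big)\frac{dr}{r}.$$ For all $\epsilon>0$, $f\in L^2(\mathbb R^n\times\mathbb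 R)$ and $(\xi,\eta)\in\mathbb R^n\times\mathbb R$, the integral $T_\epsilon^{(z,t)}f(\xi,\eta)$ converges absolutely for almost every $(z,t)$, the $\lambda$-integrals defining $R_j^\epsilon f(\xi,\eta)$ and $R_j^{*\epsilon}f(\xi,\eta)$ converge absolutely, and $$R_j^\epsilon f(\xi,\eta)=\frac1{\sqrt\pi}\int_{\mathbb H^n}T_\epsilon^{(z,t)}f(\xi,\eta)\,\tilde Z_jp_1(z,t)\,dz\,dt,\qquad R_j^{*\epsilon} f(\xi,\eta)=\frac1{\sqrt\pi}\int_{\mathbb H^n}T_\epsilon^{(z,t)}f(\xi,\eta)\,\tilde Z_j^*p_1(z,t)\,dz\,dt,$$ with absolutely convergent integrals on the right. -/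

import Mathlib

open MeasureTheory Filter Topology

noncomputable section

namespace Grushin

/-- `ℝⁿ` with its Euclidean structure and Lebesgue measure. -/
abbrev RSpace (n : ℕ) : Type := EuclideanSpace ℝ (Fin n)

/-- The Heisenberg group `ℍⁿ = ℂⁿ × ℝ` as a manifold: the point `(x, y, t)` stands for
`(z, t)` with `z = x + iy`. The measure `dz dt` is Lebesgue measure `dx dy dt`. -/
abbrev Heis (n : ℕ) : Type := RSpace n × RSpace n × ℝ

variable {n : ℕ}

/-! ### Differential operators on the Heisenberg group -/

section HeisenbergOperators

variable {V : Type*} [NormedAddCommGroup V] [NormedSpace ℝ V]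

/-- `∂/∂x_j`. -/
def dx (j : Fin n) (g : Heis n → V) (h : Heis n) : V :=
  lineDeriv ℝ g h (EuclideanSpace.single j (1 : ℝ), 0, 0)

/-- `∂/∂y_j`. -/
def dy (j : Fin n) (g : Heis n → V) (h : Heis n) : V :=
  lineDeriv ℝ g h (0, EuclideanSpace.single j (1 : ℝ), 0)

/-- `∂/∂t`. -/
def dt (g : Heis n → V) (h : Heis n) : V :=
  lineDeriv ℝ g h (0, 0, 1)

/-- `X_j = ∂/∂x_j + (y_j/2) ∂/∂t`. -/
def fieldX (j : Fin n) (g : Heis n → V) (h : Heis n) : V :=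
  dx j g h + (h.2.1 j / 2) • dt g h

/-- `Y_j = ∂/∂y_j - (x_j/2) ∂/∂t`. -/
def fieldY (j : Fin n) (g : Heis n → V) (h : Heis n) : V :=
  dy j g h - (h.1 j / 2) • dt g h

/-- The sub-Laplacian `ℒ = ∑_j (X_j² + Y_j²)`. -/
def subLaplacian (g : Heis n → V) (h : Heis n) : V :=
  ∑ j : Fin n, (fieldX j (fieldX j g) h + fieldY j (fieldY j g) h)

/-- `X̃_j = ∂/∂x_j - (y_j/2) ∂/∂t`. -/
def fieldXTilde (j : Fin n) (g : Heis n → V) (h : Heis n) : V :=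
  dx j g h - (h.2.1 j / 2) • dt g h

/-- `Ỹ_j = ∂/∂y_j + (x_j/2) ∂/∂t`. -/
def fieldYTilde (j : Fin n) (g : Heis n → V) (h : Heis n) : V :=
  dy j g h + (h.1 j / 2) • dt g h

end HeisenbergOperators

/-- `Z̃_j g = i X̃_j g + Ỹ_j g` for real-valued `g`. -/
def fieldZTilde (j : Fin n) (g : Heis n → ℝ) (h : Heis n) : ℂ :=
  Complex.I * ((fieldXTilde j g h : ℝ) : ℂ) + ((fieldYTilde j g h : ℝ) : ℂ)

/-- `Z̃*_j g = i X̃_j g - Ỹ_j g` for real-valued `g`. -/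
def fieldZTildeStar (j : Fin n) (g : Heis n → ℝ) (h : Heis n) : ℂ :=
  Complex.I * ((fieldXTilde j g h : ℝ) : ℂ) - ((fieldYTilde j g h : ℝ) : ℂ)

/-! ### The heat kernel of the sub-Laplacian -/

/-- `q_s(z, λ) = (4π)⁻ⁿ (λ / sinh (λ s))ⁿ exp (-(λ/4) coth (λ s) |z|²)`, for `z = x + iy`.
(The value at the single point `λ = 0`, where the formula is to be read as a limit, plays no
role: the function is only integrated in `λ`.) -/
def heatKernelFourier (s : ℝ) (x y : RSpace n) (l : ℝ) : ℝ :=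
  ((4 * Real.pi) ^ n)⁻¹ * (l / Real.sinh (l * s)) ^ n *
    Real.exp (-(1 / 4) * l * (Real.cosh (l * s) / Real.sinh (l * s)) * (‖x‖ ^ 2 + ‖y‖ ^ 2))

/-- The heat kernel `p_s(z, t) = (2π)⁻¹ ∫ e^{-iλt} q_s(z, λ) dλ`; as `q_s(z, λ)` is real and even
in `λ`, the exponential is a cosine. -/
def heatKernel (n : ℕ) (s : ℝ) (h : Heis n) : ℝ :=
  (2 * Real.pi)⁻¹ * ∫ l : ℝ, Real.cos (l * h.2.2) * heatKernelFourier s h.1 h.2.1 l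

/-- `K` is a heat kernel of the sub-Laplacian: a classical solution of `∂_s K = ℒ K` on
`(0, ∞) × ℍⁿ`, bounded in `L¹`, with initial value the Dirac mass at the identity. -/
structure IsHeatKernel (K : ℝ → Heis n → ℝ) : Prop where
  contDiff : ∀ s > 0, ContDiff ℝ 2 (K s)
  heat_equation : ∀ s > 0, ∀ h, HasDerivAt (fun s' => K s' h) (subLaplacian (K s) h) s
  integrable : ∀ s > 0, Integrable (K s)
  bounded : ∃ C : ℝ, ∀ s > 0, ∫ h, |K s h| ≤ C
  initial : ∀ φ : Heis n → ℝ, Continuous φ → (∃ C : ℝ, ∀ h, |φ h| ≤ C) →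
    Tendsto (fun s => ∫ h, K s h * φ h) (𝓝[>] 0) (𝓝 (φ 0))

/-! ### The scaled Hermite semigroup -/

/-- The `L²(ℝ)`-normalized Hermite functions
`h_k(u) = (2ᵏ k! √π)^{-1/2} H_k(u) e^{-u²/2}`. Mathlib's `hermite` is the probabilists'
polynomial `He_k`, and `H_k(u) = 2^{k/2} He_k(√2 u)`. -/
def hermiteFun (k : ℕ) (u : ℝ) : ℝ :=
  (Real.sqrt (k.factorial * Real.sqrt Real.pi))⁻¹ *
    Polynomial.aeval (Real.sqrt 2 * u) (Polynomial.hermite k) * Real.exp (-u ^ 2 / 2)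

/-- The scaled Hermite functions `Φ_α^λ(ξ) = |λ|^{n/4} ∏_i h_{α_i}(|λ|^{1/2} ξ_i)`, which for
`λ ≠ 0` form an orthonormal basis of `L²(ℝⁿ)` of eigenfunctions of `H(λ) = -Δ + λ²|ξ|²`, with
eigenvalues `(2|α| + n)|λ|`. -/
def scaledHermite (l : ℝ) (α : Fin n → ℕ) (ξ : RSpace n) : ℝ :=
  |l| ^ ((n : ℝ) / 4) * ∏ i, hermiteFun (α i) (Real.sqrt |l| * ξ i)

/-- The Hermite semigroup
`e^{-rH(λ)} φ = ∑_α e^{-(2|α| + n)|λ| r} (φ, Φ_α^λ) Φ_α^λ`; for `r > 0`, `λ ≠ 0` and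
`φ ∈ L²(ℝⁿ)` the series converges absolutely at every point. -/
def hermiteSemigroup (r l : ℝ) (φ : RSpace n → ℂ) (ξ : RSpace n) : ℂ :=
  ∑' α : Fin n → ℕ, (Real.exp (-((2 * ∑ i, (α i : ℝ)) + n) * |l| * r) : ℂ) *
    (∫ ξ' : RSpace n, φ ξ' * (scaledHermite l α ξ' : ℂ)) * (scaledHermite l α ξ : ℂ)

/-- `A_j(λ) = -∂/∂ξ_j + λ ξ_j`. -/
def creation (l : ℝ) (j : Fin n) (g : RSpace n → ℂ) (ξ : RSpace n) : ℂ :=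
  -lineDeriv ℝ g ξ (EuclideanSpace.single j (1 : ℝ)) + (l : ℂ) * (ξ j : ℂ) * g ξ

/-- `A_j(λ)* = ∂/∂ξ_j + λ ξ_j`. -/
def annihilation (l : ℝ) (j : Fin n) (g : RSpace n → ℂ) (ξ : RSpace n) : ℂ :=
  lineDeriv ℝ g ξ (EuclideanSpace.single j (1 : ℝ)) + (l : ℂ) * (ξ j : ℂ) * g ξ

/-- `π^{-1/2} ∫_{ε²}^{1/ε²} e^{-rH(λ)} φ r^{-1/2} dr`, the truncation of `H(λ)^{-1/2} φ`. -/
def truncatedInvSqrt (ε l : ℝ) (φ : RSpace n → ℂ) (ξ : RSpace n) : ℂ :=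
  ((Real.sqrt Real.pi)⁻¹ : ℂ) *
    ∫ r in Set.Ioo (ε ^ 2) (1 / ε ^ 2), hermiteSemigroup r l φ ξ * ((r ^ (-(1 / 2) : ℝ) : ℝ) : ℂ)

/-- `R_j^ε(λ) = A_j(λ) π^{-1/2} ∫_{ε²}^{1/ε²} e^{-rH(λ)} r^{-1/2} dr`. -/
def hermiteRiesz (ε l : ℝ) (j : Fin n) (φ : RSpace n → ℂ) : RSpace n → ℂ :=
  creation l j (truncatedInvSqrt ε l φ)

/-- `R_j^{*ε}(λ) = A_j(λ)* π^{-1/2} ∫_{ε²}^{1/ε²} e^{-rH(λ)} r^{-1/2} dr`. -/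
def hermiteRieszStar (ε l : ℝ) (j : Fin n) (φ : RSpace n → ℂ) : RSpace n → ℂ :=
  annihilation l j (truncatedInvSqrt ε l φ)

/-! ### Truncated Riesz transforms for the Grushin operator -/

/-- `F(ξ, λ)` is the partial inverse Fourier transform `∫ f(ξ, η) e^{iλη} dη` of `f` in the sense
of `L²(ℝⁿ × ℝ)`, that is, the `L²`-limit of the integrals over `-N < η < N`. -/
def IsPartialFourier (f F : RSpace n × ℝ → ℂ) : Prop :=
  MemLp F 2 ∧
    Tendsto (fun N : ℕ => eLpNorm (fun p : RSpace n × ℝ =>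
      (∫ η in Set.Ioo (-(N : ℝ)) N, f (p.1, η) * Complex.exp (Complex.I * p.2 * η)) - F p)
        2 volume) atTop (𝓝 0)

open Classical in
/-- The partial inverse Fourier transform `f^λ(ξ) = ∫ f(ξ, η) e^{iλη} dη` of `f ∈ L²(ℝⁿ × ℝ)`
(unique almost everywhere; it exists for every such `f` by Plancherel's theorem). -/
def partialFourier (f : RSpace n × ℝ → ℂ) (l : ℝ) (ξ : RSpace n) : ℂ :=
  if h : ∃ F, IsPartialFourier f F then h.choose (ξ, l) else 0

/-- The integrand `e^{-iλη} R_j^ε(λ) f^λ(ξ)`. -/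
def rieszIntegrand (ε : ℝ) (j : Fin n) (f : RSpace n × ℝ → ℂ) (ξ : RSpace n) (η l : ℝ) : ℂ :=
  Complex.exp (-Complex.I * l * η) * hermiteRiesz ε l j (partialFourier f l) ξ

/-- The integrand `e^{-iλη} R_j^{*ε}(λ) f^λ(ξ)`. -/
def rieszStarIntegrand (ε : ℝ) (j : Fin n) (f : RSpace n × ℝ → ℂ) (ξ : RSpace n) (η l : ℝ) : ℂ :=
  Complex.exp (-Complex.I * l * η) * hermiteRieszStar ε l j (partialFourier f l) ξ

/-- `R_j^ε f(ξ, η) = (2π)⁻¹ ∫ e^{-iλη} R_j^ε(λ) f^λ(ξ) dλ`. -/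
def truncatedRiesz (ε : ℝ) (j : Fin n) (f : RSpace n × ℝ → ℂ) (ξ : RSpace n) (η : ℝ) : ℂ :=
  ((2 * Real.pi : ℝ) : ℂ)⁻¹ * ∫ l : ℝ, rieszIntegrand ε j f ξ η l

/-- `R_j^{*ε} f(ξ, η) = (2π)⁻¹ ∫ e^{-iλη} R_j^{*ε}(λ) f^λ(ξ) dλ`. -/
def truncatedRieszStar (ε : ℝ) (j : Fin n) (f : RSpace n × ℝ → ℂ) (ξ : RSpace n) (η : ℝ) : ℂ :=
  ((2 * Real.pi : ℝ) : ℂ)⁻¹ * ∫ l : ℝ, rieszStarIntegrand ε j f ξ η l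

/-! ### Truncated Hilbert transforms along curves -/

/-- The set `{r : ε < |r| < 1/ε}`. -/
def truncationSet (ε : ℝ) : Set ℝ := {r | ε < |r| ∧ |r| < 1 / ε}

/-- The integrand `f(ξ + r y, η - r x·ξ - r² (t + x·y/2)) / r`. -/
def hilbertIntegrand (h : Heis n) (f : RSpace n × ℝ → ℂ) (ξ : RSpace n) (η r : ℝ) : ℂ :=
  f (ξ + r • h.2.1,
    η - r * inner ℝ h.1 ξ - r ^ 2 * (h.2.2 + inner ℝ h.1 h.2.1 / 2)) / (r : ℂ)

/-- `T_ε^{(z,t)} f(ξ, η) = ∫_{ε < |r| < 1/ε} f(ξ + r y, η - r x·ξ - r² (t + x·y/2)) dr/r`. -/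
def truncatedHilbert (ε : ℝ) (h : Heis n) (f : RSpace n × ℝ → ℂ) (ξ : RSpace n) (η : ℝ) : ℂ :=
  ∫ r in truncationSet ε, hilbertIntegrand h f ξ η r

end Grushin

end

/-!
# Truncated Riesz transforms for the Grushin operator as averages of Hilbert transforms

**The heat kernel.** Up to the normalization, `p_s(z, t)` is an oscillatory integral
`∫ g(λ) e^{-iλt - C(λ)|z|²/4} dλ` with `C(λ) = λ coth (λs)` and rapidly decreasing `g` (`oscInt`).
Derivatives of such integrals are again of this kind, with `g` replaced by `C g` or `-iλ g`, so
smoothness is an induction, and the heat equation reduces to the ordinary differential equations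
in `s` satisfied by `λ coth (λs)` and `λ / sinh (λs)`. The integrand continues holomorphically to
a strip around the real axis on which `Re (λ coth λ) ≥ 1/2`; Cauchy estimates for its second
derivative give the decay `e^{-|z|²/8} (1 + t²)⁻¹` of `p₁` and of its derivatives
(`exists_norm_oscInt_le`), and the remaining properties of the heat kernel follow from the
homogeneity of `p_s` under the Heisenberg dilations (`isHeatKernel_heatKernel`).

**The representation formulas.** The two formulas are treated together, with a sign `σ = ±1`
(`integrable_and_representation`).
* Fubini's theorem moves the integral in `r` outside. Joint integrability holds because the change
  of variables `(x, y, t) ↦ (x, ξ + r y, η - r x·ξ - r² (t + x·y/2))` multiplies Lebesgue measure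
  by a constant, so that `|f|²` integrates to a finite value against a weight depending on `x` only.
* For fixed `r`, this change of variables and Parseval's formula in the last variable
  (`integral_mul_eq_integral_partialFourier`) turn the integral over the Heisenberg group into an
  integral of `f^λ(ξ')` against the `x`-integral of the Fourier transform of `Z̃_j p₁` in `t`. That
  integral is Gaussian, and its value is `r` times the kernel of `A_j(λ) e^{-r²H(λ)}`, up to a
  constant (`integral_rieszFiber`).
* Mehler's formula identifies the kernel of the Hermite semigroup
  (`hermiteSemigroup_eq_integral`). The Gaussian bounds on the kernel of `A_j(λ) e^{-sH(λ)}`, which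
  are uniform for `ε² < s < ε⁻²`, permit differentiation under the integral sign and the
  interchange of the integrals in `λ` and `s` (`lineDeriv_truncatedInvSqrt_add`,
  `integral_integral_rieszTriple`).
* The substitution `s = r²` identifies both sides (`setIntegral_truncationSet_comp_sq`).
-/

noncomputable section

namespace Grushin

variable {n : ℕ}

/-! ### The functions `z / sinh z` and `z coth z` on a horizontal strip -/

/-- `z / sinh z`, with the value `1` at `0`. -/
def zDivSinh (z : ℂ) : ℂ := (dslope Complex.sinh 0 z)⁻¹

/-- `z coth z`, with the value `1` at `0`. -/
def zCoth (z : ℂ) : ℂ := Complex.cosh z * zDivSinh z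

/-- The open horizontal strip `|Im z| < δ`. -/
def strip (δ : ℝ) : Set ℂ := {z | |z.im| < δ}

lemma zDivSinh_of_ne {z : ℂ} (hz : z ≠ 0) : zDivSinh z = z / Complex.sinh z := by
  simp [zDivSinh, dslope_of_ne _ hz, slope_def_field]

lemma zDivSinh_zero : zDivSinh 0 = 1 := by
  simp [zDivSinh, Complex.deriv_sinh]

lemma isOpen_strip (δ : ℝ) : IsOpen (strip δ) :=
  isOpen_lt (by fun_prop) continuous_const

lemma norm_sinh_sq (z : ℂ) :
    ‖Complex.sinh z‖ ^ 2 = Real.sinh z.re ^ 2 + Real.sin z.im ^ 2 := by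
  have h : Complex.sinh z = ⟨Real.sinh z.re * Real.cos z.im, Real.cosh z.re * Real.sin z.im⟩ := by
    conv_lhs => rw [← Complex.re_add_im z, Complex.sinh_add, Complex.cosh_mul_I, Complex.sinh_mul_I]
    apply Complex.ext <;> simp [← Complex.ofReal_sinh, ← Complex.ofReal_cosh, ← Complex.ofReal_cos,
      ← Complex.ofReal_sin]
  rw [← Complex.normSq_eq_norm_sq, h, Complex.normSq_mk]
  have h1 := Real.cosh_sq z.re
  have h2 := Real.sin_sq_add_cos_sq z.im
  linear_combination Real.sin z.im ^ 2 * h1 + Real.sinh z.re ^ 2 * h2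

lemma norm_cosh_sq (z : ℂ) :
    ‖Complex.cosh z‖ ^ 2 = Real.sinh z.re ^ 2 + Real.cos z.im ^ 2 := by
  have h : Complex.cosh z = ⟨Real.cosh z.re * Real.cos z.im, Real.sinh z.re * Real.sin z.im⟩ := by
    conv_lhs => rw [← Complex.re_add_im z, Complex.cosh_add, Complex.cosh_mul_I, Complex.sinh_mul_I]
    apply Complex.ext <;> simp [← Complex.ofReal_sinh, ← Complex.ofReal_cosh, ← Complex.ofReal_cos,
      ← Complex.ofReal_sin]
  rw [← Complex.normSq_eq_norm_sq, h, Complex.normSq_mk]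
  have h1 := Real.cosh_sq z.re
  have h2 := Real.sin_sq_add_cos_sq z.im
  linear_combination Real.cos z.im ^ 2 * h1 + Real.sinh z.re ^ 2 * h2

lemma sq_le_sinh_sq (a : ℝ) : a ^ 2 ≤ Real.sinh a ^ 2 := by
  rw [sq_le_sq, Real.abs_sinh]
  exact Real.self_le_sinh_iff.2 (abs_nonneg a)

lemma sq_le_four_mul_sin_sq {b : ℝ} (hb : |b| ≤ 1) : b ^ 2 ≤ 4 * Real.sin b ^ 2 := by
  have hpi := Real.pi_gt_three
  have h1 : 2 / Real.pi * |b| ≤ Real.sin |b| := Real.mul_le_sin (abs_nonneg b) (by linarith)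
  have h2 : (1 : ℝ) / 2 ≤ 2 / Real.pi := by
    rw [div_le_div_iff₀ (by norm_num) (by positivity)]
    linarith [Real.pi_le_four]
  have h3 : 1 / 2 * |b| ≤ Real.sin |b| :=
    (mul_le_mul_of_nonneg_right h2 (abs_nonneg b)).trans h1
  have h4 : Real.sin |b| ^ 2 = Real.sin b ^ 2 := by
    rcases abs_choice b with h | h <;> simp [h]
  rw [← h4, ← sq_abs b]
  nlinarith [abs_nonneg b]

lemma norm_le_two_mul_norm_sinh {z : ℂ} (hz : |z.im| ≤ 1) : ‖z‖ ≤ 2 * ‖Complex.sinh z‖ := by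
  refine abs_le_of_sq_le_sq' ?_ (by positivity) |>.2
  rw [mul_pow, norm_sinh_sq, ← Complex.normSq_eq_norm_sq, Complex.normSq_apply]
  nlinarith [sq_le_sinh_sq z.re, sq_le_four_mul_sin_sq hz, sq_nonneg (Real.sinh z.re)]

lemma sinh_ne_zero {z : ℂ} (hz : |z.im| ≤ 1) (h0 : z ≠ 0) : Complex.sinh z ≠ 0 := by
  intro h
  have := norm_le_two_mul_norm_sinh hz
  rw [h] at this
  simp at this
  exact h0 this

lemma norm_zDivSinh_le {z : ℂ} (hz : |z.im| ≤ 1) : ‖zDivSinh z‖ ≤ 2 := by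
  by_cases h0 : z = 0
  · simp [h0, zDivSinh_zero]
  · rw [zDivSinh_of_ne h0, norm_div, div_le_iff₀ (norm_pos_iff.2 (sinh_ne_zero hz h0))]
    exact norm_le_two_mul_norm_sinh hz

lemma differentiableOn_zDivSinh : DifferentiableOn ℂ zDivSinh (strip 1) := by
  have h : DifferentiableOn ℂ (dslope Complex.sinh 0) (strip 1) :=
    (Complex.differentiableOn_dslope ((isOpen_strip 1).mem_nhds (by simp [strip]))).2
      Complex.differentiable_sinh.differentiableOn
  refine h.inv fun z hz => ?_
  by_cases h0 : z = 0
  · simp [h0, Complex.deriv_sinh]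
  · have hz' : |z.im| < 1 := hz
    simp [dslope_of_ne _ h0, slope_def_field, h0, sinh_ne_zero hz'.le h0]

lemma differentiableOn_zCoth : DifferentiableOn ℂ zCoth (strip 1) :=
  Complex.differentiable_cosh.differentiableOn.mul differentiableOn_zDivSinh

lemma norm_zCoth_le {z : ℂ} (hz : |z.im| ≤ 1) : ‖zCoth z‖ ≤ ‖z‖ + 2 := by
  by_cases h0 : z = 0
  · simp [h0, zDivSinh_zero, zCoth]
  have hs := norm_pos_iff.2 (sinh_ne_zero hz h0)
  have hc : ‖Complex.cosh z‖ ≤ ‖Complex.sinh z‖ + 1 := by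
    refine abs_le_of_sq_le_sq' ?_ (by positivity) |>.2
    have := norm_sinh_sq z
    rw [norm_cosh_sq]
    nlinarith [sq_nonneg (Real.sin z.im), Real.cos_sq_le_one z.im]
  have h2 := norm_zDivSinh_le hz
  rw [zCoth, zDivSinh_of_ne h0] at *
  rw [norm_mul, norm_div] at *
  calc ‖Complex.cosh z‖ * (‖z‖ / ‖Complex.sinh z‖)
      ≤ (‖Complex.sinh z‖ + 1) * (‖z‖ / ‖Complex.sinh z‖) := by gcongr
    _ = ‖z‖ + ‖z‖ / ‖Complex.sinh z‖ := by field_simp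
    _ ≤ _ := by gcongr

/-- On the strip `|Im z| ≤ 1` the factor `e^{-w z coth z / 4}` still decays in `w > 0`. -/
lemma half_le_re_zCoth {z : ℂ} (hz : |z.im| ≤ 1) : 1 / 2 ≤ (zCoth z).re := by
  by_cases h0 : z = 0
  · simp [h0, zDivSinh_zero, zCoth]; norm_num
  have hs := sinh_ne_zero hz h0
  have hs' : 0 < ‖Complex.sinh z‖ ^ 2 := by positivity
  have key : (zCoth z).re * ‖Complex.sinh z‖ ^ 2 =
      z.re * Real.sinh z.re * Real.cosh z.re + z.im * Real.sin z.im * Real.cos z.im := by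
    have h1 : zCoth z * (‖Complex.sinh z‖ ^ 2 : ℝ) =
        z * (Complex.cosh z * (starRingEnd ℂ) (Complex.sinh z)) := by
      rw [zCoth, zDivSinh_of_ne h0, ← Complex.normSq_eq_norm_sq, Complex.normSq_eq_conj_mul_self]
      field_simp
    have h2 : Complex.cosh z * (starRingEnd ℂ) (Complex.sinh z) =
        ⟨Real.sinh z.re * Real.cosh z.re, -(Real.sin z.im * Real.cos z.im)⟩ := by
      conv_lhs => rw [← Complex.re_add_im z, Complex.cosh_add, Complex.sinh_add,
        Complex.cosh_mul_I, Complex.sinh_mul_I]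
      have e1 := Real.cosh_sq z.re
      have e2 := Real.sin_sq_add_cos_sq z.im
      apply Complex.ext <;> simp [← Complex.ofReal_sinh, ← Complex.ofReal_cosh,
        ← Complex.ofReal_cos, ← Complex.ofReal_sin]
      · linear_combination Real.sinh z.re * Real.cosh z.re * e2
      · linear_combination (-Real.sin z.im * Real.cos z.im) * e1
    have h3 := congrArg Complex.re h1
    rw [h2, Complex.re_mul_ofReal] at h3
    rw [h3]; simp; ring
  rw [← mul_le_mul_iff_left₀ hs', key, norm_sinh_sq]
  have hre : Real.sinh z.re ^ 2 ≤ z.re * Real.sinh z.re * Real.cosh z.re := by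
    have aux : ∀ a : ℝ, 0 ≤ a → Real.sinh a ≤ a * Real.cosh a := by
      intro a ha
      have : MonotoneOn (fun a => a * Real.cosh a - Real.sinh a) (Set.Ici 0) := by
        refine monotoneOn_of_deriv_nonneg (convex_Ici 0) (by fun_prop) (by fun_prop) ?_
        intro x hx
        simp at hx
        have hd : HasDerivAt (fun a => a * Real.cosh a - Real.sinh a)
            (1 * Real.cosh x + x * Real.sinh x - Real.cosh x) x :=
          ((hasDerivAt_id x).mul (Real.hasDerivAt_cosh x)).sub (Real.hasDerivAt_sinh x)
        rw [hd.deriv]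
        have := Real.sinh_nonneg_iff.2 hx.le
        nlinarith
      have := this (Set.mem_Ici.2 le_rfl) (Set.mem_Ici.2 ha) ha
      simp at this
      linarith
    rcases le_total 0 z.re with h | h
    · nlinarith [aux _ h, Real.sinh_nonneg_iff.2 h]
    · have h5 := aux (-z.re) (by linarith)
      rw [Real.sinh_neg, Real.cosh_neg] at h5
      nlinarith [Real.sinh_nonpos_iff.2 h]
  have him : 1 / 2 * Real.sin z.im ^ 2 ≤ z.im * Real.sin z.im * Real.cos z.im := by
    have hcos : 1 / 2 ≤ Real.cos z.im := by
      have := Real.one_sub_sq_div_two_le_cos (x := z.im)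
      have h1 : z.im ^ 2 ≤ 1 := by rw [← sq_abs]; nlinarith [abs_nonneg z.im]
      linarith
    have hpi := Real.pi_gt_three
    have hab := abs_le.1 hz
    have h6 : Real.sin z.im ^ 2 ≤ z.im * Real.sin z.im := by
      rcases le_total 0 z.im with h | h
      · nlinarith [Real.sin_le h, Real.sin_nonneg_of_nonneg_of_le_pi h (by linarith)]
      · have h7 := Real.sin_le (x := -z.im) (by linarith)
        have h8 := Real.sin_nonneg_of_nonneg_of_le_pi (x := -z.im) (by linarith) (by linarith)
        rw [Real.sin_neg] at h7 h8
        nlinarith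
    nlinarith [sq_nonneg (Real.sin z.im)]
  nlinarith [sq_nonneg (Real.sinh z.re)]

lemma pow_le_mul_sinh (k : ℕ) {x : ℝ} (hx : 0 ≤ x) :
    x ^ (k + 1) ≤ 2 * (k + 1).factorial * Real.sinh x := by
  have h1 := Real.sum_le_exp_of_nonneg hx (k + 2)
  have h2 : 1 + x ^ (k + 1) / (k + 1).factorial ≤
      ∑ i ∈ Finset.range (k + 2), x ^ i / i.factorial := by
    rw [Finset.sum_range_succ, Finset.sum_range_succ']
    have : 0 ≤ ∑ i ∈ Finset.range k, x ^ (i + 1) / ((i + 1).factorial : ℝ) :=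
      Finset.sum_nonneg fun i _ => by positivity
    simp only [pow_zero, Nat.factorial_zero, Nat.cast_one, div_one]
    linarith
  have h3 : Real.exp (-x) ≤ 1 := Real.exp_le_one_iff.2 (by linarith)
  have h4 : x ^ (k + 1) / (k + 1).factorial ≤ 2 * Real.sinh x := by
    rw [Real.sinh_eq]; linarith
  rw [div_le_iff₀ (by positivity)] at h4
  linarith

/-- `z / sinh z` decays faster than any power of `|Re z|`, uniformly on the strip. -/
lemma exists_norm_zDivSinh_le (k : ℕ) :
    ∃ K : ℝ, 0 ≤ K ∧ ∀ z : ℂ, |z.im| ≤ 1 → (1 + |z.re|) ^ k * ‖zDivSinh z‖ ≤ K := by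
  -- `|z / sinh z| ≤ 2` settles `|Re z| ≤ 1`; elsewhere `|sinh z| ≥ sinh |Re z|`.
  refine ⟨2 ^ (k + 1) * (2 * (k + 1).factorial), by positivity, fun z hz => ?_⟩
  have hf : (1 : ℝ) ≤ (k + 1).factorial := by exact_mod_cast Nat.succ_le_of_lt (Nat.factorial_pos _)
  by_cases h1 : |z.re| ≤ 1
  · calc (1 + |z.re|) ^ k * ‖zDivSinh z‖ ≤ (1 + 1) ^ k * 2 := by
          gcongr; exact norm_zDivSinh_le hz
      _ ≤ 2 ^ (k + 1) * (2 * (k + 1).factorial) := by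
          rw [show (1 + 1 : ℝ) = 2 by norm_num, ← pow_succ]
          exact le_mul_of_one_le_right (by positivity) (by linarith)
  · push Not at h1
    have h0 : z ≠ 0 := by rintro rfl; simp at h1; linarith
    have hs := norm_pos_iff.2 (sinh_ne_zero hz h0)
    have hsl : Real.sinh |z.re| ≤ ‖Complex.sinh z‖ := by
      refine abs_le_of_sq_le_sq' ?_ (by positivity) |>.2
      rw [norm_sinh_sq, ← Real.abs_sinh, sq_abs]
      nlinarith [sq_nonneg (Real.sin z.im)]
    rw [zDivSinh_of_ne h0, norm_div, ← mul_div_assoc, div_le_iff₀ hs]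
    have hz1 : ‖z‖ ≤ 1 + |z.re| := by
      have := Complex.norm_le_abs_re_add_abs_im z; linarith
    calc (1 + |z.re|) ^ k * ‖z‖ ≤ (1 + |z.re|) ^ k * (1 + |z.re|) := by gcongr
      _ = (1 + |z.re|) ^ (k + 1) := by ring
      _ ≤ (2 * |z.re|) ^ (k + 1) := by gcongr; linarith
      _ = 2 ^ (k + 1) * |z.re| ^ (k + 1) := by ring
      _ ≤ 2 ^ (k + 1) * (2 * (k + 1).factorial * Real.sinh |z.re|) := by
          gcongr; exact pow_le_mul_sinh k (abs_nonneg _)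
      _ ≤ 2 ^ (k + 1) * (2 * (k + 1).factorial * ‖Complex.sinh z‖) := by gcongr
      _ = _ := by ring

/-! ### Decay of Fourier integrals of functions holomorphic in a strip -/

/-- Cauchy's estimate: a bound decaying like `(1 + |Re z|)⁻²` on a strip passes to the derivative
on the strip of half the width. -/
lemma strip_deriv_bound {H : ℂ → ℂ} {δ M : ℝ} (hδ : 0 < δ) (hδ1 : δ ≤ 1)
    (hd : DifferentiableOn ℂ H (strip δ))
    (hb : ∀ z ∈ strip δ, (1 + |z.re|) ^ 2 * ‖H z‖ ≤ M) :
    DifferentiableOn ℂ (deriv H) (strip (δ / 2)) ∧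
      ∀ z ∈ strip (δ / 2), (1 + |z.re|) ^ 2 * ‖deriv H z‖ ≤ 12 / δ * M := by
  constructor
  · refine (hd.deriv (isOpen_strip δ)).mono fun z hz => ?_
    have : |z.im| < δ / 2 := hz
    exact show |z.im| < δ by linarith
  · intro z hz
    have hz' : |z.im| < δ / 2 := hz
    have hball : ∀ w ∈ Metric.closedBall z (δ / 3), w ∈ strip δ := by
      intro w hw
      rw [Metric.mem_closedBall, dist_eq_norm] at hw
      have h1 := (Complex.abs_im_le_norm (w - z)).trans hw
      rw [Complex.sub_im] at h1
      have h2 := abs_sub_abs_le_abs_sub w.im z.im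
      exact show |w.im| < δ by linarith
    have hM : 0 ≤ M := le_trans (by positivity)
      (hb z (hball z (Metric.mem_closedBall_self (by positivity))))
    have key : ‖deriv H z‖ ≤ (4 * M / (1 + |z.re|) ^ 2) / (δ / 3) := by
      refine Complex.norm_deriv_le_of_forall_mem_sphere_norm_le (by positivity) ?_ ?_
      · refine DifferentiableOn.diffContOnCl ?_
        rw [closure_ball _ (by positivity)]
        exact hd.mono hball
      · intro w hw
        have hw1 := Metric.sphere_subset_closedBall hw
        have h3 := hb w (hball w hw1)
        rw [Metric.mem_closedBall, dist_eq_norm] at hw1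
        have h1 := (Complex.abs_re_le_norm (w - z)).trans hw1
        rw [Complex.sub_re] at h1
        have h2 := abs_sub_abs_le_abs_sub z.re w.re
        rw [abs_sub_comm] at h1
        have h4 : 1 + |z.re| ≤ 2 * (1 + |w.re|) := by linarith [abs_nonneg w.re]
        rw [le_div_iff₀ (by positivity)]
        calc ‖H w‖ * (1 + |z.re|) ^ 2 ≤ ‖H w‖ * (2 * (1 + |w.re|)) ^ 2 := by gcongr
          _ = 4 * ((1 + |w.re|) ^ 2 * ‖H w‖) := by ring
          _ ≤ 4 * M := by gcongr
    calc (1 + |z.re|) ^ 2 * ‖deriv H z‖ ≤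
          (1 + |z.re|) ^ 2 * ((4 * M / (1 + |z.re|) ^ 2) / (δ / 3)) := by gcongr
      _ = 12 / δ * M := by field_simp; ring

lemma norm_le_inv_one_add_sq {H : ℂ → ℂ} {δ M : ℝ} (hδ : 0 < δ)
    (hb : ∀ z ∈ strip δ, (1 + |z.re|) ^ 2 * ‖H z‖ ≤ M) (x : ℝ) :
    ‖H x‖ ≤ M * (1 + x ^ 2)⁻¹ := by
  have h := hb x (by simpa [strip] using hδ)
  rw [Complex.ofReal_re] at h
  rw [← div_eq_mul_inv, le_div_iff₀ (by positivity)]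
  refine le_trans ?_ h
  rw [mul_comm]
  gcongr
  nlinarith [abs_nonneg x, sq_abs x]

lemma strip_continuous {H : ℂ → ℂ} {δ : ℝ} (hδ : 0 < δ)
    (hd : DifferentiableOn ℂ H (strip δ)) : Continuous fun x : ℝ => H x :=
  hd.continuousOn.comp_continuous Complex.continuous_ofReal (fun x => by simpa [strip] using hδ)

lemma strip_integrable {H : ℂ → ℂ} {δ M : ℝ} (hδ : 0 < δ)
    (hd : DifferentiableOn ℂ H (strip δ))
    (hb : ∀ z ∈ strip δ, (1 + |z.re|) ^ 2 * ‖H z‖ ≤ M) (t : ℝ) :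
    Integrable fun x : ℝ => Complex.exp (-Complex.I * x * t) * H x := by
  refine (integrable_inv_one_add_sq.const_mul M).mono'
    ((Continuous.mul (by fun_prop) (strip_continuous hδ hd)).aestronglyMeasurable)
    (ae_of_all _ fun x => ?_)
  have h : ‖Complex.exp (-Complex.I * x * t)‖ = 1 := by
    rw [show -Complex.I * x * t = ((-(x * t) : ℝ) : ℂ) * Complex.I by push_cast; ring]
    exact Complex.norm_exp_ofReal_mul_I _
  rw [norm_mul, h, one_mul]
  exact norm_le_inv_one_add_sq hδ hb x

lemma strip_norm_integral_le {H : ℂ → ℂ} {δ M : ℝ} (hδ : 0 < δ)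
    (hb : ∀ z ∈ strip δ, (1 + |z.re|) ^ 2 * ‖H z‖ ≤ M) (t : ℝ) :
    ‖∫ x : ℝ, Complex.exp (-Complex.I * x * t) * H x‖ ≤ M * Real.pi := by
  rw [← integral_univ_inv_one_add_sq, ← integral_const_mul]
  refine norm_integral_le_of_norm_le (integrable_inv_one_add_sq.const_mul M)
    (ae_of_all _ fun x => ?_)
  have h : ‖Complex.exp (-Complex.I * x * t)‖ = 1 := by
    rw [show -Complex.I * x * t = ((-(x * t) : ℝ) : ℂ) * Complex.I by push_cast; ring]
    exact Complex.norm_exp_ofReal_mul_I _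
  rw [norm_mul, h, one_mul]
  exact norm_le_inv_one_add_sq hδ hb x

/-- Integration by parts against `e^{-ixt}`. -/
lemma strip_integral_deriv {H : ℂ → ℂ} {δ M : ℝ} (hδ : 0 < δ) (hδ1 : δ ≤ 1)
    (hd : DifferentiableOn ℂ H (strip δ))
    (hb : ∀ z ∈ strip δ, (1 + |z.re|) ^ 2 * ‖H z‖ ≤ M) (t : ℝ) :
    ∫ x : ℝ, Complex.exp (-Complex.I * x * t) * deriv H x =
      Complex.I * t * ∫ x : ℝ, Complex.exp (-Complex.I * x * t) * H x := by
  obtain ⟨hd', hb'⟩ := strip_deriv_bound hδ hδ1 hd hb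
  have hH : ∀ x : ℝ, HasDerivAt (fun x : ℝ => H x) (deriv H x) x := fun x =>
    ((hd.differentiableAt ((isOpen_strip δ).mem_nhds
      (by simpa [strip] using hδ))).hasDerivAt).comp_ofReal
  have he : ∀ x : ℝ, HasDerivAt (fun x : ℝ => Complex.exp (-Complex.I * x * t))
      (Complex.exp (-Complex.I * x * t) * (-Complex.I * t)) x := fun x => by
    have : HasDerivAt (fun x : ℝ => -Complex.I * x * t) (-Complex.I * t) x := by
      simpa using ((hasDerivAt_id x).ofReal_comp.const_mul (-Complex.I)).mul_const (t : ℂ)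
    exact this.cexp
  have h1 := strip_integrable hδ hd hb t
  have h2 := strip_integrable (half_pos hδ) hd' hb' t
  have e : ∀ x : ℝ, Complex.exp (-Complex.I * x * t) * (-Complex.I * t) * H x =
      (-Complex.I * t) * (Complex.exp (-Complex.I * x * t) * H x) := fun x => by ring
  rw [integral_mul_deriv_eq_deriv_mul_of_integrable
    (u := fun x : ℝ => Complex.exp (-Complex.I * x * t))
    (v := fun x : ℝ => H x) (u' := fun x => Complex.exp (-Complex.I * x * t) * (-Complex.I * t))
    (v' := fun x => deriv H x) (fun x _ => he x) (fun x _ => hH x) h2 _ h1]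
  · simp_rw [e]
    rw [integral_const_mul]
    ring
  · exact (h1.const_mul (-Complex.I * t)).congr (ae_of_all _ fun x => (e x).symm)

/-- The Fourier integral along `ℝ` of a function that is holomorphic in the strip `|Im z| < 1`
and decays there like `(1 + |Re z|)⁻²` decays like `(1 + t²)⁻¹`. -/
lemma strip_fourier_decay {H : ℂ → ℂ} {M : ℝ}
    (hd : DifferentiableOn ℂ H (strip 1))
    (hb : ∀ z ∈ strip 1, (1 + |z.re|) ^ 2 * ‖H z‖ ≤ M) (t : ℝ) :
    ‖∫ x : ℝ, Complex.exp (-Complex.I * x * t) * H x‖ ≤ 289 * Real.pi * M * (1 + t ^ 2)⁻¹ := by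
  -- Cauchy's estimate costs a factor `12 / δ`, first with `δ = 1` and then with `δ = 1 / 2`, and
  -- `1 + 12 * 24 = 289`.
  obtain ⟨hd1, hb1⟩ := strip_deriv_bound one_pos le_rfl hd hb
  obtain ⟨hd2, hb2⟩ := strip_deriv_bound (by norm_num) (by norm_num) hd1 hb1
  have e1 := strip_integral_deriv one_pos le_rfl hd hb t
  have e2 := strip_integral_deriv (by norm_num) (by norm_num) hd1 hb1 t
  have b0 := strip_norm_integral_le one_pos hb t
  have b2 := strip_norm_integral_le (by norm_num) hb2 t
  have e3 : ‖Complex.I * (t : ℂ)‖ = |t| := by simp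
  rw [e2, e1, norm_mul (Complex.I * t), norm_mul (Complex.I * t), e3, ← mul_assoc,
    abs_mul_abs_self] at b2
  rw [← div_eq_mul_inv, le_div_iff₀ (by positivity)]
  nlinarith

/-! ### Oscillatory integrals on the Heisenberg group -/

/-- A measurable amplitude all of whose polynomial multiples are bounded. -/
structure RapidDecay (g : ℝ → ℂ) : Prop where
  measurable : Measurable g
  bound : ∀ k : ℕ, ∃ K : ℝ, ∀ l, (1 + |l|) ^ k * ‖g l‖ ≤ K

/-- A measurable nonnegative function of at most linear growth. -/
structure LinearGrowth (C : ℝ → ℝ) : Prop where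
  measurable : Measurable C
  nonneg : ∀ l, 0 ≤ C l
  bound : ∃ K : ℝ, 0 ≤ K ∧ ∀ l, C l ≤ K * (1 + |l|)

lemma RapidDecay.bound_two {g : ℝ → ℂ} (hg : RapidDecay g) (k : ℕ) :
    ∃ K : ℝ, 0 ≤ K ∧ ∀ l, (1 + |l|) ^ k * ‖g l‖ ≤ K * (1 + l ^ 2)⁻¹ := by
  obtain ⟨K, hK⟩ := hg.bound (k + 2)
  refine ⟨K, le_trans (by positivity) (hK 0), fun l => ?_⟩
  rw [← div_eq_mul_inv, le_div_iff₀ (by positivity)]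
  refine le_trans ?_ (hK l)
  rw [pow_add, mul_right_comm]
  gcongr
  nlinarith [abs_nonneg l, sq_abs l]

lemma RapidDecay.integrable_mul {g : ℝ → ℂ} (hg : RapidDecay g) (k : ℕ) :
    Integrable fun l => (1 + |l|) ^ k * ‖g l‖ := by
  obtain ⟨K, -, hK⟩ := hg.bound_two k
  refine (integrable_inv_one_add_sq.const_mul K).mono' ?_ (ae_of_all _ fun l => ?_)
  · have := hg.measurable
    exact (by fun_prop : Measurable fun l => (1 + |l|) ^ k * ‖g l‖).aestronglyMeasurable
  · rw [Real.norm_of_nonneg (by positivity)]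
    exact hK l

lemma RapidDecay.integrable {g : ℝ → ℂ} (hg : RapidDecay g) : Integrable g := by
  have := hg.integrable_mul 0
  simp only [pow_zero, one_mul] at this
  exact (integrable_norm_iff hg.measurable.aestronglyMeasurable).1 this

lemma RapidDecay.mul {g u : ℝ → ℂ} (hg : RapidDecay g) (hu : Measurable u) {K : ℝ} {m : ℕ}
    (hK : ∀ l, ‖u l‖ ≤ K * (1 + |l|) ^ m) : RapidDecay fun l => u l * g l := by
  refine ⟨hu.mul hg.measurable, fun k => ?_⟩
  obtain ⟨K', hK'⟩ := hg.bound (k + m)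
  have h0 : 0 ≤ K := by
    have := (norm_nonneg _).trans (hK 0)
    simpa using this
  refine ⟨K * K', fun l => ?_⟩
  calc (1 + |l|) ^ k * ‖u l * g l‖ = (1 + |l|) ^ k * (‖u l‖ * ‖g l‖) := by rw [norm_mul]
    _ ≤ (1 + |l|) ^ k * (K * (1 + |l|) ^ m * ‖g l‖) := by gcongr; exact hK l
    _ = K * ((1 + |l|) ^ (k + m) * ‖g l‖) := by ring
    _ ≤ K * K' := by gcongr; exact hK' l

lemma RapidDecay.mul_freq {g : ℝ → ℂ} (hg : RapidDecay g) :
    RapidDecay fun l => (-Complex.I * l) * g l :=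
  hg.mul (K := 1) (m := 1) (by fun_prop) fun l => by simp

lemma RapidDecay.mul_growth {g : ℝ → ℂ} {C : ℝ → ℝ} (hg : RapidDecay g) (hC : LinearGrowth C) :
    RapidDecay fun l => (C l : ℂ) * g l := by
  obtain ⟨K, -, hK⟩ := hC.bound
  have := hC.measurable
  refine hg.mul (K := K) (m := 1) (by fun_prop) fun l => ?_
  rw [Complex.norm_real, Real.norm_of_nonneg (hC.nonneg l), pow_one]
  exact hK l

/-- The exponent `-iλt - C(λ)|z|²/4`. -/
def oscPhase (C : ℝ → ℝ) (l : ℝ) (h : Heis n) : ℂ :=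
  -Complex.I * l * h.2.2 - C l * ((‖h.1‖ ^ 2 + ‖h.2.1‖ ^ 2 : ℝ) : ℂ) / 4

/-- The oscillatory integral `∫ g(λ) e^{-iλt - C(λ)|z|²/4} dλ`. -/
def oscInt (C : ℝ → ℝ) (g : ℝ → ℂ) (h : Heis n) : ℂ :=
  ∫ l : ℝ, g l * Complex.exp (oscPhase C l h)

lemma norm_exp_oscPhase (C : ℝ → ℝ) (l : ℝ) (h : Heis n) :
    ‖Complex.exp (oscPhase C l h)‖ = Real.exp (-(C l * (‖h.1‖ ^ 2 + ‖h.2.1‖ ^ 2) / 4)) := by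
  have : (oscPhase C l h).re = -(C l * (‖h.1‖ ^ 2 + ‖h.2.1‖ ^ 2) / 4) := by
    rw [oscPhase, Complex.sub_re, show -Complex.I * (l : ℂ) * (h.2.2 : ℂ) =
      ((-(l * h.2.2) : ℝ) : ℂ) * Complex.I by push_cast; ring,
      show (C l : ℂ) * ((‖h.1‖ ^ 2 + ‖h.2.1‖ ^ 2 : ℝ) : ℂ) / 4 =
        ((C l * (‖h.1‖ ^ 2 + ‖h.2.1‖ ^ 2) / 4 : ℝ) : ℂ) by push_cast; ring, Complex.ofReal_re,
      Complex.re_ofReal_mul]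
    simp
  rw [Complex.norm_exp, this]

lemma norm_exp_oscPhase_le {C : ℝ → ℝ} (hC : LinearGrowth C) (l : ℝ) (h : Heis n) :
    ‖Complex.exp (oscPhase C l h)‖ ≤ 1 := by
  rw [norm_exp_oscPhase, Real.exp_le_one_iff]
  have := hC.nonneg l
  rw [neg_nonpos]
  positivity

lemma measurable_oscPhase {C : ℝ → ℝ} (hC : LinearGrowth C) (h : Heis n) :
    Measurable fun l => oscPhase C l h := by
  unfold oscPhase
  have := hC.measurable
  fun_prop

lemma RapidDecay.integrable_osc {C : ℝ → ℝ} {g : ℝ → ℂ} (hC : LinearGrowth C) (hg : RapidDecay g)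
    (h : Heis n) : Integrable fun l => g l * Complex.exp (oscPhase C l h) :=
  hg.integrable.mul_bdd (c := 1) (measurable_oscPhase hC h).cexp.aestronglyMeasurable
    (ae_of_all _ fun l => norm_exp_oscPhase_le hC l h)

/-- The linear form `(dx, dy, dt) ↦ dt`. -/
def tForm (n : ℕ) : Heis n →L[ℝ] ℂ :=
  Complex.ofRealCLM ∘L ContinuousLinearMap.snd ℝ (RSpace n) ℝ ∘L
    ContinuousLinearMap.snd ℝ (RSpace n) (RSpace n × ℝ)

/-- The linear form `(dx, dy, dt) ↦ x · dx + y · dy` at the point `(x, y, t)`. -/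
def radialForm (h : Heis n) : Heis n →L[ℝ] ℂ :=
  Complex.ofRealCLM ∘L (innerSL ℝ h.1 ∘L ContinuousLinearMap.fst ℝ (RSpace n) (RSpace n × ℝ) +
    innerSL ℝ h.2.1 ∘L ContinuousLinearMap.fst ℝ (RSpace n) ℝ ∘L
      ContinuousLinearMap.snd ℝ (RSpace n) (RSpace n × ℝ))

@[simp] lemma tForm_apply (v : Heis n) : tForm n v = v.2.2 := rfl

@[simp] lemma radialForm_apply (h v : Heis n) :
    radialForm h v = ((inner ℝ h.1 v.1 + inner ℝ h.2.1 v.2.1 : ℝ) : ℂ) := rfl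

lemma norm_tForm_le : ‖tForm n‖ ≤ 1 := by
  refine ContinuousLinearMap.opNorm_le_bound _ zero_le_one fun v => ?_
  rw [tForm_apply, Complex.norm_real, one_mul]
  exact (norm_snd_le v.2).trans (norm_snd_le v)

lemma norm_radialForm_le (h : Heis n) : ‖radialForm h‖ ≤ 2 * ‖h‖ := by
  refine ContinuousLinearMap.opNorm_le_bound _ (by positivity) fun v => ?_
  rw [radialForm_apply, Complex.norm_real]
  have h1 : ‖h.1‖ ≤ ‖h‖ := norm_fst_le h
  have h2 : ‖h.2.1‖ ≤ ‖h‖ := (norm_fst_le h.2).trans (norm_snd_le h)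
  have h3 : ‖v.1‖ ≤ ‖v‖ := norm_fst_le v
  have h4 : ‖v.2.1‖ ≤ ‖v‖ := (norm_fst_le v.2).trans (norm_snd_le v)
  calc ‖inner ℝ h.1 v.1 + inner ℝ h.2.1 v.2.1‖ ≤ ‖h.1‖ * ‖v.1‖ + ‖h.2.1‖ * ‖v.2.1‖ :=
        (norm_add_le _ _).trans (add_le_add (norm_inner_le_norm _ _) (norm_inner_le_norm _ _))
    _ ≤ ‖h‖ * ‖v‖ + ‖h‖ * ‖v‖ := by gcongr
    _ = _ := by ring

lemma contDiff_radialForm {m : WithTop ℕ∞} : ContDiff ℝ m (radialForm (n := n)) := by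
  have h1 : ContDiff ℝ m fun h : Heis n => innerSL ℝ h.1 := (innerSL ℝ).contDiff.comp contDiff_fst
  have h2 : ContDiff ℝ m fun h : Heis n => innerSL ℝ h.2.1 :=
    (innerSL ℝ).contDiff.comp (contDiff_fst.comp contDiff_snd)
  exact contDiff_const.clm_comp ((h1.clm_comp contDiff_const).add (h2.clm_comp contDiff_const))

lemma hasFDerivAt_oscPhase (C : ℝ → ℝ) (l : ℝ) (h : Heis n) :
    HasFDerivAt (oscPhase C l)
      ((-Complex.I * l) • tForm n + (-(C l : ℂ) / 2) • radialForm h) h := by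
  have h1 : HasFDerivAt (fun h : Heis n => ((‖h.1‖ ^ 2 + ‖h.2.1‖ ^ 2 : ℝ) : ℂ))
      ((2 : ℂ) • radialForm h) h := by
    have a := (hasStrictFDerivAt_norm_sq h.1).hasFDerivAt.comp h (hasFDerivAt_fst (𝕜 := ℝ))
    have b := (hasStrictFDerivAt_norm_sq h.2.1).hasFDerivAt.comp h
      ((hasFDerivAt_fst (𝕜 := ℝ)).comp h (hasFDerivAt_snd (𝕜 := ℝ)))
    have := Complex.ofRealCLM.hasFDerivAt.comp h (a.add b)
    convert! this using 1
    ext v <;> simp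
  have h2 : HasFDerivAt (fun h : Heis n => (h.2.2 : ℂ)) (tForm n) h := (tForm n).hasFDerivAt
  have := (h2.const_mul (-Complex.I * l)).sub ((h1.const_mul (C l : ℂ)).mul_const (4⁻¹ : ℂ))
  convert! this using 1
  ext v <;> simp <;> ring

/-- The differential of an oscillatory integral is a combination of oscillatory integrals. -/
lemma hasFDerivAt_oscInt {C : ℝ → ℝ} {g : ℝ → ℂ} (hC : LinearGrowth C) (hg : RapidDecay g)
    (h : Heis n) :
    HasFDerivAt (oscInt C g) (oscInt C (fun l => (-Complex.I * l) * g l) h • tForm n +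
      (-oscInt C (fun l => (C l : ℂ) * g l) h / 2) • radialForm h) h := by
  obtain ⟨K, hK0, hK⟩ := hC.bound
  have j1 : ∀ h : Heis n, Integrable fun l : ℝ =>
      ((-Complex.I * l) * g l * Complex.exp (oscPhase C l h)) • tForm n := fun h =>
    ((hg.mul_freq).integrable_osc hC h).smul_const (tForm n)
  have j2 : ∀ h : Heis n, Integrable fun l : ℝ => ((C l : ℂ) * g l * Complex.exp (oscPhase C l h)) •
      ((-(1 / 2) : ℂ) • radialForm h) := fun h =>
    ((hg.mul_growth hC).integrable_osc hC h).smul_const ((-(1 / 2) : ℂ) • radialForm h)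
  have key := hasFDerivAt_integral_of_dominated_of_fderiv_le (𝕜 := ℝ) (μ := volume)
    (F := fun (h : Heis n) (l : ℝ) => g l * Complex.exp (oscPhase C l h))
    (F' := fun h l => ((-Complex.I * l) * g l * Complex.exp (oscPhase C l h)) • tForm n +
      ((C l : ℂ) * g l * Complex.exp (oscPhase C l h)) • ((-(1 / 2) : ℂ) • radialForm h))
    (x₀ := h) (s := Metric.ball h 1)
    (bound := fun l => (1 + K * (‖h‖ + 1)) * ((1 + |l|) ^ 1 * ‖g l‖))
    (Metric.ball_mem_nhds h one_pos)
    (Eventually.of_forall fun h' => (hg.integrable_osc hC h').aestronglyMeasurable)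
    (hg.integrable_osc hC h) ?_ ?_ ((hg.integrable_mul 1).const_mul _) ?_
  · refine key.congr_fderiv ?_
    rw [integral_add (j1 h) (j2 h), integral_smul_const, integral_smul_const]
    simp only [oscInt, smul_smul]
    congr 2
    ring
  · exact (j1 h).aestronglyMeasurable.add (j2 h).aestronglyMeasurable
  · refine ae_of_all _ fun l h' hh' => ?_
    have hn : ‖h'‖ ≤ ‖h‖ + 1 := by
      have := norm_sub_norm_le h' h
      have h3 := (mem_ball_iff_norm.1 hh').le
      linarith
    have e1 := norm_exp_oscPhase_le hC l h'
    have hCl := hC.nonneg l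
    have e2 : ‖(-(1 / 2) : ℂ) • radialForm h'‖ ≤ ‖h‖ + 1 := by
      rw [norm_smul]
      have := norm_radialForm_le h'
      have h5 : ‖(-(1 / 2) : ℂ)‖ = 1 / 2 := by simp
      rw [h5]; linarith
    calc _ ≤ ‖(-Complex.I * l) * g l * Complex.exp (oscPhase C l h')‖ * ‖tForm n‖ +
          ‖(C l : ℂ) * g l * Complex.exp (oscPhase C l h')‖ * ‖(-(1 / 2) : ℂ) • radialForm h'‖ := by
          refine (norm_add_le _ _).trans ?_
          rw [norm_smul, norm_smul (_ * _ * _ : ℂ)]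
      _ ≤ (|l| * ‖g l‖ * 1) * 1 + (K * (1 + |l|) * ‖g l‖ * 1) * (‖h‖ + 1) := by
          simp only [norm_mul, norm_neg, Complex.norm_I, one_mul, Complex.norm_real,
            Real.norm_eq_abs, abs_of_nonneg hCl]
          gcongr
          · exact norm_tForm_le
          · exact hK l
      _ ≤ _ := by nlinarith [norm_nonneg (g l), abs_nonneg l]
  · refine ae_of_all _ fun l h' _ => ?_
    have := (hasFDerivAt_oscPhase C l h').cexp.const_mul (g l)
    convert! this using 1
    ext v <;> simp <;> ring

lemma contDiff_oscInt {C : ℝ → ℝ} (hC : LinearGrowth C) (m : ℕ) :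
    ∀ {g : ℝ → ℂ}, RapidDecay g → ContDiff ℝ m (oscInt (n := n) C g) := by
  induction m with
  | zero =>
    intro g hg
    exact contDiff_zero.2 (continuous_iff_continuousAt.2 fun h =>
      (hasFDerivAt_oscInt hC hg h).continuousAt)
  | succ m ih =>
    intro g hg
    push_cast
    refine contDiff_succ_iff_fderiv.2 ⟨fun h => (hasFDerivAt_oscInt hC hg h).differentiableAt,
      by simp, ?_⟩
    rw [funext fun h => (hasFDerivAt_oscInt hC hg h).fderiv]
    exact ((ih hg.mul_freq).smul contDiff_const).add
      (((ih (hg.mul_growth hC)).neg.div_const 2).smul contDiff_radialForm)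

/-! ### The heat kernel as an oscillatory integral -/

/-- `λ coth(λ s)`, the decay rate of `q_s(z, λ)` in `|z|²/4`. -/
def heatRate (s l : ℝ) : ℝ := l * (Real.cosh (l * s) / Real.sinh (l * s))

/-- The normalizing constant `(2π)⁻¹ (4π)⁻ⁿ`. -/
def heatConst (n : ℕ) : ℝ := (2 * Real.pi)⁻¹ * ((4 * Real.pi) ^ n)⁻¹

lemma heatConst_pos (n : ℕ) : 0 < heatConst n := by
  unfold heatConst; positivity

/-- `(2π)⁻¹ (4π)⁻ⁿ (λ / sinh (λ s))ⁿ`, the amplitude of `(2π)⁻¹ q_s(z, λ)`. -/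
def heatAmp (n : ℕ) (s l : ℝ) : ℝ := heatConst n * (l / Real.sinh (l * s)) ^ n

lemma zDivSinh_ofReal {x : ℝ} (hx : x ≠ 0) : zDivSinh x = ((x / Real.sinh x : ℝ) : ℂ) := by
  rw [zDivSinh_of_ne (by exact_mod_cast hx)]
  push_cast
  rfl

lemma zCoth_ofReal {x : ℝ} (hx : x ≠ 0) :
    zCoth x = ((x * (Real.cosh x / Real.sinh x) : ℝ) : ℂ) := by
  rw [zCoth, zDivSinh_ofReal hx]
  push_cast
  ring

lemma heatRate_eq {s : ℝ} (hs : s ≠ 0) (l : ℝ) :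
    heatRate s l = s⁻¹ * (l * s * (Real.cosh (l * s) / Real.sinh (l * s))) := by
  rw [heatRate]; field_simp

lemma heatRate_zero (s : ℝ) : heatRate s 0 = 0 := by simp [heatRate]

/-- The amplitude vanishes at `λ = 0` because of `0 / 0 = 0`, not by continuity. -/
lemma heatAmp_zero (hn : n ≠ 0) (s : ℝ) : heatAmp n s 0 = 0 := by simp [heatAmp, hn]

lemma inv_two_mul_le_heatRate {s l : ℝ} (hs : 0 < s) (hl : l ≠ 0) : s⁻¹ / 2 ≤ heatRate s l := by
  have h := half_le_re_zCoth (z := ((l * s : ℝ) : ℂ)) (by simp)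
  rw [zCoth_ofReal (by positivity), Complex.ofReal_re] at h
  rw [heatRate_eq hs.ne']
  have := inv_pos.2 hs
  nlinarith

lemma heatRate_nonneg {s : ℝ} (hs : 0 < s) (l : ℝ) : 0 ≤ heatRate s l := by
  by_cases hl : l = 0
  · simp [hl, heatRate_zero]
  · exact le_trans (by positivity) (inv_two_mul_le_heatRate hs hl)

lemma heatRate_le {s : ℝ} (hs : 0 < s) (l : ℝ) : heatRate s l ≤ |l| + 2 / s := by
  by_cases hl : l = 0
  · simp only [hl, heatRate_zero]; positivity
  have h := norm_zCoth_le (z := ((l * s : ℝ) : ℂ)) (by simp)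
  rw [zCoth_ofReal (by positivity), Complex.norm_real, Complex.norm_real] at h
  rw [heatRate_eq hs.ne']
  have h2 := (le_abs_self _).trans h
  rw [Real.norm_eq_abs, abs_mul, abs_of_pos hs] at h2
  calc _ ≤ s⁻¹ * (|l| * s + 2) := by gcongr
    _ = _ := by field_simp

lemma measurable_heatRate (s : ℝ) : Measurable (heatRate s) := by
  unfold heatRate
  have h1 := Real.measurable_cosh
  have h2 := Real.measurable_sinh
  fun_prop

lemma measurable_heatAmp (n : ℕ) (s : ℝ) : Measurable (heatAmp n s) := by
  unfold heatAmp
  have h2 := Real.measurable_sinh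
  fun_prop

lemma linearGrowth_heatRate {s : ℝ} (hs : 0 < s) : LinearGrowth (heatRate s) := by
  refine ⟨measurable_heatRate s, heatRate_nonneg hs, 1 + 2 / s, by positivity, fun l => ?_⟩
  have h1 := heatRate_le hs l
  have : 0 ≤ 2 / s * |l| := by positivity
  nlinarith

/-- The decay of the amplitude in `λ` is uniform in `s` away from `s = 0`. -/
lemma exists_heatAmp_le (hn : n ≠ 0) {s₀ : ℝ} (hs₀ : 0 < s₀) (k : ℕ) :
    ∃ K : ℝ, 0 ≤ K ∧ ∀ s ≥ s₀, ∀ l, (1 + |l|) ^ k * |heatAmp n s l| ≤ K := by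
  obtain ⟨K, hK0, hK⟩ := exists_norm_zDivSinh_le k
  have hc := heatConst_pos n
  refine ⟨heatConst n * (s₀⁻¹) ^ n * 2 ^ (n - 1) * (1 + s₀⁻¹) ^ k * K,
    by positivity, fun s hs l => ?_⟩
  have hsp : 0 < s := hs₀.trans_le hs
  by_cases hl : l = 0
  · rw [hl, heatAmp_zero hn]; simp only [abs_zero, mul_zero]; positivity
  have h1 := hK ((l * s : ℝ) : ℂ) (by simp)
  have h2 := norm_zDivSinh_le (z := ((l * s : ℝ) : ℂ)) (by simp)
  rw [zDivSinh_ofReal (by positivity), Complex.norm_real, Real.norm_eq_abs] at h1 h2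
  rw [Complex.ofReal_re] at h1
  set q := |l * s / Real.sinh (l * s)| with hq
  have hq0 : 0 ≤ q := abs_nonneg _
  have e : |heatAmp n s l| = heatConst n * (s⁻¹) ^ n * (q ^ (n - 1) * q) := by
    rw [pow_sub_one_mul hn, heatAmp, abs_mul, abs_of_pos (by positivity), abs_pow, mul_assoc,
      ← mul_pow, hq]
    congr 2
    rw [show l / Real.sinh (l * s) = s⁻¹ * (l * s / Real.sinh (l * s)) by field_simp, abs_mul,
      abs_of_pos (inv_pos.2 hsp)]
  have hsi : s⁻¹ ≤ s₀⁻¹ := inv_anti₀ hs₀ hs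
  have h3 : 1 + |l| ≤ (1 + s₀⁻¹) * (1 + |l * s|) := by
    rw [abs_mul, abs_of_pos hsp]
    have : |l| ≤ s₀⁻¹ * (|l| * s) := by
      rw [inv_mul_eq_div, le_div_iff₀ hs₀]; gcongr
    have : 0 ≤ |l| * s := by positivity
    have : 0 ≤ s₀⁻¹ := by positivity
    nlinarith
  rw [e]
  calc (1 + |l|) ^ k * (heatConst n * (s⁻¹) ^ n * (q ^ (n - 1) * q))
      ≤ ((1 + s₀⁻¹) * (1 + |l * s|)) ^ k * (heatConst n * (s₀⁻¹) ^ n *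
        (2 ^ (n - 1) * q)) := by gcongr
    _ = heatConst n * (s₀⁻¹) ^ n * 2 ^ (n - 1) * (1 + s₀⁻¹) ^ k *
        ((1 + |l * s|) ^ k * q) := by rw [mul_pow]; ring
    _ ≤ _ := by gcongr

lemma rapidDecay_heatAmp (hn : n ≠ 0) {s : ℝ} (hs : 0 < s) :
    RapidDecay fun l => (heatAmp n s l : ℂ) := by
  refine ⟨(Complex.measurable_ofReal.comp (measurable_heatAmp n s)), fun k => ?_⟩
  obtain ⟨K, -, hK⟩ := exists_heatAmp_le hn hs k
  exact ⟨K, fun l => by simpa using hK s le_rfl l⟩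

lemma heatKernelFourier_eq (s : ℝ) (h : Heis n) (l : ℝ) :
    (2 * Real.pi)⁻¹ * heatKernelFourier s h.1 h.2.1 l =
      heatAmp n s l * Real.exp (-(heatRate s l * (‖h.1‖ ^ 2 + ‖h.2.1‖ ^ 2) / 4)) := by
  rw [heatKernelFourier, heatAmp, heatRate, heatConst, ← mul_assoc, ← mul_assoc]
  congr 2
  ring

lemma re_amp_mul_exp_oscPhase (C : ℝ → ℝ) (a l : ℝ) (h : Heis n) :
    ((a : ℂ) * Complex.exp (oscPhase C l h)).re =
      Real.cos (l * h.2.2) * (a * Real.exp (-(C l * (‖h.1‖ ^ 2 + ‖h.2.1‖ ^ 2) / 4))) := by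
  have e : oscPhase C l h = ((-(C l * (‖h.1‖ ^ 2 + ‖h.2.1‖ ^ 2) / 4) : ℝ) : ℂ) +
      ((-(l * h.2.2) : ℝ) : ℂ) * Complex.I := by
    rw [oscPhase]; push_cast; ring
  rw [e, Complex.exp_add, Complex.exp_mul_I, ← Complex.ofReal_exp, ← Complex.ofReal_cos,
    ← Complex.ofReal_sin, Complex.re_ofReal_mul, Complex.re_ofReal_mul, Complex.add_re,
    Complex.ofReal_re, Complex.re_ofReal_mul, Complex.I_re, Real.cos_neg]
  ring

lemma heatKernel_eq_re_oscInt (hn : n ≠ 0) {s : ℝ} (hs : 0 < s) (h : Heis n) :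
    heatKernel n s h =
      (oscInt (heatRate s) (fun l => (heatAmp n s l : ℂ)) h).re := by
  rw [heatKernel, oscInt, ← integral_const_mul, ← Complex.reCLM_apply,
    ← Complex.reCLM.integral_comp_comm
    ((rapidDecay_heatAmp hn hs).integrable_osc (linearGrowth_heatRate hs) h)]
  refine integral_congr_ae (ae_of_all _ fun l => ?_)
  dsimp only
  rw [Complex.reCLM_apply, re_amp_mul_exp_oscPhase, ← heatKernelFourier_eq, mul_left_comm]

/-- Oscillatory integrals with an even decay rate and a Hermitian-symmetric amplitude are real. -/
lemma ofReal_re_oscInt {C : ℝ → ℝ} {g : ℝ → ℂ} (hC : ∀ l, C (-l) = C l)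
    (hg : ∀ l, g (-l) = (starRingEnd ℂ) (g l)) (h : Heis n) :
    ((oscInt C g h).re : ℂ) = oscInt C g h := by
  rw [← Complex.conj_eq_iff_re, oscInt, ← integral_conj, ← integral_neg_eq_self]
  refine integral_congr_ae (ae_of_all _ fun l => ?_)
  dsimp only
  rw [map_mul, hg, Complex.conj_conj, ← Complex.exp_conj]
  congr 2
  simp only [oscPhase, hC, map_sub, map_mul, map_neg, map_div₀, Complex.conj_I, Complex.conj_ofReal,
    map_ofNat]
  push_cast
  simp

lemma heatRate_neg (s l : ℝ) : heatRate s (-l) = heatRate s l := by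
  simp [heatRate, Real.cosh_neg, Real.sinh_neg, div_neg]

lemma heatAmp_neg (s l : ℝ) : heatAmp n s (-l) = heatAmp n s l := by
  simp [heatAmp, Real.sinh_neg]

/-! ### The heat equation -/

lemma hasFDerivAt_re_oscInt {C : ℝ → ℝ} {g : ℝ → ℂ} (hC : LinearGrowth C) (hg : RapidDecay g)
    (h : Heis n) : HasFDerivAt (fun h => (oscInt C g h).re)
      (Complex.reCLM ∘L (oscInt C (fun l => (-Complex.I * l) * g l) h • tForm n +
      (-oscInt C (fun l => (C l : ℂ) * g l) h / 2) • radialForm h)) h :=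
  Complex.reCLM.hasFDerivAt.comp h (hasFDerivAt_oscInt hC hg h)

/-- The derivative of `P Re(osc)` in the direction `v`, where `P` is an affine function with
slope `p` in that direction. -/
lemma lineDeriv_mul_re_oscInt {C : ℝ → ℝ} {g : ℝ → ℂ} (hC : LinearGrowth C) (hg : RapidDecay g)
    (h v : Heis n) {P : Heis n → ℝ} {p : ℝ} (hP : ∀ t : ℝ, P (h + t • v) = P h + t * p) :
    HasLineDerivAt ℝ (fun h => P h * (oscInt C g h).re)
      (p * (oscInt C g h).re + P h *
        (v.2.2 * (oscInt C (fun l => (-Complex.I * l) * g l) h).re -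
          (inner ℝ h.1 v.1 + inner ℝ h.2.1 v.2.1) / 2 *
            (oscInt C (fun l => (C l : ℂ) * g l) h).re)) h v := by
  have h1 := (hasFDerivAt_re_oscInt hC hg h).hasLineDerivAt v
  have h2 : HasDerivAt (fun t : ℝ => P (h + t • v)) p 0 := by
    simp_rw [hP]
    simpa using ((hasDerivAt_id (0 : ℝ)).mul_const p).const_add (P h)
  have h3 := h2.mul h1
  unfold HasLineDerivAt
  convert! h3 using 1
  have e : ∀ (a : ℂ) (b : ℝ), (a * (b : ℂ)).re = b * a.re := fun a b => by simp; ring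
  have e' : ∀ (a : ℂ), (-a / 2).re = -a.re / 2 := fun a => by
    rw [show -a / 2 = ((1 / 2 : ℝ) : ℂ) * (-a) by push_cast; ring, Complex.re_ofReal_mul]
    simp; ring
  simp only [zero_smul, add_zero, ContinuousLinearMap.coe_comp, Function.comp_apply, add_apply,
    smul_apply, smul_eq_mul, tForm_apply, radialForm_apply,
    Complex.reCLM_apply, Complex.add_re, e, e']
  ring

section HeatEquation

variable {C : ℝ → ℝ} {g : ℝ → ℂ}

lemma lineDeriv_mul_re_oscInt_eq (hC : LinearGrowth C) (hg : RapidDecay g)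
    (h v : Heis n) {P : Heis n → ℝ} {p : ℝ} (hP : ∀ t : ℝ, P (h + t • v) = P h + t * p) :
    lineDeriv ℝ (fun h => P h * (oscInt C g h).re) h v =
      p * (oscInt C g h).re + P h *
        (v.2.2 * (oscInt C (fun l => (-Complex.I * l) * g l) h).re -
          (inner ℝ h.1 v.1 + inner ℝ h.2.1 v.2.1) / 2 *
            (oscInt C (fun l => (C l : ℂ) * g l) h).re) :=
  (lineDeriv_mul_re_oscInt hC hg h v hP).lineDeriv

lemma dx_re_oscInt (hC : LinearGrowth C) (hg : RapidDecay g) (j : Fin n) (h : Heis n) :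
    dx j (fun h => (oscInt C g h).re) h =
      -(h.1 j / 2) * (oscInt C (fun l => (C l : ℂ) * g l) h).re := by
  have := lineDeriv_mul_re_oscInt_eq hC hg h (EuclideanSpace.single j (1 : ℝ), 0, 0)
    (P := fun _ => 1) (p := 0) (by simp)
  simpa [dx, EuclideanSpace.inner_single_right] using this

lemma dy_re_oscInt (hC : LinearGrowth C) (hg : RapidDecay g) (j : Fin n) (h : Heis n) :
    dy j (fun h => (oscInt C g h).re) h =
      -(h.2.1 j / 2) * (oscInt C (fun l => (C l : ℂ) * g l) h).re := by
  have := lineDeriv_mul_re_oscInt_eq hC hg h (0, EuclideanSpace.single j (1 : ℝ), 0)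
    (P := fun _ => 1) (p := 0) (by simp)
  simpa [dy, EuclideanSpace.inner_single_right] using this

lemma dt_re_oscInt (hC : LinearGrowth C) (hg : RapidDecay g) (h : Heis n) :
    dt (fun h => (oscInt C g h).re) h =
      (oscInt C (fun l => (-Complex.I * l) * g l) h).re := by
  have := lineDeriv_mul_re_oscInt_eq hC hg h ((0, 0, 1) : Heis n)
    (P := fun _ => 1) (p := 0) (by simp)
  simpa [dt] using this

lemma fieldX_re_oscInt (hC : LinearGrowth C) (hg : RapidDecay g) (j : Fin n) (h : Heis n) :
    fieldX j (fun h => (oscInt C g h).re) h =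
      -(h.1 j / 2) * (oscInt C (fun l => (C l : ℂ) * g l) h).re +
        h.2.1 j / 2 * (oscInt C (fun l => (-Complex.I * l) * g l) h).re := by
  rw [fieldX, dx_re_oscInt hC hg, dt_re_oscInt hC hg, smul_eq_mul]

lemma fieldY_re_oscInt (hC : LinearGrowth C) (hg : RapidDecay g) (j : Fin n) (h : Heis n) :
    fieldY j (fun h => (oscInt C g h).re) h =
      -(h.2.1 j / 2) * (oscInt C (fun l => (C l : ℂ) * g l) h).re +
        -(h.1 j / 2) * (oscInt C (fun l => (-Complex.I * l) * g l) h).re := by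
  rw [fieldY, dy_re_oscInt hC hg, dt_re_oscInt hC hg, smul_eq_mul]
  ring

/-- Differentiating a combination of two oscillatory integrals with affine coefficients. -/
lemma lineDeriv_add_re_oscInt (hC : LinearGrowth C) {g₁ g₂ : ℝ → ℂ} (hg₁ : RapidDecay g₁)
    (hg₂ : RapidDecay g₂) (h v : Heis n) {P Q : Heis n → ℝ} {p q : ℝ}
    (hP : ∀ t : ℝ, P (h + t • v) = P h + t * p) (hQ : ∀ t : ℝ, Q (h + t • v) = Q h + t * q) :
    lineDeriv ℝ (fun h => P h * (oscInt C g₁ h).re + Q h * (oscInt C g₂ h).re) h v =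
      (p * (oscInt C g₁ h).re + P h *
        (v.2.2 * (oscInt C (fun l => (-Complex.I * l) * g₁ l) h).re -
          (inner ℝ h.1 v.1 + inner ℝ h.2.1 v.2.1) / 2 *
            (oscInt C (fun l => (C l : ℂ) * g₁ l) h).re)) +
      (q * (oscInt C g₂ h).re + Q h *
        (v.2.2 * (oscInt C (fun l => (-Complex.I * l) * g₂ l) h).re -
          (inner ℝ h.1 v.1 + inner ℝ h.2.1 v.2.1) / 2 *
            (oscInt C (fun l => (C l : ℂ) * g₂ l) h).re)) := by
  have a := lineDeriv_mul_re_oscInt hC hg₁ h v hP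
  have b := lineDeriv_mul_re_oscInt hC hg₂ h v hQ
  unfold HasLineDerivAt at a b
  exact HasLineDerivAt.lineDeriv (HasDerivAt.add a b)

lemma fieldX_sq_add_fieldY_sq_re_oscInt (hC : LinearGrowth C) (hg : RapidDecay g) (j : Fin n)
    (h : Heis n) :
    fieldX j (fieldX j fun h => (oscInt C g h).re) h +
        fieldY j (fieldY j fun h => (oscInt C g h).re) h =
      -(oscInt C (fun l => (C l : ℂ) * g l) h).re + (h.1 j ^ 2 + h.2.1 j ^ 2) / 4 *
        ((oscInt C (fun l => (C l : ℂ) * (C l * g l)) h).re +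
          (oscInt C (fun l => (-Complex.I * l) * (-Complex.I * l * g l)) h).re) := by
  have hA := hg.mul_growth hC
  have hB := hg.mul_freq
  have hcomm : (fun l : ℝ => (C l : ℂ) * (-Complex.I * l * g l)) =
      fun l : ℝ => -Complex.I * l * ((C l : ℂ) * g l) := by ext l; ring
  have e1 : fieldX j (fun h : Heis n => (oscInt C g h).re) = _ :=
    funext (fieldX_re_oscInt hC hg j)
  have e2 : fieldY j (fun h : Heis n => (oscInt C g h).re) = _ :=
    funext (fieldY_re_oscInt hC hg j)
  rw [e1, e2]
  simp only [fieldX, fieldY, dx, dy, dt]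
  rw [lineDeriv_add_re_oscInt hC hA hB h (EuclideanSpace.single j (1 : ℝ), 0, 0)
      (P := fun h => -(h.1 j / 2)) (Q := fun h => h.2.1 j / 2) (p := -(1 / 2)) (q := 0)
      (fun t => by simp; ring) (fun t => by simp),
    lineDeriv_add_re_oscInt hC hA hB h (0, 0, 1)
      (P := fun h => -(h.1 j / 2)) (Q := fun h => h.2.1 j / 2) (p := 0) (q := 0)
      (fun t => by simp) (fun t => by simp),
    lineDeriv_add_re_oscInt hC hA hB h (0, EuclideanSpace.single j (1 : ℝ), 0)
      (P := fun h => -(h.2.1 j / 2)) (Q := fun h => -(h.1 j / 2)) (p := -(1 / 2)) (q := 0)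
      (fun t => by simp; ring) (fun t => by simp),
    lineDeriv_add_re_oscInt hC hA hB h (0, 0, 1)
      (P := fun h => -(h.2.1 j / 2)) (Q := fun h => -(h.1 j / 2)) (p := 0) (q := 0)
      (fun t => by simp) (fun t => by simp)]
  simp only [hcomm, EuclideanSpace.inner_single_right, inner_zero_right, smul_eq_mul,
    conj_trivial]
  ring

/-- The sub-Laplacian of a radial oscillatory integral: it acts on the amplitude as
`-n C(λ) + |z|² (C(λ)² - λ²) / 4`. -/
lemma subLaplacian_re_oscInt (hC : LinearGrowth C) (hg : RapidDecay g) (h : Heis n) :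
    subLaplacian (fun h => (oscInt C g h).re) h =
      -n * (oscInt C (fun l => (C l : ℂ) * g l) h).re + (‖h.1‖ ^ 2 + ‖h.2.1‖ ^ 2) / 4 *
        ((oscInt C (fun l => (C l : ℂ) * (C l * g l)) h).re +
          (oscInt C (fun l => (-Complex.I * l) * (-Complex.I * l * g l)) h).re) := by
  rw [subLaplacian, Finset.sum_congr rfl fun j _ => fieldX_sq_add_fieldY_sq_re_oscInt hC hg j h,
    Finset.sum_add_distrib, ← Finset.sum_mul, ← Finset.sum_div, Finset.sum_add_distrib,
    EuclideanSpace.real_norm_sq_eq, EuclideanSpace.real_norm_sq_eq]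
  simp

end HeatEquation

lemma hasDerivAt_heatRate {s l : ℝ} (hs : 0 < s) (hl : l ≠ 0) :
    HasDerivAt (fun s => heatRate s l) (l ^ 2 - heatRate s l ^ 2) s := by
  have hsh : Real.sinh (l * s) ≠ 0 := by simp [Real.sinh_eq_zero, hl, hs.ne']
  have h1 : HasDerivAt (fun s => l * s) l s := by simpa using (hasDerivAt_id s).const_mul l
  have := (h1.cosh.div h1.sinh hsh).const_mul l
  convert! this using 1
  have h2 := Real.cosh_sq (l * s)
  simp only [heatRate]
  field_simp

lemma hasDerivAt_heatAmp {s l : ℝ} (hs : 0 < s) (hl : l ≠ 0) :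
    HasDerivAt (fun s => heatAmp n s l) (-n * heatRate s l * heatAmp n s l) s := by
  have hsh : Real.sinh (l * s) ≠ 0 := by simp [Real.sinh_eq_zero, hl, hs.ne']
  have h1 : HasDerivAt (fun s => l * s) l s := by simpa using (hasDerivAt_id s).const_mul l
  have := (((hasDerivAt_const s l).div h1.sinh hsh).pow n).const_mul (heatConst n)
  convert! this using 1
  simp only [heatRate, heatAmp]
  rcases Nat.eq_zero_or_pos n with h0 | h0
  · simp [h0]
  · rw [← pow_sub_one_mul h0.ne' (l / Real.sinh (l * s))]
    simp only [Pi.div_apply]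
    field_simp
    ring

/-- The time derivative of the integrand of `p_s`, in the form in which `subLaplacian_re_oscInt`
delivers the sub-Laplacian. -/
lemma hasDerivAt_heat_integrand (hn : n ≠ 0) {s : ℝ} (hs : 0 < s) (l : ℝ) (h : Heis n) :
    HasDerivAt (fun s => (heatAmp n s l : ℂ) * Complex.exp (oscPhase (heatRate s) l h))
      (((-n * heatRate s l + (‖h.1‖ ^ 2 + ‖h.2.1‖ ^ 2) / 4 * (heatRate s l ^ 2 - l ^ 2) : ℝ) : ℂ) *
        (heatAmp n s l : ℂ) * Complex.exp (oscPhase (heatRate s) l h)) s := by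
  by_cases hl : l = 0
  · subst hl
    simp only [heatAmp_zero hn]
    simpa using hasDerivAt_const s (0 : ℂ)
  have hp : HasDerivAt (fun s => oscPhase (heatRate s) l h)
      (-((l ^ 2 - heatRate s l ^ 2 : ℝ) : ℂ) * ((‖h.1‖ ^ 2 + ‖h.2.1‖ ^ 2 : ℝ) : ℂ) / 4) s := by
    have := ((((hasDerivAt_heatRate hs hl).ofReal_comp).mul_const
      ((‖h.1‖ ^ 2 + ‖h.2.1‖ ^ 2 : ℝ) : ℂ)).div_const 4).const_sub (-Complex.I * l * h.2.2)
    convert! this using 1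
    ring
  have := (hasDerivAt_heatAmp (n := n) hs hl).ofReal_comp.mul hp.cexp
  convert! this using 1
  push_cast
  ring

lemma hasDerivAt_oscInt_heat (hn : n ≠ 0) {s : ℝ} (hs : 0 < s) (h : Heis n) :
    Integrable (fun l : ℝ =>
      ((-n * heatRate s l + (‖h.1‖ ^ 2 + ‖h.2.1‖ ^ 2) / 4 * (heatRate s l ^ 2 - l ^ 2) : ℝ) : ℂ) *
        (heatAmp n s l : ℂ) * Complex.exp (oscPhase (heatRate s) l h)) ∧
    HasDerivAt (fun s => oscInt (heatRate s) (fun l => (heatAmp n s l : ℂ)) h)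
      (∫ l : ℝ,
      ((-n * heatRate s l + (‖h.1‖ ^ 2 + ‖h.2.1‖ ^ 2) / 4 * (heatRate s l ^ 2 - l ^ 2) : ℝ) : ℂ) *
        (heatAmp n s l : ℂ) * Complex.exp (oscPhase (heatRate s) l h)) s := by
  have hs2 : 0 < s / 2 := by positivity
  obtain ⟨K, hK0, hK⟩ := exists_heatAmp_le hn hs2 4
  set w := (‖h.1‖ ^ 2 + ‖h.2.1‖ ^ 2) / 4 with hw
  have hw0 : 0 ≤ w := by positivity
  set A := 1 + 2 / (s / 2) with hA
  have hA0 : 0 ≤ A := by positivity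
  have hpos : ∀ s' ∈ Metric.ball s (s / 2), s / 2 < s' := fun s' hs' => by
    have := abs_lt.1 (by simpa [dist_eq_norm] using hs' : |s' - s| < s / 2)
    linarith [this.1]
  refine hasDerivAt_integral_of_dominated_loc_of_deriv_le
    (F' := fun s l => ((-n * heatRate s l + w * (heatRate s l ^ 2 - l ^ 2) : ℝ) : ℂ) *
        (heatAmp n s l : ℂ) * Complex.exp (oscPhase (heatRate s) l h))
    (bound := fun l => (n * A + w * (A ^ 2 + 1)) * K * (1 + l ^ 2)⁻¹)
    (s := Metric.ball s (s / 2)) (Metric.ball_mem_nhds s hs2)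
    ?_ ((rapidDecay_heatAmp hn hs).integrable_osc (linearGrowth_heatRate hs) h) ?_ ?_
    (integrable_inv_one_add_sq.const_mul _) ?_
  · filter_upwards [Metric.ball_mem_nhds s hs2] with s' hs'
    have hs'' := hs2.trans (hpos s' hs')
    exact ((rapidDecay_heatAmp hn hs'').integrable_osc
      (linearGrowth_heatRate hs'') h).aestronglyMeasurable
  · have h1 := measurable_heatRate s
    have h2 := measurable_heatAmp n s
    have h3 := (measurable_oscPhase (linearGrowth_heatRate hs) h).cexp
    exact (by fun_prop : Measurable _).aestronglyMeasurable
  · refine ae_of_all _ fun l s' hs' => ?_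
    have hs'' := hpos s' hs'
    have hs3 := hs2.trans hs''
    have e1 := norm_exp_oscPhase_le (linearGrowth_heatRate hs3) l h
    have e2 := heatRate_nonneg hs3 l
    have e3 : heatRate s' l ≤ A * (1 + |l|) := by
      have h1 := heatRate_le hs3 l
      have h2 : 2 / s' ≤ 2 / (s / 2) := by gcongr
      have h3 : 0 ≤ 2 / (s / 2) * |l| := by positivity
      rw [hA]; nlinarith
    have e4 := hK s' hs''.le l
    have e5 : |-n * heatRate s' l + w * (heatRate s' l ^ 2 - l ^ 2)| ≤
        (n * A + w * (A ^ 2 + 1)) * (1 + |l|) ^ 2 := by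
      have h1 : heatRate s' l ^ 2 ≤ A ^ 2 * (1 + |l|) ^ 2 := by
        rw [← mul_pow]; gcongr
      have h2 : l ^ 2 ≤ (1 + |l|) ^ 2 := by
        rw [← sq_abs l]; gcongr; linarith
      have h3 : (1 + |l|) ≤ (1 + |l|) ^ 2 := by nlinarith [abs_nonneg l]
      calc _ ≤ |-n * heatRate s' l| + |w * (heatRate s' l ^ 2 - l ^ 2)| := abs_add_le _ _
        _ ≤ n * (A * (1 + |l|) ^ 2) + w * (A ^ 2 * (1 + |l|) ^ 2 + (1 + |l|) ^ 2) := by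
            refine add_le_add ?_ ?_
            · rw [abs_mul, abs_neg, Nat.abs_cast, abs_of_nonneg e2]
              gcongr
              exact e3.trans (by gcongr)
            · rw [abs_mul, abs_of_nonneg hw0]
              gcongr
              refine (abs_sub _ _).trans ?_
              rw [abs_of_nonneg (sq_nonneg _), abs_of_nonneg (sq_nonneg _)]
              gcongr
        _ = _ := by ring
    rw [norm_mul, norm_mul, Complex.norm_real, Complex.norm_real, Real.norm_eq_abs,
      Real.norm_eq_abs, ← div_eq_mul_inv, le_div_iff₀ (by positivity)]
    calc _ ≤ (n * A + w * (A ^ 2 + 1)) * (1 + |l|) ^ 2 * |heatAmp n s' l| * 1 *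
          (1 + |l|) ^ 2 := by
          gcongr
          nlinarith [abs_nonneg l, sq_abs l]
      _ = (n * A + w * (A ^ 2 + 1)) * ((1 + |l|) ^ 4 * |heatAmp n s' l|) := by ring
      _ ≤ _ := by gcongr
  · exact ae_of_all _ fun l s' hs' => hasDerivAt_heat_integrand hn (hs2.trans (hpos s' hs')) l h

lemma hasDerivAt_heatKernel (hn : n ≠ 0) {s : ℝ} (hs : 0 < s) (h : Heis n) :
    HasDerivAt (fun s' => heatKernel n s' h) (subLaplacian (heatKernel n s) h) s := by
  have hC := linearGrowth_heatRate hs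
  have hg := rapidDecay_heatAmp hn hs
  obtain ⟨-, hd⟩ := hasDerivAt_oscInt_heat hn hs h
  have hre := Complex.reCLM.hasFDerivAt.comp_hasDerivAt s hd
  have e : subLaplacian (heatKernel n s) h = Complex.reCLM (∫ l : ℝ,
      ((-n * heatRate s l + (‖h.1‖ ^ 2 + ‖h.2.1‖ ^ 2) / 4 * (heatRate s l ^ 2 - l ^ 2) : ℝ) : ℂ) *
        (heatAmp n s l : ℂ) * Complex.exp (oscPhase (heatRate s) l h)) := by
    rw [show heatKernel n s = _ from funext (heatKernel_eq_re_oscInt hn hs),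
      subLaplacian_re_oscInt hC hg]
    have i1 := (hg.mul_growth hC).integrable_osc hC h
    have i2 := ((hg.mul_growth hC).mul_growth hC).integrable_osc hC h
    have i3 := (hg.mul_freq.mul_freq).integrable_osc hC h
    have i23 : Integrable fun l : ℝ => (heatRate s l : ℂ) *
        (heatRate s l * heatAmp n s l) * Complex.exp (oscPhase (heatRate s) l h) +
        (-Complex.I * l) * (-Complex.I * l * heatAmp n s l) *
          Complex.exp (oscPhase (heatRate s) l h) := i2.add i3
    rw [integral_congr_ae (g := fun l : ℝ =>
      ((-n : ℝ) : ℂ) * ((heatRate s l : ℂ) * heatAmp n s l *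
        Complex.exp (oscPhase (heatRate s) l h)) +
      (((‖h.1‖ ^ 2 + ‖h.2.1‖ ^ 2) / 4 : ℝ) : ℂ) * ((heatRate s l : ℂ) *
        (heatRate s l * heatAmp n s l) * Complex.exp (oscPhase (heatRate s) l h) +
        (-Complex.I * l) * (-Complex.I * l * heatAmp n s l) *
          Complex.exp (oscPhase (heatRate s) l h)))
      (ae_of_all _ fun l => ?_),
      integral_add (i1.const_mul _) (i23.const_mul _), integral_const_mul,
      integral_const_mul, integral_add i2 i3, Complex.reCLM_apply, Complex.add_re,
      Complex.re_ofReal_mul, Complex.re_ofReal_mul, Complex.add_re]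
    · rfl
    · have hI : Complex.I * Complex.I = -1 := Complex.I_mul_I
      push_cast
      linear_combination (-((‖h.1‖ : ℂ) ^ 2 + (‖h.2.1‖ : ℂ) ^ 2) / 4 * (l : ℂ) ^ 2 *
        heatAmp n s l * Complex.exp (oscPhase (heatRate s) l h)) * hI
  rw [e]
  refine hre.congr_of_eventuallyEq ?_
  filter_upwards [lt_mem_nhds hs] with s' hs'
  exact heatKernel_eq_re_oscInt hn hs' h

lemma contDiff_heatKernel (hn : n ≠ 0) {s : ℝ} (hs : 0 < s) : ContDiff ℝ 2 (heatKernel n s) := by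
  rw [show heatKernel n s = _ from funext (heatKernel_eq_re_oscInt hn hs)]
  exact Complex.reCLM.contDiff.comp
    (contDiff_oscInt (linearGrowth_heatRate hs) 2 (rapidDecay_heatAmp hn hs))

/-! ### Pointwise decay and scaling of the heat kernel -/

/-- The integrable weight `e^{-|x|²/8} e^{-|y|²/8} (1 + t²)⁻¹` on the Heisenberg group. -/
def heatWeight (h : Heis n) : ℝ :=
  Real.exp (-(1 / 8) * ‖h.1‖ ^ 2) * (Real.exp (-(1 / 8) * ‖h.2.1‖ ^ 2) * (1 + h.2.2 ^ 2)⁻¹)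

lemma heatWeight_pos (h : Heis n) : 0 < heatWeight h := by
  unfold heatWeight; positivity

lemma integrable_gaussian {b : ℝ} (hb : 0 < b) :
    Integrable fun x : RSpace n => Real.exp (-b * ‖x‖ ^ 2) := by
  have := GaussianFourier.integrable_cexp_neg_mul_sq_norm_add (V := RSpace n) (b := b)
    (by simpa using hb) 0 0
  refine this.norm.congr (ae_of_all _ fun x => ?_)
  simp only [zero_mul, add_zero, Complex.norm_exp]
  congr 1
  rw [show (-(b : ℂ) * (‖x‖ : ℂ) ^ 2) = ((-b * ‖x‖ ^ 2 : ℝ) : ℂ) by push_cast; ring,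
    Complex.ofReal_re]

lemma integrable_heatWeight : Integrable (heatWeight (n := n)) :=
  (integrable_gaussian (by norm_num)).mul_prod
    ((integrable_gaussian (by norm_num)).mul_prod integrable_inv_one_add_sq)

/-- The value at `λ` of the extension of `heatAmp n 1` to the strip. -/
lemma heatAmp_one_eq {l : ℝ} (hl : l ≠ 0) :
    (heatAmp n 1 l : ℂ) = heatConst n * zDivSinh l ^ n := by
  rw [zDivSinh_ofReal hl, heatAmp, mul_one]
  push_cast
  rfl

lemma heatRate_one_eq {l : ℝ} (hl : l ≠ 0) : (heatRate 1 l : ℂ) = zCoth l := by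
  rw [zCoth_ofReal hl, heatRate, mul_one]

lemma ae_ne_zero : ∀ᵐ l : ℝ, l ≠ 0 := by
  simp [ae_iff, measure_singleton]

/-- The holomorphic continuation to `|Im z| < 1` of the function whose Fourier integral is
`oscInt (heatRate 1) (p * heatAmp n 1)`, where `w` stands for `|x|² + |y|²`. -/
def stripIntegrand (n : ℕ) (p : ℂ → ℂ) (w : ℝ) (z : ℂ) : ℂ :=
  p z * (heatConst n * zDivSinh z ^ n) * Complex.exp (-zCoth z * w / 4)

lemma oscInt_eq_strip {p : ℂ → ℂ} {g : ℝ → ℂ} (hg : ∀ l : ℝ, l ≠ 0 → g l = p l * heatAmp n 1 l)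
    (h : Heis n) : oscInt (heatRate 1) g h = ∫ l : ℝ, Complex.exp (-Complex.I * l * h.2.2) *
      stripIntegrand n p (‖h.1‖ ^ 2 + ‖h.2.1‖ ^ 2) l := by
  refine integral_congr_ae ?_
  filter_upwards [ae_ne_zero] with l hl
  rw [hg l hl, heatAmp_one_eq hl, oscPhase, heatRate_one_eq hl, sub_eq_add_neg, Complex.exp_add,
    stripIntegrand, neg_mul (zCoth l), neg_div]
  ring

lemma differentiableOn_stripIntegrand {p : ℂ → ℂ} (hp : DifferentiableOn ℂ p (strip 1)) (w : ℝ) :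
    DifferentiableOn ℂ (stripIntegrand n p w) (strip 1) := by
  have h1 := differentiableOn_zDivSinh
  have h2 := differentiableOn_zCoth
  unfold stripIntegrand
  fun_prop

lemma exists_stripIntegrand_le (hn : n ≠ 0) {p : ℂ → ℂ} {A : ℝ}
    (hA : ∀ z ∈ strip 1, ‖p z‖ ≤ A * (1 + |z.re|)) :
    ∃ M : ℝ, 0 ≤ M ∧ ∀ w : ℝ, 0 ≤ w → ∀ z ∈ strip 1,
      (1 + |z.re|) ^ 2 * ‖stripIntegrand n p w z‖ ≤ M * Real.exp (-(1 / 8) * w) := by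
  obtain ⟨K, hK0, hK⟩ := exists_norm_zDivSinh_le 3
  have hc := heatConst_pos n
  have hA0 : 0 ≤ A := by
    have := (norm_nonneg _).trans (hA 0 (by simp [strip]))
    simpa using this
  refine ⟨A * heatConst n * 2 ^ (n - 1) * K, by positivity, fun w hw z hz => ?_⟩
  have hz' : |z.im| ≤ 1 := le_of_lt hz
  have e1 := norm_zDivSinh_le hz'
  have e2 := hK z hz'
  have e3 : ‖Complex.exp (-zCoth z * w / 4)‖ ≤ Real.exp (-(1 / 8) * w) := by
    rw [Complex.norm_exp, show -zCoth z * w / 4 = ((w / 4 : ℝ) : ℂ) * (-zCoth z) by push_cast; ring,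
      Complex.re_ofReal_mul, Complex.neg_re]
    refine Real.exp_le_exp.2 ?_
    nlinarith [half_le_re_zCoth hz']
  rw [stripIntegrand, norm_mul, norm_mul, norm_mul, norm_pow, ← pow_sub_one_mul hn ‖zDivSinh z‖,
    Complex.norm_real, Real.norm_of_nonneg hc.le]
  calc _ ≤ (1 + |z.re|) ^ 2 * (A * (1 + |z.re|) * (heatConst n * (2 ^ (n - 1) * ‖zDivSinh z‖)) *
        Real.exp (-(1 / 8) * w)) := by
        gcongr
        exact hA z hz
    _ = A * heatConst n * 2 ^ (n - 1) * ((1 + |z.re|) ^ 3 * ‖zDivSinh z‖) *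
        Real.exp (-(1 / 8) * w) := by ring
    _ ≤ _ := by gcongr

/-- Oscillatory integrals with the phase of the heat kernel `p₁` are dominated by `heatWeight`. -/
lemma exists_norm_oscInt_le (hn : n ≠ 0) {p : ℂ → ℂ} (hp : DifferentiableOn ℂ p (strip 1)) {A : ℝ}
    (hA : ∀ z ∈ strip 1, ‖p z‖ ≤ A * (1 + |z.re|)) {g : ℝ → ℂ}
    (hg : ∀ l : ℝ, l ≠ 0 → g l = p l * heatAmp n 1 l) :
    ∃ K : ℝ, ∀ h : Heis n, ‖oscInt (heatRate 1) g h‖ ≤ K * heatWeight h := by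
  obtain ⟨M, hM0, hM⟩ := exists_stripIntegrand_le hn hA
  refine ⟨289 * Real.pi * M, fun h => ?_⟩
  rw [oscInt_eq_strip hg h]
  refine (strip_fourier_decay (differentiableOn_stripIntegrand hp _)
    (hM (‖h.1‖ ^ 2 + ‖h.2.1‖ ^ 2) (by positivity)) _).trans_eq ?_
  rw [heatWeight, mul_add, Real.exp_add]
  ring

/-! ### Dilations -/

section Dilation

lemma map_smul_volume {a : ℝ} (ha : a ≠ 0) :
    Measure.map (fun x : RSpace n => a • x) volume = ENNReal.ofReal |(a ^ n)⁻¹| • volume := by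
  simpa using Measure.map_addHaar_smul (volume : Measure (RSpace n)) ha

lemma map_mul_volume {b : ℝ} (hb : b ≠ 0) :
    Measure.map (fun t : ℝ => b * t) volume = ENNReal.ofReal |b⁻¹| • volume := by
  simpa using Measure.map_addHaar_smul (volume : Measure ℝ) hb

lemma map_smul_prod_volume {a b : ℝ} (ha : a ≠ 0) (hb : b ≠ 0) :
    Measure.map (Prod.map (fun x : RSpace n => a • x) (fun t : ℝ => b * t)) volume =
      ENNReal.ofReal |(a ^ n * b)⁻¹| • volume := by
  rw [Measure.volume_eq_prod, ← Measure.map_prod_map _ _ (by fun_prop) (by fun_prop),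
    map_smul_volume ha, map_mul_volume hb, Measure.prod_smul_left, Measure.prod_smul_right,
    smul_smul, ← ENNReal.ofReal_mul (abs_nonneg _), ← abs_mul, mul_inv]

/-- The Heisenberg dilation `(z, t) ↦ (r z, r² t)`. -/
def dilation (r : ℝ) (h : Heis n) : Heis n := (r • h.1, r • h.2.1, r ^ 2 * h.2.2)

lemma continuous_dilation (r : ℝ) : Continuous (dilation (n := n) r) := by
  unfold dilation; fun_prop

lemma measurableEmbedding_dilation {r : ℝ} (hr : r ≠ 0) :
    MeasurableEmbedding (dilation (n := n) r) := by
  refine ((Homeomorph.smulOfNeZero r hr).prodCongr ((Homeomorph.smulOfNeZero r hr).prodCongr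
    (Homeomorph.mulLeft₀ (r ^ 2) (pow_ne_zero 2 hr)))).toMeasurableEquiv.measurableEmbedding

lemma map_dilation_volume {r : ℝ} (hr : r ≠ 0) :
    Measure.map (dilation (n := n) r) volume = ENNReal.ofReal (r ^ (2 * n + 2))⁻¹ • volume := by
  have : dilation (n := n) r = Prod.map (fun x : RSpace n => r • x)
      (Prod.map (fun x : RSpace n => r • x) (fun t : ℝ => r ^ 2 * t)) := rfl
  rw [this, Measure.volume_eq_prod, ← Measure.map_prod_map _ _ (by fun_prop) (by fun_prop),
    map_smul_volume hr, map_smul_prod_volume hr (pow_ne_zero 2 hr), Measure.prod_smul_left,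
    Measure.prod_smul_right, smul_smul, ← ENNReal.ofReal_mul (abs_nonneg _), ← abs_mul, ← mul_inv]
  congr 2
  rw [abs_of_nonneg]
  · ring
  · rw [show r ^ n * (r ^ n * r ^ 2) = (r ^ (n + 1)) ^ 2 by ring]
    positivity

lemma integral_comp_dilation {E : Type*} [NormedAddCommGroup E] [NormedSpace ℝ E] {r : ℝ}
    (hr : r ≠ 0) (g : Heis n → E) :
    ∫ h, g (dilation r h) = (r ^ (2 * n + 2))⁻¹ • ∫ h, g h := by
  have hp : 0 ≤ (r ^ (2 * n + 2))⁻¹ := by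
    rw [show 2 * n + 2 = 2 * (n + 1) by ring, pow_mul]; positivity
  rw [← (measurableEmbedding_dilation hr).integral_map, map_dilation_volume hr,
    integral_smul_measure, ENNReal.toReal_ofReal hp]

lemma integrable_comp_dilation {E : Type*} [NormedAddCommGroup E] {r : ℝ}
    (hr : r ≠ 0) {g : Heis n → E} :
    Integrable (fun h => g (dilation r h)) ↔ Integrable g := by
  have hp : 0 < (r ^ (2 * n + 2))⁻¹ := by
    rw [show 2 * n + 2 = 2 * (n + 1) by ring, pow_mul]; positivity
  have := (measurableEmbedding_dilation (n := n) hr).integrable_map_iff (g := g) (μ := volume)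
  rw [map_dilation_volume hr, integrable_smul_measure (by simpa using hp) (by simp)] at this
  exact this.symm

/-- `p_s` is homogeneous of degree `-(2n + 2)` under the dilations `(z, t) ↦ (r z, r² t)`. -/
lemma heatKernel_dilation {r : ℝ} (hr : 0 < r) (h : Heis n) :
    heatKernel n (r ^ 2) (dilation r h) = (r ^ (2 * n + 2))⁻¹ * heatKernel n 1 h := by
  have e : ∀ l : ℝ, Real.cos (l * (dilation r h).2.2) *
      heatKernelFourier (r ^ 2) (dilation r h).1 (dilation r h).2.1 l =
      (r ^ (2 * n))⁻¹ * (fun l => Real.cos (l * h.2.2) * heatKernelFourier 1 h.1 h.2.1 l)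
        (l * r ^ 2) := by
    intro l
    have hq : l / Real.sinh (l * r ^ 2) = (r ^ 2)⁻¹ * (l * r ^ 2 / Real.sinh (l * r ^ 2)) := by
      field_simp
    simp only [dilation, heatKernelFourier, mul_one, norm_smul, Real.norm_eq_abs, abs_of_pos hr]
    rw [hq, mul_pow ((r ^ 2)⁻¹), show l * (r ^ 2 * h.2.2) = l * r ^ 2 * h.2.2 by ring,
      show (r * ‖h.1‖) ^ 2 + (r * ‖h.2.1‖) ^ 2 = r ^ 2 * (‖h.1‖ ^ 2 + ‖h.2.1‖ ^ 2) by ring,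
      inv_pow, ← pow_mul]
    have : ∀ c w : ℝ, -(1 / 4) * l * c * (r ^ 2 * w) = -(1 / 4) * (l * r ^ 2) * c * w := by
      intros; ring
    rw [this]
    ring
  simp only [heatKernel]
  rw [integral_congr_ae (ae_of_all _ e), integral_const_mul, Measure.integral_comp_mul_right
    (fun l => Real.cos (l * h.2.2) * heatKernelFourier 1 h.1 h.2.1 l),
    abs_of_pos (by positivity), smul_eq_mul, pow_add]
  generalize (∫ l : ℝ, Real.cos (l * h.2.2) * heatKernelFourier 1 h.1 h.2.1 l) = J
  field_simp

end Dilation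

/-! ### The total mass of the heat kernel -/

/-- Fourier inversion at the origin. -/
lemma integral_fourier_eq {H : ℝ → ℂ} (hc : Continuous H) (hi : Integrable H)
    (hF : Integrable fun t : ℝ => ∫ x : ℝ, Complex.exp (-Complex.I * x * t) * H x) :
    ∫ t : ℝ, ∫ x : ℝ, Complex.exp (-Complex.I * x * t) * H x = 2 * Real.pi * H 0 := by
  have e : ∀ t : ℝ, FourierTransform.fourier H t =
      ∫ x : ℝ, Complex.exp (-Complex.I * x * (t * (2 * Real.pi) : ℝ)) * H x := by
    intro t
    rw [Real.fourier_real_eq_integral_exp_smul]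
    refine integral_congr_ae (ae_of_all _ fun x => ?_)
    simp only [smul_eq_mul]
    congr 2
    push_cast
    ring
  have h2pi : (2 * Real.pi) ≠ 0 := by positivity
  have hF' : Integrable (FourierTransform.fourier H) := by
    rw [funext e]
    exact hF.comp_mul_right' h2pi
  have := hi.fourierInv_fourier_eq hF' (v := 0) hc.continuousAt
  rw [Real.fourierInv_eq'] at this
  simp only [inner_zero_right, mul_zero, Complex.ofReal_zero, zero_mul, Complex.exp_zero,
    one_smul] at this
  rw [← this, integral_congr_ae (ae_of_all _ e), Measure.integral_comp_mul_right
    (fun t : ℝ => ∫ x : ℝ, Complex.exp (-Complex.I * x * t) * H x), abs_of_pos (by positivity),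
    Complex.real_smul]
  push_cast
  field_simp

lemma exists_norm_heatKernel_le (hn : n ≠ 0) :
    ∃ K : ℝ, ∀ h : Heis n, |heatKernel n 1 h| ≤ K * heatWeight h := by
  obtain ⟨K, hK⟩ := exists_norm_oscInt_le hn (p := fun _ => 1) (A := 1) (by fun_prop)
    (fun z _ => by simp) (g := fun l => (heatAmp n 1 l : ℂ)) (fun l _ => by simp)
  refine ⟨K, fun h => ?_⟩
  rw [heatKernel_eq_re_oscInt hn one_pos]
  exact (Complex.abs_re_le_norm _).trans (hK h)

lemma integrable_heatKernel_one (hn : n ≠ 0) : Integrable (heatKernel n 1) := by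
  obtain ⟨K, hK⟩ := exists_norm_heatKernel_le hn
  exact (integrable_heatWeight.const_mul K).mono'
    (contDiff_heatKernel hn one_pos).continuous.aestronglyMeasurable (ae_of_all _ hK)

/-- Fourier inversion at frequency `0`: integrating `p₁` in `t` leaves the Euclidean heat kernel
of `ℝ²ⁿ`. -/
lemma integral_heatKernel_t (hn : n ≠ 0) (x y : RSpace n) :
    ∫ t : ℝ, heatKernel n 1 (x, y, t) =
      ((4 * Real.pi) ^ n)⁻¹ * (Real.exp (-(1 / 4) * ‖x‖ ^ 2) * Real.exp (-(1 / 4) * ‖y‖ ^ 2)) := by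
  obtain ⟨M, hM0, hM⟩ := exists_stripIntegrand_le hn (p := fun _ => 1) (A := 1)
    (fun z _ => by simp)
  have hd := differentiableOn_stripIntegrand (n := n) (p := fun _ => 1) (by fun_prop)
    (‖x‖ ^ 2 + ‖y‖ ^ 2)
  have hb := hM (‖x‖ ^ 2 + ‖y‖ ^ 2) (by positivity)
  have hk : ∀ t : ℝ, (heatKernel n 1 (x, y, t) : ℂ) = ∫ l : ℝ, Complex.exp (-Complex.I * l * t) *
      stripIntegrand n (fun _ => 1) (‖x‖ ^ 2 + ‖y‖ ^ 2) l := by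
    intro t
    rw [heatKernel_eq_re_oscInt hn one_pos, ofReal_re_oscInt (heatRate_neg 1)
      (fun l => by simp [heatAmp_neg]), oscInt_eq_strip (p := fun _ => 1) (fun l _ => by simp)]
  have hint : Integrable fun t : ℝ => ∫ l : ℝ, Complex.exp (-Complex.I * l * t) *
      stripIntegrand n (fun _ => 1) (‖x‖ ^ 2 + ‖y‖ ^ 2) l := by
    refine (integrable_inv_one_add_sq.const_mul _).mono' ?_
      (ae_of_all _ fun t => strip_fourier_decay hd hb t)
    simp_rw [← hk]
    refine Continuous.aestronglyMeasurable ?_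
    have := (contDiff_heatKernel hn one_pos).continuous
    fun_prop
  have key := integral_fourier_eq (strip_continuous one_pos hd)
    (by simpa using strip_integrable one_pos hd hb 0) hint
  simp_rw [← hk] at key
  rw [integral_complex_ofReal] at key
  have e0 : 2 * Real.pi * stripIntegrand n (fun _ => 1) (‖x‖ ^ 2 + ‖y‖ ^ 2) ((0 : ℝ) : ℂ) =
      ((((4 * Real.pi) ^ n)⁻¹ * (Real.exp (-(1 / 4) * ‖x‖ ^ 2) *
        Real.exp (-(1 / 4) * ‖y‖ ^ 2)) : ℝ) : ℂ) := by
    rw [← Real.exp_add, stripIntegrand, heatConst]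
    simp only [Complex.ofReal_zero, zCoth, zDivSinh_zero, Complex.cosh_zero]
    have hpi : (Real.pi : ℂ) ≠ 0 := by exact_mod_cast Real.pi_ne_zero
    push_cast
    rw [show (-(1 * 1) * ((‖x‖ : ℂ) ^ 2 + (‖y‖ : ℂ) ^ 2) / 4) =
      -(1 / 4) * (‖x‖ : ℂ) ^ 2 + -(1 / 4) * (‖y‖ : ℂ) ^ 2 by ring]
    field_simp
    exact one_pow n
  rw [e0] at key
  exact_mod_cast key

lemma integral_heatKernel_one (hn : n ≠ 0) : ∫ h, heatKernel n 1 h = 1 := by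
  have hi := integrable_heatKernel_one hn
  rw [Measure.volume_eq_prod] at hi ⊢
  rw [integral_prod _ hi]
  have e : ∀ᵐ x : RSpace n, ∫ q : RSpace n × ℝ, heatKernel n 1 (x, q) =
      ((4 * Real.pi) ^ n)⁻¹ * (Real.exp (-(1 / 4) * ‖x‖ ^ 2) *
        ∫ y : RSpace n, Real.exp (-(1 / 4) * ‖y‖ ^ 2)) := by
    filter_upwards [hi.prod_right_ae] with x hx
    rw [Measure.volume_eq_prod] at hx ⊢
    rw [integral_prod _ hx]
    simp_rw [integral_heatKernel_t hn, integral_const_mul]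
  rw [integral_congr_ae e, integral_const_mul, integral_mul_const,
    GaussianFourier.integral_rexp_neg_mul_sq_norm (by norm_num), ← Real.rpow_add (by positivity)]
  rw [show Real.pi / (1 / 4) = 4 * Real.pi by ring, finrank_euclideanSpace, Fintype.card_fin,
    add_halves, Real.rpow_natCast, inv_mul_cancel₀ (by positivity)]

/-- `p_s` is the heat kernel of the sub-Laplacian. -/
theorem isHeatKernel_heatKernel (hn : n ≠ 0) : IsHeatKernel (heatKernel n) := by
  have hr : ∀ s : ℝ, 0 < s → ∃ r : ℝ, 0 < r ∧ s = r ^ 2 := fun s hs =>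
    ⟨√s, Real.sqrt_pos.2 hs, (Real.sq_sqrt hs.le).symm⟩
  have hint : ∀ s > 0, Integrable (heatKernel n s) := by
    intro s hs
    obtain ⟨r, hr, rfl⟩ := hr s hs
    rw [← integrable_comp_dilation hr.ne']
    simp_rw [heatKernel_dilation hr]
    exact (integrable_heatKernel_one hn).const_mul _
  -- Dilations reduce integrals of functionals of `p_s`, `s = r²`, to time `1`.
  have hscale : ∀ r > 0, ∀ φ : ℝ → Heis n → ℝ, (∀ c a h, 0 ≤ c → φ (c * a) h = c * φ a h) →
      ∫ h, φ (heatKernel n (r ^ 2) h) h = ∫ h, φ (heatKernel n 1 h) (dilation r h) := by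
    intro r hr φ hφ
    have h1 := integral_comp_dilation hr.ne' (fun h => φ (heatKernel n (r ^ 2) h) h)
    simp_rw [heatKernel_dilation hr] at h1
    have hc : 0 < (r ^ (2 * n + 2))⁻¹ := by positivity
    simp_rw [hφ _ _ _ hc.le] at h1
    rw [integral_const_mul, smul_eq_mul] at h1
    exact (mul_left_cancel₀ hc.ne' h1).symm
  refine ⟨fun s hs => contDiff_heatKernel hn hs, fun s hs h => hasDerivAt_heatKernel hn hs h,
    hint, ⟨∫ h, |heatKernel n 1 h|, fun s hs => ?_⟩, fun φ hφ ⟨B, hB⟩ => ?_⟩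
  · obtain ⟨r, hr, rfl⟩ := hr s hs
    exact (hscale r hr (fun a _ => |a|) fun c a _ hc => by rw [abs_mul, abs_of_nonneg hc]).le
  · have e : ∀ᶠ s in 𝓝[>] (0 : ℝ), ∫ h, heatKernel n 1 h * φ (dilation (√s) h) =
        ∫ h, heatKernel n s h * φ h := by
      filter_upwards [self_mem_nhdsWithin] with s hs
      have := hscale (√s) (Real.sqrt_pos.2 hs) (fun a h => a * φ h)
        fun c a h _ => by ring
      rw [Real.sq_sqrt (le_of_lt hs)] at this
      exact this.symm
    refine Tendsto.congr' e ?_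
    -- Since `p₁` has integral `1`, dominated convergence applies.
    have h1 : φ 0 = ∫ h, heatKernel n 1 h * φ 0 := by
      rw [integral_mul_const, integral_heatKernel_one hn, one_mul]
    rw [h1]
    have hK := (contDiff_heatKernel hn one_pos).continuous
    refine tendsto_integral_filter_of_dominated_convergence (fun h => |heatKernel n 1 h| * B)
      ?_ ?_ ((integrable_heatKernel_one hn).abs.mul_const B) ?_
    · refine Eventually.of_forall fun s => Continuous.aestronglyMeasurable ?_
      have := continuous_dilation (n := n) (√s)
      fun_prop
    · refine Eventually.of_forall fun s => ae_of_all _ fun h => ?_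
      rw [norm_mul, Real.norm_eq_abs, Real.norm_eq_abs]
      gcongr
      exact hB _
    · refine ae_of_all _ fun h => ?_
      have hc : Continuous fun s : ℝ => heatKernel n 1 h * φ (dilation (√s) h) := by
        unfold dilation
        fun_prop
      have := (hc.tendsto 0).mono_left (nhdsWithin_le_nhds (s := Set.Ioi 0))
      have e0 : dilation (√0) h = 0 := by simp [dilation]
      rw [e0] at this
      exact this

/-! ### Mehler's formula in one variable -/

section Mehler

open Polynomial

lemma derivative_hermite_succ (k : ℕ) :
    derivative (hermite (k + 1)) = ((k : ℤ[X]) + 1) * hermite k := by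
  induction k with
  | zero => simp
  | succ k ih =>
    rw [hermite_succ (k + 1), derivative_sub, derivative_mul, derivative_X, one_mul, ih,
      derivative_mul, hermite_succ k]
    simp only [derivative_add, derivative_natCast, derivative_one]
    push_cast
    ring

lemma aeval_hermite_add_two (k : ℕ) (x : ℂ) :
    aeval x (hermite (k + 2)) =
      x * aeval x (hermite (k + 1)) - (k + 1) * aeval x (hermite k) := by
  rw [hermite_succ (k + 1), derivative_hermite_succ]
  simp

/-- The standard Gaussian density, without its normalization. -/
def gaussW (u : ℝ) : ℝ := Real.exp (-(1 / 2) * u ^ 2)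

lemma gaussW_nonneg (u : ℝ) : 0 ≤ gaussW u := Real.exp_nonneg _

lemma continuous_gaussW : Continuous gaussW := by unfold gaussW; fun_prop

lemma hasDerivAt_gaussW (u : ℝ) : HasDerivAt (fun u => (gaussW u : ℂ)) (-(u : ℂ) * gaussW u) u := by
  have : HasDerivAt gaussW (-u * gaussW u) u := by
    have h := ((hasDerivAt_pow 2 u).const_mul (-(1 / 2) : ℝ)).exp
    convert! h using 1
    simp only [gaussW]
    push_cast
    ring
  convert! this.ofReal_comp using 1
  push_cast; ring

lemma norm_add_I_mul_sq (x u : ℝ) : ‖(x : ℂ) + Complex.I * u‖ ^ 2 = x ^ 2 + u ^ 2 := by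
  rw [← Complex.normSq_eq_norm_sq, Complex.normSq_apply]
  simp
  ring

lemma integrable_add_I_mul_pow (x : ℝ) (k : ℕ) :
    Integrable fun u : ℝ => ((x : ℂ) + Complex.I * u) ^ k * gaussW u := by
  have hg : Integrable fun u : ℝ => (1 + k.factorial * 4 ^ k * Real.exp (x ^ 2 / 4)) *
      Real.exp (-(1 / 4) * u ^ 2) := (integrable_exp_neg_mul_sq (by norm_num)).const_mul _
  refine hg.mono' (Continuous.aestronglyMeasurable ?_) (ae_of_all _ fun u => ?_)
  · have := continuous_gaussW
    fun_prop
  rw [norm_mul, norm_pow, Complex.norm_real, Real.norm_of_nonneg (gaussW_nonneg u)]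
  set a := ‖(x : ℂ) + Complex.I * u‖ with ha
  have h1 : a ^ k ≤ 1 + (a ^ 2) ^ k := by
    rw [← pow_mul, mul_comm, pow_mul]
    nlinarith [sq_nonneg (a ^ k - 1)]
  have h2 : (a ^ 2) ^ k ≤ k.factorial * 4 ^ k * Real.exp ((x ^ 2 + u ^ 2) / 4) := by
    rw [ha, norm_add_I_mul_sq]
    have := Real.pow_div_factorial_le_exp ((x ^ 2 + u ^ 2) / 4) (by positivity) k
    rw [div_le_iff₀ (by positivity), div_pow, div_le_iff₀ (by positivity)] at this
    linarith
  have h3 : Real.exp (-(1 / 4) * u ^ 2) ≥ gaussW u := by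
    refine Real.exp_le_exp.2 ?_
    nlinarith [sq_nonneg u]
  have h4 : Real.exp ((x ^ 2 + u ^ 2) / 4) * gaussW u =
      Real.exp (x ^ 2 / 4) * Real.exp (-(1 / 4) * u ^ 2) := by
    rw [gaussW, ← Real.exp_add, ← Real.exp_add]; ring_nf
  have hw : 0 ≤ gaussW u := Real.exp_nonneg _
  calc a ^ k * gaussW u
      ≤ (1 + k.factorial * 4 ^ k * Real.exp ((x ^ 2 + u ^ 2) / 4)) * gaussW u := by
        gcongr; linarith
    _ = gaussW u + k.factorial * 4 ^ k * (Real.exp ((x ^ 2 + u ^ 2) / 4) * gaussW u) := by ring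
    _ ≤ _ := by rw [h4]; linarith

/-- The Hermite polynomials are Gaussian moments: `He_k(x) = E (x + iu)^k`. -/
lemma integral_add_I_mul_pow (x : ℝ) (k : ℕ) :
    ∫ u : ℝ, ((x : ℂ) + Complex.I * u) ^ k * gaussW u =
      (Real.sqrt (2 * Real.pi) : ℂ) * aeval (x : ℂ) (hermite k) := by
  have h0 : ∫ u : ℝ, (gaussW u : ℂ) = (Real.sqrt (2 * Real.pi) : ℂ) := by
    rw [integral_complex_ofReal]
    simp only [gaussW]
    rw [integral_gaussian]
    congr 2
    ring
  have hstep : ∀ k : ℕ, ∫ u : ℝ, ((x : ℂ) + Complex.I * u) ^ (k + 1) * gaussW u =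
      x * (∫ u : ℝ, ((x : ℂ) + Complex.I * u) ^ k * gaussW u) -
        k * ∫ u : ℝ, ((x : ℂ) + Complex.I * u) ^ (k - 1) * gaussW u := by
    intro k
    have hd : ∀ u : ℝ, HasDerivAt (fun u : ℝ => ((x : ℂ) + Complex.I * u) ^ k)
        (k * ((x : ℂ) + Complex.I * u) ^ (k - 1) * Complex.I) u := fun u => by
      have h : HasDerivAt (fun u : ℝ => (x : ℂ) + Complex.I * u) Complex.I u := by
        simpa using ((hasDerivAt_id u).ofReal_comp.const_mul Complex.I).const_add (x : ℂ)
      exact h.pow k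
    have i1 := integrable_add_I_mul_pow x (k + 1)
    have i2 := integrable_add_I_mul_pow x k
    have i3 := integrable_add_I_mul_pow x (k - 1)
    have e1 : ∀ u : ℝ, ((x : ℂ) + Complex.I * u) ^ k * (-(u : ℂ) * gaussW u) =
        Complex.I * (((x : ℂ) + Complex.I * u) ^ (k + 1) * gaussW u) -
        Complex.I * x * (((x : ℂ) + Complex.I * u) ^ k * gaussW u) := fun u => by
      rw [pow_succ]
      linear_combination -((x : ℂ) + Complex.I * u) ^ k * u * gaussW u * Complex.I_mul_I
    have e2 : ∀ u : ℝ, k * ((x : ℂ) + Complex.I * u) ^ (k - 1) * Complex.I * gaussW u =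
        k * Complex.I * (((x : ℂ) + Complex.I * u) ^ (k - 1) * gaussW u) := fun u => by ring
    have key := integral_mul_deriv_eq_deriv_mul_of_integrable
      (u := fun u : ℝ => ((x : ℂ) + Complex.I * u) ^ k)
      (v := fun u : ℝ => (gaussW u : ℂ))
      (u' := fun u : ℝ => k * ((x : ℂ) + Complex.I * u) ^ (k - 1) * Complex.I)
      (v' := fun u : ℝ => -(u : ℂ) * gaussW u)
      (fun u _ => hd u) (fun u _ => hasDerivAt_gaussW u)
      (((i1.const_mul Complex.I).sub (i2.const_mul (Complex.I * x))).congr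
        (ae_of_all _ fun u => (e1 u).symm))
      ((i3.const_mul (k * Complex.I)).congr (ae_of_all _ fun u => (e2 u).symm)) i2
    rw [integral_congr_ae (ae_of_all _ e1), integral_congr_ae (ae_of_all _ e2),
      integral_sub (i1.const_mul _) (i2.const_mul _), integral_const_mul, integral_const_mul,
      integral_const_mul] at key
    have hI : Complex.I ≠ 0 := Complex.I_ne_zero
    apply mul_left_cancel₀ hI
    linear_combination key
  induction k using Nat.twoStepInduction with
  | zero => simpa using h0
  | one =>
    rw [hstep 0]
    simp only [pow_zero, one_mul, h0, hermite_one, aeval_X]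
    push_cast; ring
  | more k ih1 ih2 =>
    rw [hstep (k + 1), ih2, Nat.add_sub_cancel, ih1, aeval_hermite_add_two]
    push_cast; ring

/-- The double Gaussian integral behind Mehler's formula. -/
lemma integral_mehler {ρ : ℝ} (h0 : 0 ≤ ρ) (h1 : ρ < 1) (x y : ℝ) :
    ∫ u : ℝ, ∫ v : ℝ, Complex.exp (ρ * (((x : ℂ) + Complex.I * u) * (y + Complex.I * v))) *
      (gaussW u * gaussW v) = ((2 * Real.pi * (Real.sqrt (1 - ρ ^ 2))⁻¹ *
        Real.exp (ρ * x * y - ρ ^ 2 * x ^ 2 / 2 -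
          (ρ * y - ρ ^ 2 * x) ^ 2 / (2 * (1 - ρ ^ 2))) : ℝ) : ℂ) := by
  have hρ : 0 < 1 - ρ ^ 2 := by nlinarith
  have hI : Complex.I ^ 2 = -1 := Complex.I_sq
  have e1 : ∀ u : ℝ, ∫ v : ℝ, Complex.exp (ρ * (((x : ℂ) + Complex.I * u) * (y + Complex.I * v))) *
      (gaussW u * gaussW v) = (2 * Real.pi : ℂ) ^ (1 / 2 : ℂ) *
        Complex.exp ((-((1 - ρ ^ 2) / 2 : ℝ) : ℂ) * u ^ 2 + (Complex.I * (ρ * y - ρ ^ 2 * x)) * u +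
          (ρ * x * y - ρ ^ 2 * x ^ 2 / 2)) := by
    intro u
    have e2 : ∀ v : ℝ, Complex.exp (ρ * (((x : ℂ) + Complex.I * u) * (y + Complex.I * v))) *
      (gaussW u * gaussW v) = Complex.exp ((-(1 / 2) : ℂ) * v ^ 2 +
        (ρ * Complex.I * (x + Complex.I * u)) * v +
        (ρ * (x + Complex.I * u) * y - 1 / 2 * u ^ 2)) := by
      intro v
      simp only [gaussW, Complex.ofReal_exp]
      rw [← Complex.exp_add, ← Complex.exp_add]
      congr 1
      push_cast
      ring
    rw [integral_congr_ae (ae_of_all _ e2), integral_cexp_quadratic (by norm_num)]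
    congr 2
    · ring
    · push_cast
      linear_combination (-(ρ : ℂ) ^ 2 * (x + Complex.I * u) ^ 2 * (-1 / 2) + 0) * hI +
        (-(ρ : ℂ) ^ 2 * u ^ 2 / 2) * hI
  rw [integral_congr_ae (ae_of_all _ e1), integral_const_mul, integral_cexp_quadratic (by
    rw [← Complex.ofReal_neg, Complex.ofReal_re]; linarith)]
  have s1 : (2 * Real.pi : ℂ) ^ (1 / 2 : ℂ) = (Real.sqrt (2 * Real.pi) : ℂ) := by
    rw [Real.sqrt_eq_rpow, Complex.ofReal_cpow (by positivity)]; push_cast; rfl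
  have s2 : (Real.pi / -(-((1 - ρ ^ 2) / 2 : ℝ) : ℂ)) ^ (1 / 2 : ℂ) =
      (Real.sqrt (2 * Real.pi) * (Real.sqrt (1 - ρ ^ 2))⁻¹ : ℝ) := by
    rw [← div_eq_mul_inv, ← Real.sqrt_div (by positivity), Real.sqrt_eq_rpow,
      Complex.ofReal_cpow (by positivity)]
    congr 1
    · rw [neg_neg, ← Complex.ofReal_div]
      congr 1
      field_simp
    · push_cast; rfl
  rw [s1, s2, ← mul_assoc, ← Complex.ofReal_mul, ← mul_assoc, Real.mul_self_sqrt (by positivity)]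
  push_cast
  congr 2
  have hρ' : (1 - (ρ : ℂ) ^ 2) ≠ 0 := by exact_mod_cast hρ.ne'
  field_simp
  linear_combination (4 * ((ρ : ℂ) * y - ρ ^ 2 * x) ^ 2) * hI

/-- Mehler's formula for the probabilists' Hermite polynomials. With
`He_k(x) = (2π)^{-1/2} ∫ (x + iu)^k e^{-u²/2} du` for each of the two factors, the series becomes an
exponential series under a double Gaussian integral. -/
lemma hasSum_hermite_mul_hermite {ρ : ℝ} (h0 : 0 ≤ ρ) (h1 : ρ < 1) (x y : ℝ) :
    HasSum (fun k : ℕ => ρ ^ k / k.factorial * (aeval x (hermite k) * aeval y (hermite k)))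
      ((Real.sqrt (1 - ρ ^ 2))⁻¹ * Real.exp (ρ * x * y - ρ ^ 2 * x ^ 2 / 2 -
          (ρ * y - ρ ^ 2 * x) ^ 2 / (2 * (1 - ρ ^ 2)))) := by
  set F : ℕ → ℝ × ℝ → ℂ := fun k p => (ρ ^ k / k.factorial : ℝ) *
    ((((x : ℂ) + Complex.I * p.1) ^ k * gaussW p.1) *
      (((y : ℂ) + Complex.I * p.2) ^ k * gaussW p.2))
    with hF
  have hw := continuous_gaussW
  have hsum : ∀ p : ℝ × ℝ, HasSum (fun k => F k p)
      (Complex.exp (ρ * (((x : ℂ) + Complex.I * p.1) * (y + Complex.I * p.2))) *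
      (gaussW p.1 * gaussW p.2)) := by
    intro p
    have := (NormedSpace.expSeries_div_hasSum_exp
      ((ρ : ℂ) * (((x : ℂ) + Complex.I * p.1) * (y + Complex.I * p.2)))).mul_right
      ((gaussW p.1 : ℂ) * gaussW p.2)
    rw [← Complex.exp_eq_exp_ℂ] at this
    convert! this using 1
    ext k
    simp only [hF, mul_pow]
    push_cast
    ring
  have hnorm : ∀ p : ℝ × ℝ, HasSum (fun k => ‖F k p‖)
      (Real.exp (ρ * (‖(x : ℂ) + Complex.I * p.1‖ * ‖y + Complex.I * p.2‖)) *
      (gaussW p.1 * gaussW p.2)) := by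
    intro p
    have := (NormedSpace.expSeries_div_hasSum_exp
      (ρ * (‖(x : ℂ) + Complex.I * p.1‖ * ‖y + Complex.I * p.2‖))).mul_right
      (gaussW p.1 * gaussW p.2)
    rw [← Real.exp_eq_exp_ℝ] at this
    convert! this using 1
    ext k
    have g1 : 0 ≤ gaussW p.1 := Real.exp_nonneg _
    have g2 : 0 ≤ gaussW p.2 := Real.exp_nonneg _
    simp only [hF, norm_mul, norm_pow, mul_pow, Complex.norm_real, Real.norm_of_nonneg g1,
      Real.norm_of_nonneg g2]
    rw [Real.norm_of_nonneg (by positivity)]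
    ring
  have hint : Integrable fun p : ℝ × ℝ =>
      Real.exp (ρ * (‖(x : ℂ) + Complex.I * p.1‖ * ‖y + Complex.I * p.2‖)) *
      (gaussW p.1 * gaussW p.2) := by
    have hb : (0 : ℝ) < (1 - ρ) / 2 := by linarith
    have := ((integrable_exp_neg_mul_sq hb).mul_prod (integrable_exp_neg_mul_sq hb)).const_mul
      (Real.exp (ρ * (x ^ 2 + y ^ 2) / 2))
    refine this.mono' (Continuous.aestronglyMeasurable (by fun_prop)) (ae_of_all _ fun p => ?_)
    rw [Real.norm_of_nonneg (by have := Real.exp_nonneg; unfold gaussW; positivity)]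
    simp only [gaussW, ← Real.exp_add]
    refine Real.exp_le_exp.2 ?_
    have a1 := norm_add_I_mul_sq x p.1
    have a2 := norm_add_I_mul_sq y p.2
    have a3 := two_mul_le_add_sq ‖(x : ℂ) + Complex.I * p.1‖ ‖(y : ℂ) + Complex.I * p.2‖
    rw [a1, a2] at a3
    nlinarith
  have hmain := hasSum_integral_of_dominated_convergence (μ := (volume : Measure (ℝ × ℝ)))
    (F := F) (bound := fun k p => ‖F k p‖)
    (fun k => Continuous.aestronglyMeasurable (by simp only [hF]; fun_prop))
    (fun k => ae_of_all _ fun p => le_rfl)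
    (ae_of_all _ fun p => (hnorm p).summable)
    (by simp_rw [fun p => (hnorm p).tsum_eq]; exact hint)
    (ae_of_all _ hsum)
  have hI1 : ∀ k, ∫ p, F k p = ((2 * Real.pi * (ρ ^ k / k.factorial *
      (aeval x (hermite k) * aeval y (hermite k))) : ℝ) : ℂ) := by
    intro k
    simp only [hF]
    rw [integral_const_mul, Measure.volume_eq_prod, integral_prod_mul
      (fun u : ℝ => ((x : ℂ) + Complex.I * u) ^ k * (gaussW u : ℂ))
      (fun u : ℝ => ((y : ℂ) + Complex.I * u) ^ k * (gaussW u : ℂ)),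
      integral_add_I_mul_pow, integral_add_I_mul_pow]
    have hs : (Real.sqrt (2 * Real.pi) : ℂ) * Real.sqrt (2 * Real.pi) = 2 * Real.pi := by
      rw [← Complex.ofReal_mul, Real.mul_self_sqrt (by positivity)]; push_cast; rfl
    have hx : ∀ x : ℝ, aeval (x : ℂ) (hermite k) = ((aeval x (hermite k) : ℝ) : ℂ) := fun x =>
      aeval_algebraMap_apply ℂ x (hermite k)
    rw [hx, hx]
    push_cast
    linear_combination (ρ ^ k / k.factorial : ℂ) * (aeval x (hermite k) : ℝ) *
      (aeval y (hermite k) : ℝ) * hs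
  have hI2 : ∫ p : ℝ × ℝ, Complex.exp (ρ * (((x : ℂ) + Complex.I * p.1) * (y + Complex.I * p.2))) *
      (gaussW p.1 * gaussW p.2) = ∫ u : ℝ, ∫ v : ℝ,
        Complex.exp (ρ * (((x : ℂ) + Complex.I * u) * (y + Complex.I * v))) *
          (gaussW u * gaussW v) := by
    rw [Measure.volume_eq_prod, integral_prod]
    refine hint.mono' (Continuous.aestronglyMeasurable (by fun_prop)) (ae_of_all _ fun p => ?_)
    rw [← (hsum p).tsum_eq, ← (hnorm p).tsum_eq]
    exact norm_tsum_le_tsum_norm (hnorm p).summable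
  rw [hI2, integral_mehler h0 h1 x y] at hmain
  simp_rw [hI1] at hmain
  have h2 := (Complex.hasSum_ofReal.1 hmain).mul_left (2 * Real.pi)⁻¹
  have hpi := Real.pi_ne_zero
  convert! h2 using 1
  · ext k; field_simp
  · field_simp

/-- Mehler's formula for the normalized Hermite functions, in hyperbolic form. -/
lemma hasSum_hermiteFun_mul_hermiteFun {τ : ℝ} (hτ : 0 < τ) (u v : ℝ) :
    HasSum (fun k : ℕ => Real.exp (-(2 * k + 1) * τ) * (hermiteFun k u * hermiteFun k v))
      ((Real.sqrt (2 * Real.pi * Real.sinh (2 * τ)))⁻¹ *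
        Real.exp (-(1 / 4) * (Real.sinh τ / Real.cosh τ * (u + v) ^ 2 +
          Real.cosh τ / Real.sinh τ * (u - v) ^ 2))) := by
  set a := Real.exp (-τ) with ha
  have ha0 : 0 < a := Real.exp_pos _
  have ha1 : a < 1 := by
    rw [ha, ← Real.exp_zero]; exact Real.exp_lt_exp.2 (by linarith)
  have ha2 : a ^ 2 < 1 := by nlinarith
  have hρ : 0 < 1 - (a ^ 2) ^ 2 := by nlinarith
  have hτa : Real.exp τ = a⁻¹ := by rw [ha, Real.exp_neg, inv_inv]
  have h := (hasSum_hermite_mul_hermite (sq_nonneg a) ha2 (√2 * u) (√2 * v)).mul_left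
    (a * (√Real.pi)⁻¹ * Real.exp (-u ^ 2 / 2 + -v ^ 2 / 2))
  have h22 : √2 ^ 2 = (2 : ℝ) := Real.sq_sqrt (by norm_num)
  convert! h using 1
  · ext k
    have e1 : Real.exp (-(2 * k + 1) * τ) = a * (a ^ 2) ^ k := by
      rw [ha, ← pow_mul, ← Real.exp_nat_mul, ← Real.exp_add]
      congr 1; push_cast; ring
    have e2 : (Real.sqrt (k.factorial * Real.sqrt Real.pi))⁻¹ *
        (Real.sqrt (k.factorial * Real.sqrt Real.pi))⁻¹ = (k.factorial * Real.sqrt Real.pi)⁻¹ := by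
      rw [← mul_inv, Real.mul_self_sqrt (by positivity)]
    rw [e1, hermiteFun, hermiteFun, Real.exp_add]
    rw [mul_inv] at e2
    linear_combination (a * (a ^ 2) ^ k) * (aeval (√2 * u) (hermite k)) *
      (aeval (√2 * v) (hermite k)) * Real.exp (-u ^ 2 / 2) * Real.exp (-v ^ 2 / 2) * e2
  · have e3 : Real.sqrt (2 * Real.pi * Real.sinh (2 * τ)) =
        √Real.pi * a⁻¹ * √(1 - (a ^ 2) ^ 2) := by
      have : 2 * Real.pi * Real.sinh (2 * τ) = Real.pi * (a⁻¹) ^ 2 * (1 - (a ^ 2) ^ 2) := by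
        rw [Real.sinh_eq, show 2 * τ = τ + τ by ring, neg_add, Real.exp_add, Real.exp_add, hτa,
          ← ha]
        field_simp
      rw [this, Real.sqrt_mul (by positivity), Real.sqrt_mul (by positivity),
        Real.sqrt_sq (by positivity)]
    have e4 : Real.exp (-(1 / 4) * (Real.sinh τ / Real.cosh τ * (u + v) ^ 2 +
          Real.cosh τ / Real.sinh τ * (u - v) ^ 2)) = Real.exp (-u ^ 2 / 2 + -v ^ 2 / 2) *
        Real.exp (a ^ 2 * (√2 * u) * (√2 * v) - (a ^ 2) ^ 2 * (√2 * u) ^ 2 / 2 -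
          (a ^ 2 * (√2 * v) - (a ^ 2) ^ 2 * (√2 * u)) ^ 2 / (2 * (1 - (a ^ 2) ^ 2))) := by
      rw [← Real.exp_add]
      congr 1
      have f1 : Real.sinh τ / Real.cosh τ = (1 - a ^ 2) / (1 + a ^ 2) := by
        rw [Real.sinh_eq, Real.cosh_eq, hτa, ← ha]; field_simp
      have hm : 1 - a ^ 2 ≠ 0 := by linarith
      have f2 : Real.cosh τ / Real.sinh τ = (1 + a ^ 2) / (1 - a ^ 2) := by
        rw [← inv_div, f1, inv_div]
      rw [f1, f2, show a ^ 2 * (√2 * u) * (√2 * v) = √2 ^ 2 * (a ^ 2 * u * v) by ring,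
        show (a ^ 2) ^ 2 * (√2 * u) ^ 2 / 2 = √2 ^ 2 * ((a ^ 2) ^ 2 * u ^ 2 / 2) by ring,
        show (a ^ 2 * (√2 * v) - (a ^ 2) ^ 2 * (√2 * u)) ^ 2 =
          √2 ^ 2 * (a ^ 2 * v - (a ^ 2) ^ 2 * u) ^ 2 by ring, h22]
      have hp : 1 + a ^ 2 ≠ 0 := by positivity
      rw [show 1 - (a ^ 2) ^ 2 = (1 - a ^ 2) * (1 + a ^ 2) by ring]
      field_simp
      ring
    rw [e3, e4, mul_inv, mul_inv, inv_inv]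
    ring

end Mehler

/-! ### Mehler's formula in several variables -/

lemma hasSum_mul_prod_of_real {ι κ : Type*} {f : ι → ℝ} {g : κ → ℝ} {a b : ℝ} (hf : HasSum f a)
    (hg : HasSum g b) : HasSum (fun p : ι × κ => f p.1 * g p.2) (a * b) := by
  have h0 : Summable fun x => ‖f x‖ := hf.summable.abs
  have h1 : Summable fun x => ‖g x‖ := hg.summable.abs
  exact hf.mul hg (summable_mul_of_summable_norm h0 h1)

lemma hasSum_pi_prod (n : ℕ) : ∀ {f : Fin n → ℕ → ℝ} {s : Fin n → ℝ},
    (∀ i, HasSum (f i) (s i)) → HasSum (fun α : Fin n → ℕ => ∏ i, f i (α i)) (∏ i, s i) := by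
  induction n with
  | zero =>
    intro f s _
    simp
  | succ n ih =>
    intro f s h
    have h1 : HasSum (fun α : Fin n → ℕ => ∏ i : Fin n, f i.succ (α i)) (∏ i : Fin n, s i.succ) :=
      ih (f := fun i => f i.succ) (s := fun i => s i.succ) fun i => h i.succ
    have h2 := hasSum_mul_prod_of_real (h 0) h1
    have e1 : ∏ i : Fin (n + 1), s i = s 0 * ∏ i : Fin n, s i.succ := Fin.prod_univ_succ s
    have e2 : (fun α : Fin (n + 1) → ℕ => ∏ i, f i (α i)) ∘ (Fin.consEquiv fun _ => ℕ) =
        fun p : ℕ × (Fin n → ℕ) => f 0 p.1 * ∏ i : Fin n, f i.succ (p.2 i) := by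
      funext p
      exact Fin.prod_univ_succ fun i => f i (Fin.cons (α := fun _ => ℕ) p.1 p.2 i)
    rw [e1, ← (Fin.consEquiv fun _ : Fin (n + 1) => ℕ).hasSum_iff, e2]
    exact h2

/-- The Mehler kernel, the integral kernel of `e^{-rH(λ)}`. -/
def mehlerKernel (r l : ℝ) (ξ ξ' : RSpace n) : ℝ :=
  √(l / (2 * Real.pi * Real.sinh (2 * (l * r)))) ^ n *
    Real.exp (-(l / 4) * (Real.sinh (l * r) / Real.cosh (l * r) * ‖ξ + ξ'‖ ^ 2 +
      Real.cosh (l * r) / Real.sinh (l * r) * ‖ξ - ξ'‖ ^ 2))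

lemma mehlerKernel_neg (r l : ℝ) (ξ ξ' : RSpace n) :
    mehlerKernel r (-l) ξ ξ' = mehlerKernel r l ξ ξ' := by
  unfold mehlerKernel
  simp only [neg_mul, mul_neg, Real.sinh_neg, Real.cosh_neg, neg_div_neg_eq]
  congr 2
  ring

lemma mehlerKernel_abs (r l : ℝ) (ξ ξ' : RSpace n) :
    mehlerKernel r |l| ξ ξ' = mehlerKernel r l ξ ξ' := by
  rcases abs_choice l with h | h <;> rw [h]
  exact mehlerKernel_neg r l ξ ξ'

lemma continuous_hermiteFun (k : ℕ) : Continuous (hermiteFun k) := by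
  unfold hermiteFun
  have := (Polynomial.continuous_aeval (A := ℝ) (Polynomial.hermite k))
  fun_prop

lemma continuous_scaledHermite (l : ℝ) (α : Fin n → ℕ) : Continuous (scaledHermite l α) := by
  unfold scaledHermite
  have := continuous_hermiteFun
  fun_prop

/-- The weight `e^{-(2|α| + n)|λ| r}`. -/
def hermiteWeight (r l : ℝ) (α : Fin n → ℕ) : ℝ :=
  Real.exp (-((2 * ∑ i, (α i : ℝ)) + n) * |l| * r)

/-- Mehler's formula for the scaled Hermite functions on `ℝⁿ`. -/
lemma hasSum_scaledHermite_mul {r l : ℝ} (hr : 0 < r) (hl : l ≠ 0) (ξ ξ' : RSpace n) :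
    HasSum (fun α : Fin n → ℕ => hermiteWeight r l α *
      (scaledHermite l α ξ * scaledHermite l α ξ')) (mehlerKernel r l ξ ξ') := by
  have hl' : 0 < |l| := abs_pos.2 hl
  have hτ : 0 < |l| * r := by positivity
  have h := hasSum_pi_prod n fun i => (hasSum_hermiteFun_mul_hermiteFun hτ
    (√|l| * ξ i) (√|l| * ξ' i)).mul_left (√|l|)
  convert! h using 1
  · ext α
    rw [Finset.prod_mul_distrib, Finset.prod_mul_distrib, Finset.prod_mul_distrib,
      Finset.prod_const, Finset.card_univ, Fintype.card_fin, ← Real.exp_sum, scaledHermite,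
      scaledHermite, hermiteWeight]
    have e1 : √|l| ^ n = |l| ^ ((n : ℝ) / 4) * |l| ^ ((n : ℝ) / 4) := by
      rw [← Real.rpow_add hl', Real.sqrt_eq_rpow, ← Real.rpow_natCast, ← Real.rpow_mul hl'.le]
      congr 1; ring
    have e2 : ∑ i, -(2 * (α i : ℝ) + 1) * (|l| * r) = -((2 * ∑ i, (α i : ℝ)) + n) * |l| * r := by
      rw [← Finset.sum_mul, Finset.sum_neg_distrib, Finset.sum_add_distrib, ← Finset.mul_sum]
      simp; ring
    rw [e1, e2]; ring
  · have hsh : 0 < Real.sinh (2 * (|l| * r)) := Real.sinh_pos_iff.2 (by positivity)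
    rw [← mehlerKernel_abs, mehlerKernel, Finset.prod_mul_distrib, Finset.prod_mul_distrib,
      Finset.prod_const, Finset.prod_const, Finset.card_univ, Fintype.card_fin, ← Real.exp_sum,
      ← mul_assoc (√|l| ^ n), ← mul_pow, ← div_eq_mul_inv, ← Real.sqrt_div hl'.le]
    congr 2
    rw [← Finset.mul_sum, Finset.sum_add_distrib, ← Finset.mul_sum, ← Finset.mul_sum,
      EuclideanSpace.real_norm_sq_eq, EuclideanSpace.real_norm_sq_eq]
    have e3 : ∀ c d : ℝ, (√|l| * c + √|l| * d) ^ 2 = |l| * (c + d) ^ 2 := fun c d => by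
      rw [← mul_add, mul_pow, Real.sq_sqrt hl'.le]
    have e4 : ∀ c d : ℝ, (√|l| * c - √|l| * d) ^ 2 = |l| * (c - d) ^ 2 := fun c d => by
      rw [← mul_sub, mul_pow, Real.sq_sqrt hl'.le]
    simp_rw [e3, e4, ← Finset.mul_sum, PiLp.add_apply, PiLp.sub_apply]
    ring

lemma mul_tanh_pos {r l : ℝ} (hr : 0 < r) (hl : l ≠ 0) :
    0 < l * (Real.sinh (l * r) / Real.cosh (l * r)) := by
  have hc := Real.cosh_pos (l * r)
  rw [← mul_div_assoc]
  refine div_pos ?_ hc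
  rcases lt_or_gt_of_ne hl with h | h
  · exact mul_pos_of_neg_of_neg h (Real.sinh_neg_iff.2 (mul_neg_of_neg_of_pos h hr))
  · exact mul_pos h (Real.sinh_pos_iff.2 (by positivity))

lemma integrable_mehlerKernel_diag {r l : ℝ} (hr : 0 < r) (hl : l ≠ 0) :
    Integrable fun ξ : RSpace n => mehlerKernel r l ξ ξ := by
  have h := (integrable_gaussian (n := n) (mul_tanh_pos hr hl)).const_mul
    (√(l / (2 * Real.pi * Real.sinh (2 * (l * r)))) ^ n)
  refine h.congr (ae_of_all _ fun ξ => ?_)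
  simp only [mehlerKernel, sub_self, norm_zero]
  rw [← two_smul ℝ ξ, norm_smul]
  congr 2
  simp
  ring

/-- The Hermite semigroup acts by integration against the Mehler kernel. -/
lemma hermiteSemigroup_eq_integral {r l : ℝ} (hr : 0 < r) (hl : l ≠ 0) {φ : RSpace n → ℂ}
    (hφ : MemLp φ 2) (ξ : RSpace n) :
    hermiteSemigroup r l φ ξ = ∫ ξ', φ ξ' * (mehlerKernel r l ξ ξ' : ℂ) := by
  have hφ2 : Integrable fun ξ' => ‖φ ξ'‖ ^ 2 := hφ.integrable_norm_pow (by norm_num)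
  -- The series is dominated through `2 |φ(ξ') Φ(ξ) Φ(ξ')| ≤ |φ(ξ')|² Φ(ξ)² + Φ(ξ')²`, and the
  -- right-hand sides sum to values of the Mehler kernel on the diagonal.
  have hb : ∀ ξ', HasSum (fun α : Fin n → ℕ => 1 / 2 * (‖φ ξ'‖ ^ 2 * (hermiteWeight r l α *
      (scaledHermite l α ξ * scaledHermite l α ξ)) + hermiteWeight r l α *
      (scaledHermite l α ξ' * scaledHermite l α ξ')))
      (1 / 2 * (‖φ ξ'‖ ^ 2 * mehlerKernel r l ξ ξ + mehlerKernel r l ξ' ξ')) := fun ξ' =>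
    (((hasSum_scaledHermite_mul hr hl ξ ξ).mul_left _).add
      (hasSum_scaledHermite_mul hr hl ξ' ξ')).mul_left _
  have h := hasSum_integral_of_dominated_convergence (μ := (volume : Measure (RSpace n)))
    (F := fun (α : Fin n → ℕ) ξ' => φ ξ' * ((hermiteWeight r l α *
      (scaledHermite l α ξ * scaledHermite l α ξ') : ℝ) : ℂ))
    (f := fun ξ' => φ ξ' * (mehlerKernel r l ξ ξ' : ℂ))
    (fun α ξ' => 1 / 2 * (‖φ ξ'‖ ^ 2 * (hermiteWeight r l α *
      (scaledHermite l α ξ * scaledHermite l α ξ)) + hermiteWeight r l α *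
      (scaledHermite l α ξ' * scaledHermite l α ξ')))
    (fun α => hφ.aestronglyMeasurable.mul (Continuous.aestronglyMeasurable (by
      have := continuous_scaledHermite (n := n) l α
      fun_prop)))
    (fun α => ae_of_all _ fun ξ' => ?_) (ae_of_all _ fun ξ' => (hb ξ').summable)
    (by
      simp_rw [fun ξ' => (hb ξ').tsum_eq]
      exact ((hφ2.mul_const _).add (integrable_mehlerKernel_diag hr hl)).const_mul _)
    (ae_of_all _ fun ξ' => (Complex.hasSum_ofReal.2
      (hasSum_scaledHermite_mul hr hl ξ ξ')).mul_left _)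
  · rw [hermiteSemigroup, ← h.tsum_eq]
    refine tsum_congr fun α => ?_
    rw [mul_right_comm, ← integral_const_mul]
    refine integral_congr_ae (ae_of_all _ fun ξ' => ?_)
    simp only [hermiteWeight]
    push_cast
    ring
  · have hw : 0 ≤ hermiteWeight r l α := Real.exp_nonneg _
    rw [norm_mul, Complex.norm_real, Real.norm_eq_abs, abs_mul, abs_mul, abs_of_nonneg hw]
    have h1 := two_mul_le_add_sq (‖φ ξ'‖ * |scaledHermite l α ξ|) |scaledHermite l α ξ'|
    rw [mul_pow, sq_abs, sq_abs] at h1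
    nlinarith

/-! ### Plancherel's theorem for the partial Fourier transform -/

section Plancherel

open FourierTransform SchwartzMap

/-- The Fourier integral of a function in `L¹ ∩ L²` is its Fourier transform in `L²`. -/
lemma fourier_ae_eq_fourier_toLp {g : ℝ → ℂ} (h1 : Integrable g) (h2 : MemLp g 2) :
    𝓕 g =ᵐ[volume] (𝓕 (h2.toLp g) : Lp ℂ 2 (volume : Measure ℝ)) := by
  have hc : Continuous (𝓕 g) :=
    VectorFourier.fourierIntegral_continuous Real.continuous_fourierChar
      (by exact continuous_inner) h1
  refine ae_eq_of_integral_contDiff_smul_eq hc.locallyIntegrable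
    ((Lp.memLp _).locallyIntegrable (by norm_num)) fun φ hφ hs => ?_
  have hs' : HasCompactSupport fun x => (φ x : ℂ) := hs.comp_left (g := fun x : ℝ => (x : ℂ)) rfl
  have hφ' : ContDiff ℝ (⊤ : ℕ∞) fun x => (φ x : ℂ) := Complex.ofRealCLM.contDiff.comp hφ
  set ψ : 𝓢(ℝ, ℂ) := hs'.toSchwartzMap hφ' with hψ
  have hψa : ∀ x, ψ x = φ x := fun x => rfl
  have e1 := DFunLike.congr_fun (Lp.fourier_toTemperedDistribution_eq (h2.toLp g)) ψ
  rw [TemperedDistribution.fourier_apply, Lp.toTemperedDistribution_apply,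
    Lp.toTemperedDistribution_apply] at e1
  have e2 := VectorFourier.integral_fourierIntegral_smul_eq_flip (L := innerₗ ℝ)
    Real.continuous_fourierChar (by exact continuous_inner) (ψ.integrable (μ := volume)) h1
  rw [flip_innerₗ] at e2
  have e3 : ∫ x, (𝓕 ψ) x • (h2.toLp g) x = ∫ x, (𝓕 ψ) x • g x := by
    refine integral_congr_ae ?_
    filter_upwards [h2.coeFn_toLp] with x hx
    rw [hx]
  rw [e3] at e1
  have e4 : ∀ (F : ℝ → ℂ) (x : ℝ), φ x • F x = ψ x • F x := fun F x => by
    rw [hψa, Complex.real_smul, smul_eq_mul]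
  simp_rw [e4]
  rw [← e1]
  exact e2.symm

lemma eLpNorm_two_sq {α E : Type*} [MeasurableSpace α] [NormedAddCommGroup E] (μ : Measure α)
    (f : α → E) : eLpNorm f 2 μ ^ 2 = ∫⁻ x, ‖f x‖ₑ ^ 2 ∂μ := by
  have := eLpNorm_nnreal_pow_eq_lintegral (μ := μ) (f := f) (p := 2) (by norm_num)
  simpa using this

lemma lintegral_fourier_sq {g : ℝ → ℂ} (h1 : Integrable g) (h2 : MemLp g 2) :
    ∫⁻ x, ‖𝓕 g x‖ₑ ^ 2 = ∫⁻ x, ‖g x‖ₑ ^ 2 := by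
  rw [← eLpNorm_two_sq, ← eLpNorm_two_sq, eLpNorm_congr_ae (fourier_ae_eq_fourier_toLp h1 h2)]
  have h := Lp.norm_fourier_eq (h2.toLp g)
  rw [Lp.norm_def, Lp.norm_toLp, ENNReal.toReal_eq_toReal_iff' (Lp.eLpNorm_ne_top _) h2.2.ne] at h
  rw [h]

/-- Plancherel's theorem, in the normalization `∫ g(η) e^{iλη} dη`. -/
lemma lintegral_exp_integral_sq {g : ℝ → ℂ} (h1 : Integrable g) (h2 : MemLp g 2) :
    ∫⁻ l : ℝ, ‖∫ η : ℝ, g η * Complex.exp (Complex.I * l * η)‖ₑ ^ 2 =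
      ENNReal.ofReal (2 * Real.pi) * ∫⁻ η, ‖g η‖ₑ ^ 2 := by
  have hb : -(2 * Real.pi)⁻¹ ≠ 0 := by
    have := Real.pi_pos
    simp [this.ne']
  have e : ∀ l : ℝ, ∫ η : ℝ, g η * Complex.exp (Complex.I * l * η) =
      𝓕 g (-(2 * Real.pi)⁻¹ * l) := by
    intro l
    rw [Real.fourier_real_eq_integral_exp_smul]
    refine integral_congr_ae (ae_of_all _ fun η => ?_)
    simp only [smul_eq_mul]
    rw [mul_comm]
    congr 2
    have hpi : (Real.pi : ℂ) ≠ 0 := by exact_mod_cast Real.pi_ne_zero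
    push_cast
    field_simp
  have hc : Continuous (𝓕 g) :=
    VectorFourier.fourierIntegral_continuous Real.continuous_fourierChar
      (by exact continuous_inner) h1
  simp_rw [e]
  rw [← lintegral_fourier_sq h1 h2,
    ← lintegral_map (f := fun x => ‖𝓕 g x‖ₑ ^ 2) (g := fun l : ℝ => -(2 * Real.pi)⁻¹ * l)
      (by fun_prop) (by fun_prop), map_mul_volume hb, lintegral_smul_measure, smul_eq_mul,
    inv_neg, inv_inv, abs_neg, abs_of_pos (by positivity)]

/-- The partial Fourier integral `∫ g(ξ, η) e^{iλη} dη`. -/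
def partialIntegral (g : RSpace n × ℝ → ℂ) (p : RSpace n × ℝ) : ℂ :=
  ∫ η : ℝ, g (p.1, η) * Complex.exp (Complex.I * p.2 * η)

lemma aestronglyMeasurable_partialIntegral {g : RSpace n × ℝ → ℂ}
    (hg : AEStronglyMeasurable g) : AEStronglyMeasurable (partialIntegral g) := by
  have hq : Measure.QuasiMeasurePreserving
      (fun q : (RSpace n × ℝ) × ℝ => (q.1.1, q.2)) volume volume :=
    MeasureTheory.QuasiMeasurePreserving.prodMap Measure.quasiMeasurePreserving_fst
      (Measure.QuasiMeasurePreserving.id _)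
  have h1 : AEStronglyMeasurable (fun q : (RSpace n × ℝ) × ℝ =>
      g (q.1.1, q.2) * Complex.exp (Complex.I * q.1.2 * q.2)) (volume.prod volume) :=
    (hg.comp_quasiMeasurePreserving hq).mul (Continuous.aestronglyMeasurable (by fun_prop))
  exact h1.integral_prod_right'

lemma memLp_slice {E : Type*} [NormedAddCommGroup E] {g : RSpace n × ℝ → E} (hg : MemLp g 2) :
    ∀ᵐ ξ, MemLp (fun η => g (ξ, η)) 2 := by
  have h1 : Integrable (fun p => ‖g p‖ ^ 2) (volume.prod volume) :=
    hg.integrable_norm_pow (by norm_num)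
  have h2 : AEStronglyMeasurable g (volume.prod volume) := hg.1
  filter_upwards [h1.prod_right_ae, h2.prodMk_left] with ξ a b
  exact (memLp_two_iff_integrable_sq_norm b).2 a

lemma lintegral_partialIntegral_sq {g : RSpace n × ℝ → ℂ} (hg : MemLp g 2)
    (hi : ∀ᵐ ξ, Integrable fun η => g (ξ, η)) :
    ∫⁻ p, ‖partialIntegral g p‖ₑ ^ 2 = ENNReal.ofReal (2 * Real.pi) * ∫⁻ p, ‖g p‖ₑ ^ 2 := by
  have h1 := (aestronglyMeasurable_partialIntegral hg.1).enorm.pow_const 2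
  have h2 := hg.1.enorm.pow_const 2
  rw [Measure.volume_eq_prod] at h1 h2 ⊢
  rw [lintegral_prod _ h1, lintegral_prod _ h2, ← lintegral_const_mul' _ _ ENNReal.ofReal_ne_top]
  refine lintegral_congr_ae ?_
  filter_upwards [hi, memLp_slice hg] with ξ a b
  exact lintegral_exp_integral_sq a b

/-- The restriction of a function on `ℝⁿ × ℝ` to `|η| < N`, extended by zero. -/
def slab (N : ℕ) (f : RSpace n × ℝ → ℂ) : RSpace n × ℝ → ℂ :=
  Set.indicator {p | p.2 ∈ Set.Ioo (-(N : ℝ)) N} f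

lemma measurableSet_slab (N : ℕ) :
    MeasurableSet {p : RSpace n × ℝ | p.2 ∈ Set.Ioo (-(N : ℝ)) N} :=
  measurable_snd measurableSet_Ioo

lemma memLp_slab {f : RSpace n × ℝ → ℂ} (hf : MemLp f 2) (N : ℕ) : MemLp (slab N f) 2 :=
  hf.indicator (measurableSet_slab N)

lemma slab_of_mem {N : ℕ} {p : RSpace n × ℝ} (f : RSpace n × ℝ → ℂ)
    (hp : p.2 ∈ Set.Ioo (-(N : ℝ)) N) : slab N f p = f p :=
  Set.indicator_of_mem (s := {p : RSpace n × ℝ | p.2 ∈ Set.Ioo (-(N : ℝ)) N}) hp f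

lemma slab_of_notMem {N : ℕ} {p : RSpace n × ℝ} (f : RSpace n × ℝ → ℂ)
    (hp : p.2 ∉ Set.Ioo (-(N : ℝ)) N) : slab N f p = 0 :=
  Set.indicator_of_notMem (s := {p : RSpace n × ℝ | p.2 ∈ Set.Ioo (-(N : ℝ)) N}) hp f

lemma slab_apply (N : ℕ) (f : RSpace n × ℝ → ℂ) (ξ : RSpace n) :
    (fun η => slab N f (ξ, η)) = Set.indicator (Set.Ioo (-(N : ℝ)) N) fun η => f (ξ, η) := rfl

lemma integrable_slice_slab {f : RSpace n × ℝ → ℂ} (hf : MemLp f 2) (N : ℕ) :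
    ∀ᵐ ξ, Integrable fun η => slab N f (ξ, η) := by
  filter_upwards [memLp_slice hf] with ξ h
  rw [slab_apply, integrable_indicator_iff measurableSet_Ioo]
  exact (h.restrict _).integrable (by norm_num)

lemma partialIntegral_slab (N : ℕ) (f : RSpace n × ℝ → ℂ) (p : RSpace n × ℝ) :
    partialIntegral (slab N f) p =
      ∫ η in Set.Ioo (-(N : ℝ)) N, f (p.1, η) * Complex.exp (Complex.I * p.2 * η) := by
  rw [partialIntegral, ← integral_indicator measurableSet_Ioo]
  refine integral_congr_ae (ae_of_all _ fun η => ?_)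
  by_cases h : η ∈ Set.Ioo (-(N : ℝ)) N
  · simp only [Set.indicator_of_mem h]
    congr 1
    exact slab_of_mem (p := (p.1, η)) f h
  · simp only [Set.indicator_of_notMem h]
    rw [slab_of_notMem (p := (p.1, η)) f h, zero_mul]

lemma tendsto_eLpNorm_slab_sub {f : RSpace n × ℝ → ℂ} (hf : MemLp f 2) :
    Tendsto (fun N => eLpNorm (slab N f - f) 2 volume) atTop (𝓝 0) := by
  have h : Tendsto (fun N => ∫⁻ p, ‖(slab N f - f) p‖ₑ ^ 2) atTop (𝓝 (∫⁻ _ : RSpace n × ℝ, 0)) := by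
    refine tendsto_lintegral_of_dominated_convergence' (fun p => ‖f p‖ₑ ^ 2)
      (fun N => (((memLp_slab hf N).sub hf).1.enorm.pow_const 2)) (fun N => ae_of_all _ fun p => ?_)
      ?_ (ae_of_all _ fun p => ?_)
    · dsimp only
      rw [Pi.sub_apply]
      by_cases hp : p.2 ∈ Set.Ioo (-(N : ℝ)) N
      · rw [slab_of_mem f hp]; simp
      · rw [slab_of_notMem f hp]; simp
    · rw [← eLpNorm_two_sq]
      exact ENNReal.pow_ne_top hf.2.ne
    · refine tendsto_const_nhds.congr' ?_
      obtain ⟨N, hN⟩ := exists_nat_gt |p.2|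
      filter_upwards [eventually_ge_atTop N] with M hM
      have : |p.2| < M := hN.trans_le (by exact_mod_cast hM)
      rw [Pi.sub_apply, slab_of_mem f (abs_lt.1 this)]
      simp
  simp_rw [← eLpNorm_two_sq, lintegral_zero] at h
  have h2 := h.ennrpow_const (1 / 2)
  simp_rw [← ENNReal.rpow_natCast, ← ENNReal.rpow_mul] at h2
  simpa using h2

lemma eLpNorm_partialIntegral {g : RSpace n × ℝ → ℂ} (hg : MemLp g 2)
    (hi : ∀ᵐ ξ, Integrable fun η => g (ξ, η)) :
    eLpNorm (partialIntegral g) 2 volume =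
      ENNReal.ofReal (2 * Real.pi) ^ (1 / 2 : ℝ) * eLpNorm g 2 volume := by
  have h := lintegral_partialIntegral_sq hg hi
  rw [← eLpNorm_two_sq, ← eLpNorm_two_sq] at h
  have h2 := congrArg (fun x => x ^ (1 / 2 : ℝ)) h
  rw [ENNReal.mul_rpow_of_nonneg _ _ (by norm_num), ← ENNReal.rpow_natCast, ← ENNReal.rpow_natCast,
    ← ENNReal.rpow_mul, ← ENNReal.rpow_mul] at h2
  simpa using h2

/-- Every `f ∈ L²(ℝⁿ × ℝ)` has a partial Fourier transform. -/
lemma exists_isPartialFourier {f : RSpace n × ℝ → ℂ} (hf : MemLp f 2) :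
    ∃ F, IsPartialFourier f F := by
  set c : ENNReal := ENNReal.ofReal (2 * Real.pi) ^ (1 / 2 : ℝ) with hc
  have hcT : c ≠ ⊤ := ENNReal.rpow_ne_top_of_nonneg (by norm_num) ENNReal.ofReal_ne_top
  have hV : ∀ N, MemLp (partialIntegral (slab N f)) 2 := fun N => by
    refine ⟨aestronglyMeasurable_partialIntegral (memLp_slab hf N).1, ?_⟩
    rw [eLpNorm_partialIntegral (memLp_slab hf N) (integrable_slice_slab hf N)]
    exact ENNReal.mul_lt_top hcT.lt_top (memLp_slab hf N).2
  have hsub : ∀ N M, eLpNorm (partialIntegral (slab N f) - partialIntegral (slab M f)) 2 volume ≤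
      c * (eLpNorm (slab N f - f) 2 volume + eLpNorm (slab M f - f) 2 volume) := by
    intro N M
    have e : partialIntegral (slab N f) - partialIntegral (slab M f) =ᵐ[volume]
        partialIntegral (slab N f - slab M f) := by
      have h0 : ∀ᵐ p : RSpace n × ℝ, (Integrable fun η => slab N f (p.1, η)) ∧
          Integrable fun η => slab M f (p.1, η) :=
        Measure.quasiMeasurePreserving_fst.ae
          ((integrable_slice_slab hf N).and (integrable_slice_slab hf M))
      filter_upwards [h0] with p hp
      have hb : ∀ g : ℝ → ℂ, Integrable g →
          Integrable fun η : ℝ => g η * Complex.exp (Complex.I * p.2 * η) := fun g hg => by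
        refine hg.mul_bdd (c := 1) (Continuous.aestronglyMeasurable (by fun_prop))
          (ae_of_all _ fun η => ?_)
        rw [show Complex.I * (p.2 : ℂ) * (η : ℂ) = ((p.2 * η : ℝ) : ℂ) * Complex.I by
          push_cast; ring, Complex.norm_exp_ofReal_mul_I]
      rw [Pi.sub_apply, partialIntegral, partialIntegral, partialIntegral,
        ← integral_sub (hb _ hp.1) (hb _ hp.2)]
      refine integral_congr_ae (ae_of_all _ fun η => ?_)
      simp only [Pi.sub_apply]
      ring
    have hi : ∀ᵐ ξ, Integrable fun η => (slab N f - slab M f) (ξ, η) := by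
      filter_upwards [integrable_slice_slab hf N, integrable_slice_slab hf M] with ξ a b
      exact a.sub b
    rw [eLpNorm_congr_ae e, eLpNorm_partialIntegral ((memLp_slab hf N).sub (memLp_slab hf M)) hi]
    gcongr
    rw [show slab N f - slab M f = (slab N f - f) - (slab M f - f) by abel]
    exact eLpNorm_sub_le ((memLp_slab hf N).sub hf).1 ((memLp_slab hf M).sub hf).1 (by norm_num)
  have hcau : CauchySeq fun N => (hV N).toLp := by
    rw [EMetric.cauchySeq_iff]
    intro ε hε
    have ht : Tendsto (fun N => c * (eLpNorm (slab N f - f) 2 volume)) atTop (𝓝 (c * 0)) :=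
      ENNReal.Tendsto.const_mul (tendsto_eLpNorm_slab_sub hf) (Or.inr hcT)
    rw [mul_zero] at ht
    obtain ⟨N₀, hN₀⟩ := eventually_atTop.1 (ht.eventually (gt_mem_nhds (ENNReal.half_pos hε.ne')))
    refine ⟨N₀, fun N hN M hM => ?_⟩
    rw [Lp.edist_toLp_toLp]
    refine (hsub N M).trans_lt ?_
    rw [mul_add]
    exact (ENNReal.add_lt_add (hN₀ N hN) (hN₀ M hM)).trans_eq (ENNReal.add_halves ε)
  obtain ⟨F, hF⟩ := cauchySeq_tendsto_of_complete hcau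
  refine ⟨F, Lp.memLp F, ?_⟩
  rw [Lp.tendsto_Lp_iff_tendsto_eLpNorm'] at hF
  refine hF.congr fun N => eLpNorm_congr_ae ?_
  filter_upwards [(hV N).coeFn_toLp] with p hp
  rw [Pi.sub_apply, hp, partialIntegral_slab]

end Plancherel

/-! ### Parseval's formula -/

/-- The interchange of the last two variables of `(ℝⁿ × ℝ) × ℝ` preserves Lebesgue measure. -/
lemma measurePreserving_swap_right :
    MeasurePreserving (fun q : (RSpace n × ℝ) × ℝ => ((q.1.1, q.2), q.1.2)) :=
  ((volume_preserving_prodAssoc (α₁ := RSpace n) (β₁ := ℝ) (γ₁ := ℝ)).symm).comp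
    (((MeasurePreserving.id volume).prod Measure.measurePreserving_swap).comp
      volume_preserving_prodAssoc)

lemma memLp_mul_prod {b : RSpace n → ℝ} {e : ℝ → ℝ} (hb : MemLp b 2) (he : MemLp e 2) :
    MemLp (fun p : RSpace n × ℝ => b p.1 * e p.2) 2 := by
  have hm : AEStronglyMeasurable (fun p : RSpace n × ℝ => b p.1 * e p.2) :=
    hb.1.comp_fst.mul he.1.comp_snd
  rw [memLp_two_iff_integrable_sq hm]
  have h := ((memLp_two_iff_integrable_sq hb.1).1 hb).mul_prod
    ((memLp_two_iff_integrable_sq he.1).1 he)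
  refine h.congr (ae_of_all _ fun p => ?_)
  simp only
  ring

/-- Parseval's formula `∫ f k = ∫ F m`, where `F` is the partial Fourier transform of `f` and
`k(ξ, η) = ∫ m(ξ, λ) e^{iλη} dλ`. -/
lemma integral_mul_eq_integral_partialFourier {f F m : RSpace n × ℝ → ℂ} (hf : MemLp f 2)
    (hF : IsPartialFourier f F) (hm : AEStronglyMeasurable m) {b : RSpace n → ℝ} {e : ℝ → ℝ}
    (hb : MemLp b 2) (he : MemLp e 2) (he1 : Integrable e)
    (hbound : ∀ᵐ p, ‖m p‖ ≤ b p.1 * e p.2)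
    (hfk : Integrable fun p => f p * ∫ l : ℝ, m (p.1, l) * Complex.exp (Complex.I * l * p.2)) :
    ∫ p, f p * ∫ l : ℝ, m (p.1, l) * Complex.exp (Complex.I * l * p.2) = ∫ p, F p * m p := by
  have hm2 : MemLp m 2 := by
    refine (memLp_mul_prod hb he).mono hm (hbound.mono fun p hp => hp.trans (le_abs_self _))
  have hV : ∀ N, MemLp (partialIntegral (slab N f)) 2 := fun N => by
    refine ⟨aestronglyMeasurable_partialIntegral (memLp_slab hf N).1, ?_⟩
    rw [eLpNorm_partialIntegral (memLp_slab hf N) (integrable_slice_slab hf N)]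
    exact ENNReal.mul_lt_top (ENNReal.rpow_ne_top_of_nonneg (by norm_num)
      ENNReal.ofReal_ne_top).lt_top (memLp_slab hf N).2
  -- Both sides are limits of the same expressions for `f` cut off to `|η| < N`, where `f` is
  -- integrable in `η` and Fubini's theorem applies.
  have lim1 : Tendsto (fun N => ∫ p, partialIntegral (slab N f) p * m p) atTop
      (𝓝 (∫ p, F p * m p)) := by
    refine tendsto_integral_of_L1' _ (hF.1.1.mul hm)
      (Eventually.of_forall fun N => (hV N).integrable_mul hm2) ?_
    have h2 : Tendsto (fun N : ℕ => eLpNorm (partialIntegral (slab N f) - F) 2 volume *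
        eLpNorm m 2 volume) atTop (𝓝 (0 * eLpNorm m 2 volume)) := by
      refine ENNReal.Tendsto.mul_const ?_ (Or.inr hm2.2.ne)
      refine hF.2.congr fun N => ?_
      congr 1
      funext p
      rw [Pi.sub_apply, partialIntegral_slab]
    rw [zero_mul] at h2
    refine tendsto_of_tendsto_of_tendsto_of_le_of_le tendsto_const_nhds h2 (fun _ => zero_le)
      fun N => ?_
    refine le_trans (le_of_eq ?_) (eLpNorm_smul_le_mul_eLpNorm (p := 2) (q := 2) (r := 1) hm
      ((hV N).1.sub hF.1.1))
    congr 1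
    funext p
    simp only [Pi.sub_apply, Pi.mul_apply, Pi.smul_apply', smul_eq_mul]
    ring
  have lim2 : Tendsto (fun N => ∫ p, slab N f p *
      ∫ l : ℝ, m (p.1, l) * Complex.exp (Complex.I * l * p.2)) atTop
      (𝓝 (∫ p, f p * ∫ l : ℝ, m (p.1, l) * Complex.exp (Complex.I * l * p.2))) := by
    have hs : ∀ N p, slab N f p * (∫ l : ℝ, m (p.1, l) * Complex.exp (Complex.I * l * p.2)) =
        Set.indicator {p : RSpace n × ℝ | p.2 ∈ Set.Ioo (-(N : ℝ)) N} (fun p => f p *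
          ∫ l : ℝ, m (p.1, l) * Complex.exp (Complex.I * l * p.2)) p := by
      intro N p
      by_cases hp : p.2 ∈ Set.Ioo (-(N : ℝ)) N
      · rw [slab_of_mem f hp, Set.indicator_of_mem (by exact hp)]
      · rw [slab_of_notMem f hp, Set.indicator_of_notMem (by exact hp), zero_mul]
    simp_rw [hs]
    refine tendsto_integral_of_dominated_convergence _
      (fun N => (hfk.indicator (measurableSet_slab N)).1) hfk.norm
      (fun N => ae_of_all _ fun p => norm_indicator_le_norm_self _ _) (ae_of_all _ fun p => ?_)
    refine tendsto_const_nhds.congr' ?_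
    obtain ⟨N, hN⟩ := exists_nat_gt |p.2|
    filter_upwards [eventually_ge_atTop N] with M hM
    have : |p.2| < M := hN.trans_le (by exact_mod_cast hM)
    rw [Set.indicator_of_mem (by exact abs_lt.1 this)]
  refine tendsto_nhds_unique lim2 (lim1.congr fun N => ?_)
  set J : (RSpace n × ℝ) × ℝ → ℂ := fun q => slab N f q.1 * (m (q.1.1, q.2) *
    Complex.exp (Complex.I * q.2 * q.1.2)) with hJ
  have hq : Measure.QuasiMeasurePreserving
      (fun q : (RSpace n × ℝ) × ℝ => (q.1.1, q.2)) volume volume :=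
    MeasureTheory.QuasiMeasurePreserving.prodMap Measure.quasiMeasurePreserving_fst
      (Measure.QuasiMeasurePreserving.id _)
  have hJm : AEStronglyMeasurable J (volume.prod volume) :=
    ((memLp_slab hf N).1.comp_fst).mul ((hm.comp_quasiMeasurePreserving hq).mul
      (Continuous.aestronglyMeasurable (by fun_prop)))
  have hu : Integrable fun p : RSpace n × ℝ => ‖slab N f p‖ * b p.1 := by
    have hone : MemLp (Set.indicator (Set.Ioo (-(N : ℝ)) N) fun _ => (1 : ℝ)) 2 :=
      memLp_indicator_const 2 measurableSet_Ioo 1 (Or.inr (by simp))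
    refine ((memLp_slab hf N).norm.integrable_mul (memLp_mul_prod hb hone)).congr
      (ae_of_all _ fun p => ?_)
    simp only [Pi.mul_apply]
    by_cases hp : p.2 ∈ Set.Ioo (-(N : ℝ)) N
    · rw [Set.indicator_of_mem hp, mul_one]
    · rw [slab_of_notMem f hp]
      simp
  have hJi : Integrable J (volume.prod volume) := by
    refine (hu.mul_prod he1).mono' hJm ?_
    filter_upwards [hq.ae hbound] with q hq
    simp only [hJ]
    rw [norm_mul, norm_mul, show Complex.I * (q.2 : ℂ) * (q.1.2 : ℂ) =
      ((q.2 * q.1.2 : ℝ) : ℂ) * Complex.I by push_cast; ring, Complex.norm_exp_ofReal_mul_I,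
      mul_one, mul_assoc]
    gcongr
  have e1 : ∫ p, slab N f p * (∫ l : ℝ, m (p.1, l) * Complex.exp (Complex.I * l * p.2)) =
      ∫ q, J q := by
    rw [Measure.volume_eq_prod (RSpace n × ℝ) ℝ, integral_prod _ hJi]
    refine integral_congr_ae (ae_of_all _ fun p => ?_)
    simp only [hJ]
    rw [integral_const_mul]
  have hJ2 : Integrable (fun q : (RSpace n × ℝ) × ℝ => J ((q.1.1, q.2), q.1.2))
      (volume.prod volume) :=
    (measurePreserving_swap_right.integrable_comp hJm).2 hJi
  have e2 : ∫ q, J q = ∫ q : (RSpace n × ℝ) × ℝ, J ((q.1.1, q.2), q.1.2) := by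
    have h3 := measurePreserving_swap_right (n := n)
    rw [← h3.map_eq, integral_map h3.measurable.aemeasurable (by rw [h3.map_eq]; exact hJm),
      h3.map_eq]
  rw [e1, e2, Measure.volume_eq_prod (RSpace n × ℝ) ℝ, integral_prod _ hJ2]
  refine integral_congr_ae (ae_of_all _ fun p => ?_)
  simp only [hJ, partialIntegral]
  rw [← integral_mul_const]
  refine integral_congr_ae (ae_of_all _ fun η => ?_)
  simp only
  ring

/-! ### The derivatives `Z̃_j p₁` and `Z̃*_j p₁` -/

/-- The amplitude `(λ coth λ + σ λ) (2π)⁻¹ (4π)⁻ⁿ (λ / sinh λ)ⁿ`. -/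
def rieszAmp (n : ℕ) (σ l : ℝ) : ℝ := (heatRate 1 l + σ * l) * heatAmp n 1 l

/-- The function `-½ (i x_j + σ y_j) ∫ rieszAmp σ λ e^{-iλt - (λ coth λ)|z|²/4} dλ`, which equals
`Z̃_j p₁` for `σ = 1` and `Z̃*_j p₁` for `σ = -1`. -/
def rieszDensity (σ : ℝ) (j : Fin n) (h : Heis n) : ℂ :=
  -(1 / 2) * (Complex.I * h.1 j + σ * h.2.1 j) *
    oscInt (heatRate 1) (fun l => (rieszAmp n σ l : ℂ)) h

lemma rapidDecay_rieszAmp (hn : n ≠ 0) (σ : ℝ) : RapidDecay fun l => (rieszAmp n σ l : ℂ) := by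
  have hC := linearGrowth_heatRate one_pos
  obtain ⟨K, hK0, hK⟩ := hC.bound
  have hm := measurable_heatRate 1
  have := (rapidDecay_heatAmp hn one_pos).mul
    (u := fun l => ((heatRate 1 l + σ * l : ℝ) : ℂ)) (K := K + |σ|) (m := 1) (by fun_prop) ?_
  · refine (congrArg RapidDecay (funext fun l => ?_)).mp this
    simp only [rieszAmp]
    push_cast
    rfl
  · intro l
    rw [Complex.norm_real, pow_one]
    refine (norm_add_le _ _).trans ?_
    rw [Real.norm_of_nonneg (hC.nonneg l), norm_mul, Real.norm_eq_abs, Real.norm_eq_abs, add_mul]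
    gcongr
    · exact hK l
    · linarith

lemma oscInt_rieszAmp (hn : n ≠ 0) (σ : ℝ) (h : Heis n) :
    oscInt (heatRate 1) (fun l => (rieszAmp n σ l : ℂ)) h =
      oscInt (heatRate 1) (fun l => (heatRate 1 l : ℂ) * (heatAmp n 1 l : ℂ)) h +
      σ * Complex.I * oscInt (heatRate 1) (fun l => (-Complex.I * l) * (heatAmp n 1 l : ℂ)) h := by
  have hC := linearGrowth_heatRate one_pos
  have hg := rapidDecay_heatAmp hn one_pos
  unfold oscInt
  rw [← integral_const_mul, ← integral_add ((hg.mul_growth hC).integrable_osc hC h)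
    ((hg.mul_freq.integrable_osc hC h).const_mul _)]
  refine integral_congr_ae (ae_of_all _ fun l => ?_)
  simp only [rieszAmp]
  push_cast
  linear_combination (σ * l * heatAmp n 1 l * Complex.exp (oscPhase (heatRate 1) l h)) *
    Complex.I_sq

lemma ofReal_fieldXTilde_heatKernel (hn : n ≠ 0) (j : Fin n) (h : Heis n) :
    ((fieldXTilde j (heatKernel n 1) h : ℝ) : ℂ) = -(h.1 j / 2) *
      oscInt (heatRate 1) (fun l => (heatRate 1 l : ℂ) * (heatAmp n 1 l : ℂ)) h -
      (h.2.1 j / 2) *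
        oscInt (heatRate 1) (fun l => (-Complex.I * l) * (heatAmp n 1 l : ℂ)) h := by
  have hC := linearGrowth_heatRate one_pos
  have hg := rapidDecay_heatAmp hn one_pos
  rw [fieldXTilde, show heatKernel n 1 = _ from funext (heatKernel_eq_re_oscInt hn one_pos),
    dx_re_oscInt hC hg, dt_re_oscInt hC hg, smul_eq_mul]
  push_cast
  rw [ofReal_re_oscInt (heatRate_neg 1) (fun l => by simp [heatRate_neg, heatAmp_neg]),
    ofReal_re_oscInt (heatRate_neg 1) (fun l => by simp [heatAmp_neg])]

lemma ofReal_fieldYTilde_heatKernel (hn : n ≠ 0) (j : Fin n) (h : Heis n) :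
    ((fieldYTilde j (heatKernel n 1) h : ℝ) : ℂ) = -(h.2.1 j / 2) *
      oscInt (heatRate 1) (fun l => (heatRate 1 l : ℂ) * (heatAmp n 1 l : ℂ)) h +
      (h.1 j / 2) *
        oscInt (heatRate 1) (fun l => (-Complex.I * l) * (heatAmp n 1 l : ℂ)) h := by
  have hC := linearGrowth_heatRate one_pos
  have hg := rapidDecay_heatAmp hn one_pos
  rw [fieldYTilde, show heatKernel n 1 = _ from funext (heatKernel_eq_re_oscInt hn one_pos),
    dy_re_oscInt hC hg, dt_re_oscInt hC hg, smul_eq_mul]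
  push_cast
  rw [ofReal_re_oscInt (heatRate_neg 1) (fun l => by simp [heatRate_neg, heatAmp_neg]),
    ofReal_re_oscInt (heatRate_neg 1) (fun l => by simp [heatAmp_neg])]

lemma fieldZTilde_heatKernel (hn : n ≠ 0) (j : Fin n) (h : Heis n) :
    fieldZTilde j (heatKernel n 1) h = rieszDensity 1 j h := by
  rw [fieldZTilde, ofReal_fieldXTilde_heatKernel hn, ofReal_fieldYTilde_heatKernel hn,
    rieszDensity, oscInt_rieszAmp hn]
  push_cast
  linear_combination (1 / 2) * (h.1 j : ℂ) *
    oscInt (heatRate 1) (fun l => (-Complex.I * l) * (heatAmp n 1 l : ℂ)) h * Complex.I_sq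

lemma fieldZTildeStar_heatKernel (hn : n ≠ 0) (j : Fin n) (h : Heis n) :
    fieldZTildeStar j (heatKernel n 1) h = rieszDensity (-1) j h := by
  rw [fieldZTildeStar, ofReal_fieldXTilde_heatKernel hn, ofReal_fieldYTilde_heatKernel hn,
    rieszDensity, oscInt_rieszAmp hn]
  push_cast
  linear_combination (-(1 / 2)) * (h.1 j : ℂ) *
    oscInt (heatRate 1) (fun l => (-Complex.I * l) * (heatAmp n 1 l : ℂ)) h * Complex.I_sq

lemma continuous_rieszDensity (hn : n ≠ 0) (σ : ℝ) (j : Fin n) :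
    Continuous (rieszDensity (n := n) σ j) := by
  have := (contDiff_oscInt (n := n) (linearGrowth_heatRate one_pos) 0
    (rapidDecay_rieszAmp hn σ)).continuous
  unfold rieszDensity
  fun_prop

/-- The weight `e^{-|y|²/16} (1 + t²)⁻¹`. -/
def fiberWeight (p : RSpace n × ℝ) : ℝ := Real.exp (-(1 / 16) * ‖p.1‖ ^ 2) * (1 + p.2 ^ 2)⁻¹

/-- The weight `e^{-|x|²/16} e^{-|y|²/16} (1 + t²)⁻¹`. -/
def rieszWeight (h : Heis n) : ℝ := Real.exp (-(1 / 16) * ‖h.1‖ ^ 2) * fiberWeight h.2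

lemma fiberWeight_pos (p : RSpace n × ℝ) : 0 < fiberWeight p := by
  unfold fiberWeight; positivity

lemma rieszWeight_pos (h : Heis n) : 0 < rieszWeight h := by
  have := fiberWeight_pos h.2
  unfold rieszWeight; positivity

lemma continuous_fiberWeight : Continuous (fiberWeight (n := n)) := by
  unfold fiberWeight
  have : ∀ h : RSpace n × ℝ, 1 + h.2 ^ 2 ≠ 0 := fun h => by positivity
  fun_prop (disch := assumption)

lemma continuous_rieszWeight : Continuous (rieszWeight (n := n)) := by
  unfold rieszWeight
  have := continuous_fiberWeight (n := n)
  fun_prop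

lemma integrable_fiberWeight : Integrable (fiberWeight (n := n)) :=
  (integrable_gaussian (by norm_num)).mul_prod integrable_inv_one_add_sq

lemma fiberWeight_le_one (p : RSpace n × ℝ) : fiberWeight p ≤ 1 := by
  unfold fiberWeight
  refine mul_le_one₀ (Real.exp_le_one_iff.2 ?_) (by positivity) (inv_le_one_of_one_le₀ ?_)
  · nlinarith [sq_nonneg ‖p.1‖]
  · nlinarith [sq_nonneg p.2]

lemma norm_le_exp_norm_sq (x : RSpace n) : ‖x‖ ≤ 4 * Real.exp (1 / 16 * ‖x‖ ^ 2) := by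
  have := Real.add_one_le_exp (1 / 16 * ‖x‖ ^ 2)
  nlinarith [sq_nonneg (‖x‖ - 2)]

lemma norm_coord_combination_le (σ : ℝ) (j : Fin n) (x y : RSpace n) :
    ‖-(1 / 2) * (Complex.I * x j + σ * y j)‖ ≤
      4 * (1 + |σ|) * (Real.exp (1 / 16 * ‖x‖ ^ 2) * Real.exp (1 / 16 * ‖y‖ ^ 2)) := by
  have hx : |x j| ≤ 4 * Real.exp (1 / 16 * ‖x‖ ^ 2) * Real.exp (1 / 16 * ‖y‖ ^ 2) :=
    ((PiLp.norm_apply_le x j).trans (norm_le_exp_norm_sq _)).trans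
      (le_mul_of_one_le_right (by positivity) (Real.one_le_exp (by positivity)))
  have hy : |y j| ≤ 4 * Real.exp (1 / 16 * ‖x‖ ^ 2) * Real.exp (1 / 16 * ‖y‖ ^ 2) := by
    rw [mul_right_comm]
    exact ((PiLp.norm_apply_le y j).trans (norm_le_exp_norm_sq _)).trans
      (le_mul_of_one_le_right (by positivity) (Real.one_le_exp (by positivity)))
  rw [norm_mul]
  have a1 : ‖(-(1 / 2) : ℂ)‖ = 1 / 2 := by simp
  have a2 : ‖Complex.I * x j + σ * y j‖ ≤ |x j| + |σ| * |y j| := by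
    refine (norm_add_le _ _).trans (le_of_eq ?_)
    simp
  rw [a1]
  have a3 : |σ| * |y j| ≤ |σ| * (4 * Real.exp (1 / 16 * ‖x‖ ^ 2) *
    Real.exp (1 / 16 * ‖y‖ ^ 2)) := by gcongr
  have a4 := norm_nonneg (Complex.I * x j + σ * y j)
  linarith

/-- `Z̃_j p₁` and `Z̃*_j p₁` decay like Gaussians in `z` and like `t⁻²`. -/
lemma exists_norm_rieszDensity_le (hn : n ≠ 0) (σ : ℝ) (j : Fin n) :
    ∃ K : ℝ, ∀ h : Heis n, ‖rieszDensity σ j h‖ ≤ K * rieszWeight h := by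
  have hd := differentiableOn_zCoth
  have hA : ∀ z ∈ strip 1, ‖zCoth z + σ * z‖ ≤ (4 + 2 * |σ|) * (1 + |z.re|) := by
    intro z hz
    have hz' : |z.im| ≤ 1 := le_of_lt hz
    have h1 := norm_zCoth_le hz'
    have h2 : ‖z‖ ≤ |z.re| + 1 := (Complex.norm_le_abs_re_add_abs_im z).trans (by linarith)
    refine (norm_add_le _ _).trans ?_
    rw [norm_mul, Complex.norm_real, Real.norm_eq_abs]
    have h3 : |σ| * ‖z‖ ≤ |σ| * (|z.re| + 1) := by gcongr
    nlinarith [abs_nonneg z.re, abs_nonneg σ, mul_nonneg (abs_nonneg σ) (abs_nonneg z.re)]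
  obtain ⟨K, hK⟩ := exists_norm_oscInt_le (p := fun z => zCoth z + σ * z) hn (by fun_prop) hA
    (g := fun l => (rieszAmp n σ l : ℂ)) fun l hl => by
      simp only [rieszAmp]
      rw [← heatRate_one_eq hl]
      push_cast
      rfl
  have hK0 : 0 ≤ K := by
    have := (norm_nonneg _).trans (hK 0)
    exact nonneg_of_mul_nonneg_left this (heatWeight_pos 0)
  refine ⟨4 * (1 + |σ|) * K, fun h => ?_⟩
  rw [rieszDensity, norm_mul]
  calc _ ≤ 4 * (1 + |σ|) * (Real.exp (1 / 16 * ‖h.1‖ ^ 2) * Real.exp (1 / 16 * ‖h.2.1‖ ^ 2)) *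
        (K * heatWeight h) := by
        gcongr
        · exact norm_coord_combination_le σ j h.1 h.2.1
        · exact hK h
    _ = 4 * (1 + |σ|) * K * ((Real.exp (1 / 16 * ‖h.1‖ ^ 2) *
          Real.exp (-(1 / 8) * ‖h.1‖ ^ 2)) * ((Real.exp (1 / 16 * ‖h.2.1‖ ^ 2) *
          Real.exp (-(1 / 8) * ‖h.2.1‖ ^ 2)) * (1 + h.2.2 ^ 2)⁻¹)) := by
        rw [heatWeight]; ring
    _ = _ := by
        rw [← Real.exp_add, ← Real.exp_add, rieszWeight, fiberWeight]
        ring_nf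

/-! ### The change of variables along the curves -/

/-- The map `(x, y, t) ↦ (x, ξ + r y, η - r x·ξ - r² (t + x·y/2))`, whose last two components are
the point at which `f` is evaluated in `T_ε^{(z, t)} f(ξ, η)`. -/
def curveEquiv {r : ℝ} (hr : r ≠ 0) (ξ : RSpace n) (η : ℝ) :
    Heis n ≃ᵐ RSpace n × RSpace n × ℝ where
  toFun h := (h.1, ξ + r • h.2.1,
    η - r * inner ℝ h.1 ξ - r ^ 2 * (h.2.2 + inner ℝ h.1 h.2.1 / 2))
  invFun q := (q.1, r⁻¹ • (q.2.1 - ξ),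
    (r ^ 2)⁻¹ * (η - q.2.2) - r⁻¹ * inner ℝ q.1 (ξ + q.2.1) / 2)
  left_inv h := by
    refine Prod.ext rfl (Prod.ext ?_ ?_)
    · simp [smul_smul, hr]
    · simp only [inner_add_right, inner_smul_right]
      field_simp
      ring
  right_inv q := by
    refine Prod.ext rfl (Prod.ext ?_ ?_)
    · simp [smul_smul, hr]
    · simp only [inner_add_right, inner_smul_right, inner_sub_right]
      field_simp
      ring
  measurable_toFun := Continuous.measurable (by dsimp only [Equiv.coe_fn_mk]; fun_prop)
  measurable_invFun :=
    Continuous.measurable (by dsimp only [Equiv.coe_fn_symm_mk]; fun_prop)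

lemma measurePreserving_shear (r : ℝ) (ξ : RSpace n) (η : ℝ) :
    MeasurePreserving (fun q : RSpace n × RSpace n × ℝ =>
      (q.1, ξ + q.2.1, η - r * inner ℝ q.1 ξ - r * inner ℝ q.1 q.2.1 / 2 - q.2.2)) := by
  refine (MeasurePreserving.id volume).skew_product
    (g := fun (x : RSpace n) (p : RSpace n × ℝ) =>
      (ξ + p.1, η - r * inner ℝ x ξ - r * inner ℝ x p.1 / 2 - p.2))
    (Continuous.measurable (by unfold Function.uncurry; fun_prop)) (ae_of_all _ fun x => ?_)
  refine ((measurePreserving_add_left volume ξ).skew_product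
    (g := fun (u : RSpace n) (τ : ℝ) => η - r * inner ℝ x ξ - r * inner ℝ x u / 2 - τ)
    (Continuous.measurable (by unfold Function.uncurry; fun_prop)) (ae_of_all _ fun u => ?_)).map_eq
  exact (Measure.measurePreserving_sub_left volume _).map_eq

lemma map_curveEquiv {r : ℝ} (hr : r ≠ 0) (ξ : RSpace n) (η : ℝ) :
    Measure.map (curveEquiv hr ξ η) volume = ENNReal.ofReal |(r ^ n * r ^ 2)⁻¹| • volume := by
  have e : ⇑(curveEquiv hr ξ η) = (fun q : RSpace n × RSpace n × ℝ =>
      (q.1, ξ + q.2.1, η - r * inner ℝ q.1 ξ - r * inner ℝ q.1 q.2.1 / 2 - q.2.2)) ∘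
      Prod.map id (Prod.map (fun x : RSpace n => r • x) (fun t : ℝ => r ^ 2 * t)) := by
    funext h
    refine Prod.ext rfl (Prod.ext rfl ?_)
    simp only [curveEquiv, MeasurableEquiv.coe_mk, Equiv.coe_fn_mk, Function.comp_apply, Prod.map,
      id, inner_smul_right]
    ring
  have h := measurePreserving_shear r ξ η
  rw [e, ← Measure.map_map h.measurable (by fun_prop), Measure.volume_eq_prod,
    ← Measure.map_prod_map _ _ measurable_id (by fun_prop), Measure.map_id,
    map_smul_prod_volume hr (pow_ne_zero 2 hr), Measure.prod_smul_right, Measure.map_smul,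
    ← Measure.volume_eq_prod, h.map_eq]

lemma integrable_comp_curveEquiv {r : ℝ} (hr : r ≠ 0) (ξ : RSpace n) (η : ℝ)
    {u : RSpace n × RSpace n × ℝ → ℂ} :
    Integrable (fun h => u (curveEquiv hr ξ η h)) ↔ Integrable u := by
  have h := (curveEquiv hr ξ η).measurableEmbedding.integrable_map_iff (g := u) (μ := volume)
  rw [map_curveEquiv, integrable_smul_measure
    (by rw [Ne, ENNReal.ofReal_eq_zero, not_le]; positivity) ENNReal.ofReal_ne_top] at h
  exact h.symm

lemma integral_comp_curveEquiv {r : ℝ} (hr : r ≠ 0) (ξ : RSpace n) (η : ℝ)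
    (u : RSpace n × RSpace n × ℝ → ℂ) :
    ∫ h, u (curveEquiv hr ξ η h) = |(r ^ n * r ^ 2)⁻¹| • ∫ q, u q := by
  rw [← (curveEquiv hr ξ η).measurableEmbedding.integral_map, map_curveEquiv,
    integral_smul_measure, ENNReal.toReal_ofReal (abs_nonneg _)]

lemma lintegral_comp_curveEquiv {r : ℝ} (hr : r ≠ 0) (ξ : RSpace n) (η : ℝ)
    (u : RSpace n × RSpace n × ℝ → ENNReal) :
    ∫⁻ h, u (curveEquiv hr ξ η h) = ENNReal.ofReal |(r ^ n * r ^ 2)⁻¹| * ∫⁻ q, u q := by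
  rw [← (curveEquiv hr ξ η).measurableEmbedding.lintegral_map, map_curveEquiv,
    lintegral_smul_measure, smul_eq_mul]

lemma quasiMeasurePreserving_curve {r : ℝ} (hr : r ≠ 0) (ξ : RSpace n) (η : ℝ) :
    Measure.QuasiMeasurePreserving (fun h : Heis n => (ξ + r • h.2.1,
      η - r * inner ℝ h.1 ξ - r ^ 2 * (h.2.2 + inner ℝ h.1 h.2.1 / 2))) := by
  have h1 : Measure.QuasiMeasurePreserving (curveEquiv (n := n) hr ξ η) volume volume :=
    ⟨(curveEquiv hr ξ η).measurable, by
      rw [map_curveEquiv]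
      exact Measure.smul_absolutelyContinuous⟩
  exact Measure.quasiMeasurePreserving_snd.comp h1

/-! ### Absolute convergence of the truncated Hilbert transforms -/

lemma measurableSet_truncationSet (ε : ℝ) : MeasurableSet (truncationSet ε) := by
  have : Measurable fun r : ℝ => |r| := continuous_abs.measurable
  exact (measurableSet_lt measurable_const this).inter (measurableSet_lt this measurable_const)

lemma volume_truncationSet_lt_top (ε : ℝ) : volume (truncationSet ε) < ⊤ := by
  refine (measure_mono (t := Set.Icc (-(1 / ε)) (1 / ε)) fun r hr => ?_).trans_lt
    measure_Icc_lt_top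
  exact abs_le.1 hr.2.le

lemma ne_zero_of_mem_truncationSet {ε r : ℝ} (hε : 0 < ε) (hr : r ∈ truncationSet ε) : r ≠ 0 :=
  abs_pos.1 (hε.trans hr.1)

lemma aestronglyMeasurable_hilbertIntegrand {ε : ℝ} (hε : 0 < ε) {f : RSpace n × ℝ → ℂ}
    (hf : AEStronglyMeasurable f) (ξ : RSpace n) (η : ℝ) :
    AEStronglyMeasurable (fun q : Heis n × ℝ => hilbertIntegrand q.1 f ξ η q.2)
      (volume.prod (volume.restrict (truncationSet ε))) := by
  have hq : Measure.QuasiMeasurePreserving (fun q : Heis n × ℝ => (ξ + q.2 • q.1.2.1,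
      η - q.2 * inner ℝ q.1.1 ξ - q.2 ^ 2 * (q.1.2.2 + inner ℝ q.1.1 q.1.2.1 / 2)))
      (volume.prod (volume.restrict (truncationSet ε))) volume := by
    refine QuasiMeasurePreserving.prod_of_left (Continuous.measurable (by fun_prop)) ?_
    filter_upwards [ae_restrict_mem (measurableSet_truncationSet ε)] with r hr
    exact quasiMeasurePreserving_curve (ne_zero_of_mem_truncationSet hε hr) ξ η
  exact (hf.comp_quasiMeasurePreserving hq).mul
    (Measurable.aestronglyMeasurable (f := fun q : Heis n × ℝ => ((q.2 : ℂ))⁻¹) (by fun_prop))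

lemma integrable_rieszWeight : Integrable (rieszWeight (n := n)) :=
  (integrable_gaussian (by norm_num)).mul_prod integrable_fiberWeight

/-- The bound, uniform in `ε < |r| < 1/ε`, that makes the double integral in `(z, t)` and `r`
absolutely convergent. -/
lemma lintegral_hilbertIntegrand_mul_le {ε : ℝ} (hε : 0 < ε) {f : RSpace n × ℝ → ℂ}
    (hf : AEStronglyMeasurable f) (ξ : RSpace n) (η : ℝ) {r : ℝ} (hr : r ∈ truncationSet ε) :
    ∫⁻ h : Heis n, ‖hilbertIntegrand h f ξ η r * (rieszWeight h : ℂ)‖ₑ ≤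
      ENNReal.ofReal ε⁻¹ * (ENNReal.ofReal (ε ^ n * ε ^ 2)⁻¹ *
        ((∫⁻ x : RSpace n, ENNReal.ofReal (Real.exp (-(1 / 16) * ‖x‖ ^ 2))) * ∫⁻ p, ‖f p‖ₑ ^ 2) +
        ∫⁻ h : Heis n, ENNReal.ofReal (rieszWeight h)) := by
  have hr0 := ne_zero_of_mem_truncationSet hε hr
  set u : RSpace n × RSpace n × ℝ → ENNReal := fun q =>
    ENNReal.ofReal (Real.exp (-(1 / 16) * ‖q.1‖ ^ 2)) * ‖f q.2‖ₑ ^ 2 with hu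
  have hpt : ∀ h : Heis n, ‖hilbertIntegrand h f ξ η r * (rieszWeight h : ℂ)‖ₑ ≤
      ENNReal.ofReal ε⁻¹ * (u (curveEquiv hr0 ξ η h) + ENNReal.ofReal (rieszWeight h)) := by
    intro h
    have e : hilbertIntegrand h f ξ η r = f (curveEquiv hr0 ξ η h).2 / r := rfl
    have hw := fiberWeight_pos h.2
    have hw1 := fiberWeight_le_one h.2
    set a := ‖f (curveEquiv hr0 ξ η h).2‖ with ha
    have ha0 : 0 ≤ a := norm_nonneg _
    have hreal : ‖hilbertIntegrand h f ξ η r * (rieszWeight h : ℂ)‖ ≤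
        ε⁻¹ * (Real.exp (-(1 / 16) * ‖h.1‖ ^ 2) * a ^ 2 + rieszWeight h) := by
      rw [e, norm_mul, norm_div, Complex.norm_real, Complex.norm_real,
        Real.norm_of_nonneg (rieszWeight_pos h).le, Real.norm_eq_abs, ← ha, div_eq_inv_mul,
        mul_assoc]
      have h1 : |r|⁻¹ ≤ ε⁻¹ := inv_anti₀ hε hr.1.le
      have h2 : a * rieszWeight h ≤
          Real.exp (-(1 / 16) * ‖h.1‖ ^ 2) * a ^ 2 + rieszWeight h := by
        -- `a w ≤ a² + w` for the fiber weight `0 < w ≤ 1`. The Gaussian in `x` has to stay in front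
        -- of `a²`, because `f` does not depend on `x` after the change of variables.
        rw [rieszWeight, mul_left_comm, ← mul_add]
        refine mul_le_mul_of_nonneg_left ?_ (Real.exp_nonneg _)
        nlinarith [sq_nonneg (a - fiberWeight h.2), mul_nonneg hw.le (sub_nonneg.2 hw1)]
      have h3 : 0 ≤ a * rieszWeight h := mul_nonneg ha0 (rieszWeight_pos h).le
      exact mul_le_mul h1 h2 h3 (by positivity)
    rw [← ofReal_norm]
    refine (ENNReal.ofReal_le_ofReal hreal).trans (le_of_eq ?_)
    rw [ENNReal.ofReal_mul (by positivity), ENNReal.ofReal_add (by positivity)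
      (rieszWeight_pos h).le, ENNReal.ofReal_mul (Real.exp_nonneg _), ENNReal.ofReal_pow ha0, ha,
      ofReal_norm]
    rfl
  have hc : ENNReal.ofReal |(r ^ n * r ^ 2)⁻¹| ≤ ENNReal.ofReal (ε ^ n * ε ^ 2)⁻¹ := by
    refine ENNReal.ofReal_le_ofReal ?_
    rw [abs_inv, abs_mul, abs_pow, abs_pow]
    have := hr.1.le
    gcongr
  have hE : Measurable fun x : RSpace n => ENNReal.ofReal (Real.exp (-(1 / 16) * ‖x‖ ^ 2)) :=
    (Continuous.measurable (by fun_prop)).ennreal_ofReal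
  calc _ ≤ ∫⁻ h : Heis n, ENNReal.ofReal ε⁻¹ * (u (curveEquiv hr0 ξ η h) +
        ENNReal.ofReal (rieszWeight h)) := lintegral_mono hpt
    _ = ENNReal.ofReal ε⁻¹ * (ENNReal.ofReal |(r ^ n * r ^ 2)⁻¹| * (∫⁻ q, u q) +
        ∫⁻ h : Heis n, ENNReal.ofReal (rieszWeight h)) := by
        rw [lintegral_const_mul' _ _ ENNReal.ofReal_ne_top,
          lintegral_add_right _ continuous_rieszWeight.measurable.ennreal_ofReal,
          lintegral_comp_curveEquiv]
    _ ≤ _ := by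
        rw [hu, Measure.volume_eq_prod (RSpace n) (RSpace n × ℝ),
          lintegral_prod_mul hE.aemeasurable (hf.enorm.pow_const 2)]
        gcongr

/-- The integrand of `T_ε^{(z, t)} f(ξ, η)`, multiplied by a weight in `(z, t)`, is integrable in
all variables jointly, although `f` is only square integrable. -/
lemma integrable_hilbertIntegrand_mul_rieszWeight {ε : ℝ} (hε : 0 < ε) {f : RSpace n × ℝ → ℂ}
    (hf : MemLp f 2) (ξ : RSpace n) (η : ℝ) :
    Integrable (fun q : Heis n × ℝ => hilbertIntegrand q.1 f ξ η q.2 * (rieszWeight q.1 : ℂ))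
      (volume.prod (volume.restrict (truncationSet ε))) := by
  have hw := continuous_rieszWeight (n := n)
  have hm : AEStronglyMeasurable (fun q : Heis n × ℝ => hilbertIntegrand q.1 f ξ η q.2 *
      (rieszWeight q.1 : ℂ)) (volume.prod (volume.restrict (truncationSet ε))) :=
    (aestronglyMeasurable_hilbertIntegrand hε hf.1 ξ η).mul
      (Continuous.aestronglyMeasurable (by fun_prop))
  refine ⟨hm, ?_⟩
  rw [HasFiniteIntegral, lintegral_prod_symm _ hm.enorm]
  refine (setLIntegral_mono' (measurableSet_truncationSet ε) fun r hr =>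
    lintegral_hilbertIntegrand_mul_le hε hf.1 ξ η hr).trans_lt ?_
  rw [setLIntegral_const]
  have h1 : ∫⁻ x : RSpace n, ENNReal.ofReal (Real.exp (-(1 / 16) * ‖x‖ ^ 2)) < ⊤ :=
    (integrable_gaussian (by norm_num)).lintegral_lt_top
  have h2 : ∫⁻ p, ‖f p‖ₑ ^ 2 < ⊤ := by
    rw [← eLpNorm_two_sq]
    exact ENNReal.pow_lt_top hf.2
  have h3 : ∫⁻ h : Heis n, ENNReal.ofReal (rieszWeight h) < ⊤ :=
    integrable_rieszWeight.lintegral_lt_top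
  exact ENNReal.mul_lt_top (ENNReal.mul_lt_top ENNReal.ofReal_lt_top (ENNReal.add_lt_top.2
    ⟨ENNReal.mul_lt_top ENNReal.ofReal_lt_top (ENNReal.mul_lt_top h1 h2), h3⟩))
    (volume_truncationSet_lt_top ε)

lemma ae_integrableOn_hilbertIntegrand {ε : ℝ} (hε : 0 < ε) {f : RSpace n × ℝ → ℂ}
    (hf : MemLp f 2) (ξ : RSpace n) (η : ℝ) :
    ∀ᵐ h : Heis n, IntegrableOn (hilbertIntegrand h f ξ η) (truncationSet ε) := by
  filter_upwards [(integrable_hilbertIntegrand_mul_rieszWeight hε hf ξ η).prod_right_ae] with h hh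
  have h0 : (rieszWeight h : ℂ) ≠ 0 := by exact_mod_cast (rieszWeight_pos h).ne'
  refine (hh.mul_const (rieszWeight h : ℂ)⁻¹).congr (ae_of_all _ fun r => ?_)
  simp only
  rw [mul_inv_cancel_right₀ h0]

lemma integrable_hilbertIntegrand_mul {ε : ℝ} (hε : 0 < ε) {f : RSpace n × ℝ → ℂ}
    (hf : MemLp f 2) (ξ : RSpace n) (η : ℝ) {G : Heis n → ℂ} (hG : Continuous G) {K : ℝ}
    (hK : ∀ h, ‖G h‖ ≤ K * rieszWeight h) :
    Integrable (fun q : Heis n × ℝ => hilbertIntegrand q.1 f ξ η q.2 * G q.1)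
      (volume.prod (volume.restrict (truncationSet ε))) := by
  have h := integrable_hilbertIntegrand_mul_rieszWeight hε hf ξ η
  refine (h.norm.const_mul K).mono' ((aestronglyMeasurable_hilbertIntegrand hε hf.1 ξ η).mul
    (Continuous.aestronglyMeasurable (by fun_prop))) (ae_of_all _ fun q => ?_)
  rw [norm_mul, norm_mul, Complex.norm_real, Real.norm_of_nonneg (rieszWeight_pos _).le,
    mul_left_comm]
  exact mul_le_mul_of_nonneg_left (hK _) (norm_nonneg _)

lemma integrable_truncatedHilbert_mul {ε : ℝ} (hε : 0 < ε) {f : RSpace n × ℝ → ℂ}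
    (hf : MemLp f 2) (ξ : RSpace n) (η : ℝ) {G : Heis n → ℂ} (hG : Continuous G) {K : ℝ}
    (hK : ∀ h, ‖G h‖ ≤ K * rieszWeight h) :
    Integrable fun h : Heis n => truncatedHilbert ε h f ξ η * G h := by
  refine (integrable_hilbertIntegrand_mul hε hf ξ η hG hK).integral_prod_left.congr
    (ae_of_all _ fun h => ?_)
  simp only
  rw [integral_mul_const, truncatedHilbert]

lemma integral_truncatedHilbert_mul {ε : ℝ} (hε : 0 < ε) {f : RSpace n × ℝ → ℂ}
    (hf : MemLp f 2) (ξ : RSpace n) (η : ℝ) {G : Heis n → ℂ} (hG : Continuous G) {K : ℝ}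
    (hK : ∀ h, ‖G h‖ ≤ K * rieszWeight h) :
    ∫ h : Heis n, truncatedHilbert ε h f ξ η * G h =
      ∫ r in truncationSet ε, ∫ h : Heis n, hilbertIntegrand h f ξ η r * G h := by
  rw [← integral_integral_swap (integrable_hilbertIntegrand_mul hε hf ξ η hG hK)]
  refine integral_congr_ae (ae_of_all _ fun h => ?_)
  simp only
  rw [integral_mul_const, truncatedHilbert]

/-! ### Partial Gaussian integrals -/

lemma cexp_gaussian_integrable {b : ℝ} (hb : 0 < b) (w : RSpace n) :
    Integrable fun x : RSpace n =>
      Complex.exp (-(b : ℂ) * (‖x‖ : ℂ) ^ 2 + Complex.I * (inner ℝ w x : ℝ)) :=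
  GaussianFourier.integrable_cexp_neg_mul_sq_norm_add (by simpa using hb) _ w

lemma integral_cexp_gaussian {b : ℝ} (hb : 0 < b) (w : RSpace n) :
    ∫ x : RSpace n, Complex.exp (-(b : ℂ) * (‖x‖ : ℂ) ^ 2 + Complex.I * (inner ℝ w x : ℝ)) =
      ((√(Real.pi / b) ^ n * Real.exp (-(‖w‖ ^ 2 / (4 * b))) : ℝ) : ℂ) := by
  rw [GaussianFourier.integral_cexp_neg_mul_sq_norm_add (by simpa using hb)]
  have h0 : 0 ≤ Real.pi / b := by positivity
  have e1 : ((Real.pi : ℂ) / b) ^ ((Module.finrank ℝ (RSpace n) : ℂ) / 2) =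
      ((√(Real.pi / b) ^ n : ℝ) : ℂ) := by
    rw [finrank_euclideanSpace_fin, Real.sqrt_eq_rpow, ← Real.rpow_natCast, ← Real.rpow_mul h0,
      Complex.ofReal_cpow h0]
    push_cast
    congr 1
    ring
  rw [e1, Complex.I_sq]
  push_cast
  congr 2
  ring

lemma norm_cexp_gaussian (b : ℝ) (w x : RSpace n) :
    ‖Complex.exp (-(b : ℂ) * (‖x‖ : ℂ) ^ 2 + Complex.I * (inner ℝ w x : ℝ))‖ =
      Real.exp (-b * ‖x‖ ^ 2) := by
  rw [show -(b : ℂ) * (‖x‖ : ℂ) ^ 2 + Complex.I * (inner ℝ w x : ℝ) =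
    ((-b * ‖x‖ ^ 2 : ℝ) : ℂ) + (inner ℝ w x : ℝ) * Complex.I by push_cast; ring, Complex.exp_add,
    norm_mul, Complex.norm_exp_ofReal_mul_I, mul_one, ← Complex.ofReal_exp, Complex.norm_real,
    Real.norm_of_nonneg (Real.exp_nonneg _)]

lemma integrable_norm_mul_gaussian {b : ℝ} (hb : 0 < b) :
    Integrable fun x : RSpace n => ‖x‖ * Real.exp (-b * ‖x‖ ^ 2) := by
  refine ((integrable_gaussian (n := n) (half_pos hb)).const_mul (1 + 1 / b)).mono'
    (Continuous.aestronglyMeasurable (by fun_prop)) (ae_of_all _ fun x => ?_)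
  rw [Real.norm_of_nonneg (by positivity),
    show -b * ‖x‖ ^ 2 = b / 2 * ‖x‖ ^ 2 * (-1) + -(b / 2) * ‖x‖ ^ 2 by ring, Real.exp_add,
    ← mul_assoc]
  refine mul_le_mul_of_nonneg_right ?_ (Real.exp_nonneg _)
  rw [mul_neg_one, Real.exp_neg, ← div_eq_mul_inv, div_le_iff₀ (Real.exp_pos _)]
  have h1 := Real.add_one_le_exp (b / 2 * ‖x‖ ^ 2)
  have h2 : ‖x‖ ≤ (1 + 1 / b) * (b / 2 * ‖x‖ ^ 2 + 1) := by
    have e : (1 + 1 / b) * (b / 2 * ‖x‖ ^ 2 + 1) =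
        b / 2 * ‖x‖ ^ 2 + 1 + ‖x‖ ^ 2 / 2 + 1 / b := by field_simp; ring
    have : 0 ≤ b / 2 * ‖x‖ ^ 2 := by positivity
    have : 0 < 1 / b := by positivity
    nlinarith [sq_nonneg (‖x‖ - 1)]
  exact h2.trans (by gcongr)

lemma integrable_coord_mul_cexp_gaussian {b : ℝ} (hb : 0 < b) (w : RSpace n) (j : Fin n) :
    Integrable fun x : RSpace n => (x j : ℂ) *
      Complex.exp (-(b : ℂ) * (‖x‖ : ℂ) ^ 2 + Complex.I * (inner ℝ w x : ℝ)) := by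
  refine (integrable_norm_mul_gaussian (n := n) hb).mono'
    (Continuous.aestronglyMeasurable (by fun_prop)) (ae_of_all _ fun x => ?_)
  rw [norm_mul, norm_cexp_gaussian, Complex.norm_real]
  gcongr
  exact PiLp.norm_apply_le x j

/-- The first moment of a modulated Gaussian, by integration by parts. -/
lemma integral_coord_mul_cexp_gaussian {b : ℝ} (hb : 0 < b) (w : RSpace n) (j : Fin n) :
    ∫ x : RSpace n, (x j : ℂ) *
        Complex.exp (-(b : ℂ) * (‖x‖ : ℂ) ^ 2 + Complex.I * (inner ℝ w x : ℝ)) =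
      Complex.I * (w j / (2 * b) : ℝ) *
        ∫ x : RSpace n,
          Complex.exp (-(b : ℂ) * (‖x‖ : ℂ) ^ 2 + Complex.I * (inner ℝ w x : ℝ)) := by
  set E : RSpace n → ℂ := fun x =>
    Complex.exp (-(b : ℂ) * (‖x‖ : ℂ) ^ 2 + Complex.I * (inner ℝ w x : ℝ)) with hE
  have i0 : Integrable E := cexp_gaussian_integrable hb w
  have i1 : Integrable fun x => (x j : ℂ) * E x := integrable_coord_mul_cexp_gaussian hb w j
  have hd : ∀ x, HasLineDerivAt ℝ E (Complex.I * w j * E x - 2 * b * ((x j : ℂ) * E x)) x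
      (EuclideanSpace.single j (1 : ℝ)) := by
    intro x
    have hpoly : ∀ t : ℝ, -(b : ℂ) * (‖x + t • EuclideanSpace.single j (1 : ℝ)‖ : ℂ) ^ 2 +
        Complex.I * (inner ℝ w (x + t • EuclideanSpace.single j (1 : ℝ)) : ℝ) =
        -(b : ℂ) * (‖x‖ : ℂ) ^ 2 + Complex.I * (inner ℝ w x : ℝ) +
          ((Complex.I * w j - 2 * b * x j) * t - b * t ^ 2) := by
      intro t
      rw [← Complex.ofReal_pow, norm_add_sq_real, inner_add_right, inner_smul_right,
        inner_smul_right, norm_smul]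
      simp only [EuclideanSpace.inner_single_right, PiLp.norm_single, norm_one, mul_one,
        one_mul, Real.norm_eq_abs, sq_abs, conj_trivial]
      push_cast
      ring
    have ht : HasDerivAt (fun t : ℝ => (t : ℂ)) 1 0 := Complex.ofRealCLM.hasDerivAt
    have h1 : HasDerivAt (fun t : ℝ => -(b : ℂ) * (‖x‖ : ℂ) ^ 2 + Complex.I * (inner ℝ w x : ℝ) +
        ((Complex.I * w j - 2 * b * x j) * t - b * (t : ℂ) ^ 2))
        (Complex.I * w j - 2 * b * x j) 0 := by
      have := ((ht.const_mul (Complex.I * w j - 2 * b * x j)).sub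
        ((ht.pow 2).const_mul (b : ℂ))).const_add
        (-(b : ℂ) * (‖x‖ : ℂ) ^ 2 + Complex.I * (inner ℝ w x : ℝ))
      convert! this using 1
      simp
    have h2 := h1.cexp
    rw [HasLineDerivAt]
    simp only [hE]
    simp_rw [hpoly]
    convert! h2 using 1
    simp
    ring
  have key := integral_bilinear_hasLineDerivAt_right_eq_neg_left_of_integrable
    (μ := (volume : Measure (RSpace n))) (B := ContinuousLinearMap.mul ℝ ℂ)
    (f := fun _ => (1 : ℂ)) (f' := fun _ => 0) (g := E)
    (g' := fun x => Complex.I * w j * E x - 2 * b * ((x j : ℂ) * E x))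
    (v := EuclideanSpace.single j (1 : ℝ)) (by simp)
    (by simp only [ContinuousLinearMap.mul_apply', one_mul]
        exact (i0.const_mul _).sub (i1.const_mul _))
    (by simpa using i0) (fun x _ => hasDerivAt_const _ _) (fun x _ => hd x)
  simp only [ContinuousLinearMap.mul_apply', one_mul, zero_mul, integral_zero, neg_zero] at key
  rw [integral_sub (i0.const_mul _) (i1.const_mul _), integral_const_mul, integral_const_mul] at key
  have hb' : (b : ℂ) ≠ 0 := by exact_mod_cast hb.ne'
  change ∫ x, (x j : ℂ) * E x = Complex.I * (w j / (2 * b) : ℝ) * ∫ x, E x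
  generalize ∫ x, (x j : ℂ) * E x = A at key ⊢
  generalize ∫ x, E x = B at key ⊢
  push_cast
  field_simp
  linear_combination -key

/-! ### The integral kernel of `A_j(λ) e^{-sH(λ)}` -/

/-- The factor `λ ξ_j + σ (λ/2) (tanh(λs) (ξ + ξ')_j + coth(λs) (ξ - ξ')_j)`. -/
def rieszFactor (σ : ℝ) (j : Fin n) (s l : ℝ) (ξ ξ' : RSpace n) : ℝ :=
  l * ξ j + σ * (l / 2 * (Real.sinh (l * s) / Real.cosh (l * s) * (ξ + ξ') j +
    Real.cosh (l * s) / Real.sinh (l * s) * (ξ - ξ') j))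

/-- The result of applying `-σ ∂/∂ξ_j + λ ξ_j` to the Mehler kernel: the integral kernel of
`A_j(λ) e^{-sH(λ)}` for `σ = 1` and of `A_j(λ)* e^{-sH(λ)}` for `σ = -1`. -/
def rieszKernel (σ : ℝ) (j : Fin n) (s l : ℝ) (ξ ξ' : RSpace n) : ℝ :=
  rieszFactor σ j s l ξ ξ' * mehlerKernel s l ξ ξ'

/-- The Fourier transform of `rieszDensity` in `t`. -/
def rieszFiber (σ : ℝ) (j : Fin n) (l : ℝ) (x y : RSpace n) : ℂ :=
  -(1 / 2) * (Complex.I * x j + σ * y j) * (rieszAmp n σ l : ℂ) *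
    (Real.exp (-(heatRate 1 l * (‖x‖ ^ 2 + ‖y‖ ^ 2) / 4)) : ℝ)

lemma rieszDensity_eq_integral (σ : ℝ) (j : Fin n) (h : Heis n) :
    rieszDensity σ j h =
      ∫ l : ℝ, Complex.exp (-Complex.I * l * h.2.2) * rieszFiber σ j l h.1 h.2.1 := by
  rw [rieszDensity, oscInt, ← integral_const_mul]
  refine integral_congr_ae (ae_of_all _ fun l => ?_)
  simp only [rieszFiber, oscPhase]
  rw [sub_eq_add_neg, Complex.exp_add]
  push_cast
  ring

lemma norm_rieszFiber_le (σ : ℝ) (j : Fin n) {l : ℝ} (hl : l ≠ 0) (x y : RSpace n) :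
    ‖rieszFiber σ j l x y‖ ≤ 4 * (1 + |σ|) * ‖(rieszAmp n σ l : ℂ)‖ *
      (Real.exp (-(1 / 16) * ‖x‖ ^ 2) * Real.exp (-(1 / 16) * ‖y‖ ^ 2)) := by
  have hC := inv_two_mul_le_heatRate one_pos hl
  rw [rieszFiber, norm_mul, norm_mul, Complex.norm_real (Real.exp _),
    Real.norm_of_nonneg (Real.exp_nonneg _)]
  calc _ ≤ 4 * (1 + |σ|) * (Real.exp (1 / 16 * ‖x‖ ^ 2) * Real.exp (1 / 16 * ‖y‖ ^ 2)) *
        ‖(rieszAmp n σ l : ℂ)‖ * Real.exp (-(1 / 8 * (‖x‖ ^ 2 + ‖y‖ ^ 2))) := by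
        gcongr
        · exact norm_coord_combination_le σ j x y
        · have : 0 ≤ ‖x‖ ^ 2 + ‖y‖ ^ 2 := by positivity
          nlinarith
    _ = 4 * (1 + |σ|) * ‖(rieszAmp n σ l : ℂ)‖ * ((Real.exp (1 / 16 * ‖x‖ ^ 2) *
          Real.exp (1 / 16 * ‖y‖ ^ 2)) * Real.exp (-(1 / 8 * (‖x‖ ^ 2 + ‖y‖ ^ 2)))) := by ring
    _ = _ := by
        rw [← Real.exp_add, ← Real.exp_add, ← Real.exp_add]
        ring_nf

lemma div_sinh_pos {μ : ℝ} (hμ : μ ≠ 0) : 0 < μ / Real.sinh μ := by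
  rcases lt_or_gt_of_ne hμ with h | h
  · exact div_pos_of_neg_of_neg h (Real.sinh_neg_iff.2 h)
  · exact div_pos h (Real.sinh_pos_iff.2 h)

/-- The constants of the heat kernel and of the Mehler kernel agree, by
`sinh 2μ = 2 sinh μ cosh μ`. -/
lemma heatAmp_mul_sqrt {r l : ℝ} (hr : r ≠ 0) (hl : l ≠ 0) :
    heatAmp n 1 (l * r ^ 2) * √(Real.pi / (heatRate 1 (l * r ^ 2) / 4)) ^ n =
      (2 * Real.pi)⁻¹ * |r| ^ n *
        √(l / (2 * Real.pi * Real.sinh (2 * (l * r ^ 2)))) ^ n := by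
  have hμ : l * r ^ 2 ≠ 0 := by positivity
  have hS : Real.sinh (l * r ^ 2) ≠ 0 := by simpa [Real.sinh_eq_zero] using hμ
  have hc := Real.cosh_pos (l * r ^ 2)
  have hq := div_sinh_pos hμ
  have hpi := Real.pi_pos
  have key : (4 * Real.pi)⁻¹ * (l * r ^ 2 / Real.sinh (l * r ^ 2)) *
      √(Real.pi / (heatRate 1 (l * r ^ 2) / 4)) =
      |r| * √(l / (2 * Real.pi * Real.sinh (2 * (l * r ^ 2)))) := by
    rw [← Real.sqrt_sq_eq_abs, ← Real.sqrt_mul (sq_nonneg r),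
      ← Real.sqrt_sq (show 0 ≤ (4 * Real.pi)⁻¹ * (l * r ^ 2 / Real.sinh (l * r ^ 2)) by positivity),
      ← Real.sqrt_mul (sq_nonneg _), heatRate, mul_one, Real.sinh_two_mul]
    congr 1
    field_simp
    ring
  rw [heatAmp, heatConst, mul_one, mul_assoc _ (|r| ^ n), ← mul_pow, ← key, ← inv_pow]
  ring

/-- The Gaussian integral that turns the heat kernel into the Mehler kernel: the partial Fourier
integral in `x` of the Fourier transform of `Z̃_j p₁` is a multiple of the kernel of
`A_j(λ) e^{-r²H(λ)}`. -/
lemma integral_rieszFiber {σ : ℝ} (hσ : σ ^ 2 = 1) (j : Fin n) {r l : ℝ} (hr : r ≠ 0) (hl : l ≠ 0)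
    (ξ ξ' : RSpace n) :
    ∫ x : RSpace n, Complex.exp (Complex.I * ((l * r / 2 * inner ℝ x (ξ + ξ') : ℝ) : ℂ)) *
        rieszFiber σ j (l * r ^ 2) x (r⁻¹ • (ξ' - ξ)) =
      (((2 * Real.pi)⁻¹ * |r| ^ n * r * rieszKernel σ j (r ^ 2) l ξ ξ' : ℝ) : ℂ) := by
  set μ := l * r ^ 2 with hμd
  have hμ : μ ≠ 0 := by positivity
  have hS : Real.sinh μ ≠ 0 := by simpa [Real.sinh_eq_zero] using hμ
  have hc := Real.cosh_pos μ
  set C := heatRate 1 μ with hCd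
  have hC0 : 0 < C := lt_of_lt_of_le (by norm_num) (inv_two_mul_le_heatRate one_pos hμ)
  have hCe : C = μ * (Real.cosh μ / Real.sinh μ) := by rw [hCd, heatRate, mul_one]
  have hb : 0 < C / 4 := by positivity
  set y := r⁻¹ • (ξ' - ξ) with hy
  set w := (l * r / 2) • (ξ + ξ') with hw
  -- In `x` the integrand is `x_j` or a constant times a Gaussian of rate `C / 4`, modulated by `w`.
  set a : ℂ := -(1 / 2) * (rieszAmp n σ μ : ℂ) * (Real.exp (-(C * ‖y‖ ^ 2 / 4)) : ℝ) with ha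
  have e1 : ∀ x : RSpace n, Complex.exp (Complex.I * ((l * r / 2 * inner ℝ x (ξ + ξ') : ℝ) : ℂ)) *
      rieszFiber σ j μ x y = a * Complex.I * ((x j : ℂ) * Complex.exp (-((C / 4 : ℝ) : ℂ) *
        (‖x‖ : ℂ) ^ 2 + Complex.I * (inner ℝ w x : ℝ))) + a * σ * y j *
        Complex.exp (-((C / 4 : ℝ) : ℂ) * (‖x‖ : ℂ) ^ 2 + Complex.I * (inner ℝ w x : ℝ)) := by
    intro x
    rw [rieszFiber, ← hCd, Complex.exp_add, show -(C * (‖x‖ ^ 2 + ‖y‖ ^ 2) / 4) =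
      -(C / 4) * ‖x‖ ^ 2 + -(C * ‖y‖ ^ 2 / 4) by ring, Real.exp_add, hw, real_inner_smul_left,
      real_inner_comm, ha]
    push_cast
    ring
  simp_rw [e1]
  rw [integral_add ((integrable_coord_mul_cexp_gaussian hb w j).const_mul _)
    ((cexp_gaussian_integrable hb w).const_mul _), integral_const_mul, integral_const_mul,
    integral_coord_mul_cexp_gaussian hb, integral_cexp_gaussian hb, ha]
  have hamp : rieszAmp n σ μ = (C + σ * μ) * heatAmp n 1 μ := rfl
  have hnorm : ∀ u v : ℝ, ∀ z : RSpace n, ‖u • z‖ ^ 2 * v = u ^ 2 * v * ‖z‖ ^ 2 := fun u v z => by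
    rw [norm_smul, mul_pow, Real.norm_eq_abs, sq_abs]; ring
  have hexp : -(C * ‖y‖ ^ 2 / 4) + -(‖w‖ ^ 2 / (4 * (C / 4))) =
      -(l / 4) * (Real.sinh μ / Real.cosh μ * ‖ξ + ξ'‖ ^ 2 +
        Real.cosh μ / Real.sinh μ * ‖ξ - ξ'‖ ^ 2) := by
    rw [norm_sub_rev ξ ξ', mul_comm C, div_eq_mul_inv (‖w‖ ^ 2), hy, hw, hnorm, hnorm, hCe, hμd]
    rw [hμd] at hS hc
    field_simp
    ring
  have hfac : -(1 / 2) * (C + σ * μ) * (σ * y j - w j / (2 * (C / 4))) =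
      r * rieszFactor σ j (r ^ 2) l ξ ξ' := by
    rw [rieszFactor, ← hμd, hy, hw, hCe]
    simp only [PiLp.smul_apply, PiLp.add_apply, PiLp.sub_apply, smul_eq_mul]
    rw [hμd] at hS hc ⊢
    field_simp
    linear_combination (4 * Real.cosh (l * r ^ 2) * Real.sinh (l * r ^ 2) * (ξ j - ξ' j)) * hσ
  have hmain := heatAmp_mul_sqrt (n := n) hr hl
  rw [← hμd, ← hCd] at hmain
  have hreal : -(1 / 2) * (rieszAmp n σ μ) * Real.exp (-(C * ‖y‖ ^ 2 / 4)) *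
      (σ * y j - w j / (2 * (C / 4))) * (√(Real.pi / (C / 4)) ^ n *
        Real.exp (-(‖w‖ ^ 2 / (4 * (C / 4))))) =
      (2 * Real.pi)⁻¹ * |r| ^ n * r * rieszKernel σ j (r ^ 2) l ξ ξ' := by
    rw [rieszKernel, mehlerKernel, ← hμd, ← hexp, Real.exp_add, hamp]
    linear_combination (heatAmp n 1 μ * √(Real.pi / (C / 4)) ^ n * Real.exp (-(C * ‖y‖ ^ 2 / 4)) *
      Real.exp (-(‖w‖ ^ 2 / (4 * (C / 4))))) * hfac + (r * rieszFactor σ j (r ^ 2) l ξ ξ' *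
      Real.exp (-(C * ‖y‖ ^ 2 / 4)) * Real.exp (-(‖w‖ ^ 2 / (4 * (C / 4))))) * hmain
  rw [← hreal]
  push_cast
  linear_combination (-(1 / 2) * (rieszAmp n σ μ) * Complex.exp (-(C * ‖y‖ ^ 2 / 4)) *
    (w j / (2 * (C / 4))) * (√(Real.pi / (C / 4)) ^ n *
        Complex.exp (-(‖w‖ ^ 2 / (4 * (C / 4)))))) * Complex.I_sq

/-- The kernel of `A_j(λ) e^{-r²H(λ)}` inherits its decay from the Fourier transform of
`Z̃_j p₁`. -/
lemma abs_rieszKernel_le {σ : ℝ} (hσ : σ ^ 2 = 1) (j : Fin n) {r l : ℝ} (hr : r ≠ 0) (hl : l ≠ 0)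
    (ξ ξ' : RSpace n) :
    (2 * Real.pi)⁻¹ * |r| ^ n * |r| * |rieszKernel σ j (r ^ 2) l ξ ξ'| ≤
      4 * (1 + |σ|) * ‖(rieszAmp n σ (l * r ^ 2) : ℂ)‖ *
        Real.exp (-(1 / 16) * ‖r⁻¹ • (ξ' - ξ)‖ ^ 2) *
        ∫ x : RSpace n, Real.exp (-(1 / 16) * ‖x‖ ^ 2) := by
  have hμ : l * r ^ 2 ≠ 0 := by positivity
  have h := norm_integral_le_of_norm_le (μ := (volume : Measure (RSpace n)))
    (f := fun x : RSpace n => Complex.exp (Complex.I * ((l * r / 2 * inner ℝ x (ξ + ξ') : ℝ) : ℂ)) *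
        rieszFiber σ j (l * r ^ 2) x (r⁻¹ • (ξ' - ξ)))
    ((integrable_gaussian (n := n) (b := 1 / 16) (by norm_num)).const_mul
      (4 * (1 + |σ|) * ‖(rieszAmp n σ (l * r ^ 2) : ℂ)‖ *
        Real.exp (-(1 / 16) * ‖r⁻¹ • (ξ' - ξ)‖ ^ 2))) (ae_of_all _ fun x => ?_)
  · rw [integral_rieszFiber hσ j hr hl, integral_const_mul, Complex.norm_real, Real.norm_eq_abs,
      abs_mul, abs_mul, abs_mul, abs_of_pos (by positivity : 0 < (2 * Real.pi)⁻¹),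
      abs_of_nonneg (by positivity : 0 ≤ |r| ^ n)] at h
    exact h
  · rw [norm_mul, mul_comm Complex.I, Complex.norm_exp_ofReal_mul_I, one_mul]
    refine (norm_rieszFiber_le σ j hμ x _).trans (le_of_eq ?_)
    ring

/-- A bound for the kernel of `A_j(λ) e^{-sH(λ)}` that is uniform for `ε² < s < ε⁻²`. -/
lemma exists_abs_rieszKernel_le (hn : n ≠ 0) {ε : ℝ} (hε : 0 < ε) {σ : ℝ} (hσ : σ ^ 2 = 1)
    (j : Fin n) :
    ∃ K : ℝ, 0 ≤ K ∧ ∀ s ∈ Set.Ioo (ε ^ 2) (1 / ε ^ 2), ∀ l : ℝ, l ≠ 0 → ∀ ξ ξ' : RSpace n,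
      |rieszKernel σ j s l ξ ξ'| ≤
        K * (Real.exp (-(ε ^ 2 / 16) * ‖ξ' - ξ‖ ^ 2) * (1 + l ^ 2)⁻¹) := by
  obtain ⟨K, hK0, hK⟩ := (rapidDecay_rieszAmp (n := n) hn σ).bound_two 0
  set Γ := ∫ x : RSpace n, Real.exp (-(1 / 16) * ‖x‖ ^ 2) with hΓ
  have hΓ0 : 0 ≤ Γ := integral_nonneg fun x => Real.exp_nonneg _
  refine ⟨((2 * Real.pi)⁻¹ * ε ^ n * ε)⁻¹ * (4 * (1 + |σ|) * (K * (1 + (ε ^ 4)⁻¹)) * Γ),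
    by positivity, fun s hs l hl ξ ξ' => ?_⟩
  have hs0 : 0 < s := (by positivity : 0 < ε ^ 2).trans hs.1
  have hr0 : √s ≠ 0 := (Real.sqrt_pos.2 hs0).ne'
  have hεr : ε ≤ √s := Real.le_sqrt_of_sq_le hs.1.le
  have h := abs_rieszKernel_le hσ j hr0 hl ξ ξ'
  rw [Real.sq_sqrt hs0.le, abs_of_nonneg (Real.sqrt_nonneg s)] at h
  have h1 : (2 * Real.pi)⁻¹ * ε ^ n * ε * |rieszKernel σ j s l ξ ξ'| ≤
      (2 * Real.pi)⁻¹ * √s ^ n * √s * |rieszKernel σ j s l ξ ξ'| := by gcongr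
  have h2 : ‖(rieszAmp n σ (l * s) : ℂ)‖ ≤ K * (1 + (ε ^ 4)⁻¹) * (1 + l ^ 2)⁻¹ := by
    have a := hK (l * s)
    rw [pow_zero, one_mul] at a
    refine a.trans ?_
    rw [mul_assoc]
    refine mul_le_mul_of_nonneg_left ?_ hK0
    rw [← div_eq_mul_inv, le_div_iff₀ (by positivity), inv_mul_le_iff₀ (by positivity)]
    have b1 : ε ^ 4 ≤ s ^ 2 := by
      have := pow_le_pow_left₀ (by positivity) hs.1.le 2
      calc ε ^ 4 = (ε ^ 2) ^ 2 := by ring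
        _ ≤ _ := this
    have b2 : l ^ 2 ≤ (ε ^ 4)⁻¹ * (l * s) ^ 2 := by
      rw [← div_eq_inv_mul, le_div_iff₀ (by positivity), mul_pow]
      gcongr
    have b3 : 0 ≤ (ε ^ 4)⁻¹ := by positivity
    nlinarith [sq_nonneg (l * s)]
  have h3 : Real.exp (-(1 / 16) * ‖(√s)⁻¹ • (ξ' - ξ)‖ ^ 2) ≤
      Real.exp (-(ε ^ 2 / 16) * ‖ξ' - ξ‖ ^ 2) := by
    rw [Real.exp_le_exp, norm_smul, mul_pow, norm_inv, Real.norm_of_nonneg (Real.sqrt_nonneg s),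
      inv_pow, Real.sq_sqrt hs0.le]
    have b1 : ε ^ 2 ≤ s⁻¹ := by
      rw [le_inv_comm₀ (by positivity) hs0, ← one_div]
      exact hs.2.le
    nlinarith [mul_le_mul_of_nonneg_right b1 (sq_nonneg ‖ξ' - ξ‖)]
  rw [mul_assoc _⁻¹, ← div_eq_inv_mul, le_div_iff₀ (by positivity), mul_comm]
  refine (h1.trans h).trans ?_
  calc _ ≤ 4 * (1 + |σ|) * (K * (1 + (ε ^ 4)⁻¹) * (1 + l ^ 2)⁻¹) *
        Real.exp (-(ε ^ 2 / 16) * ‖ξ' - ξ‖ ^ 2) * Γ := by gcongr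
    _ = _ := by ring

lemma measurable_rieszKernel (σ : ℝ) (j : Fin n) :
    Measurable fun q : ℝ × ℝ × RSpace n × RSpace n =>
      rieszKernel σ j q.1 q.2.1 q.2.2.1 q.2.2.2 := by
  unfold rieszKernel rieszFactor mehlerKernel
  have h1 := Real.measurable_sinh
  have h2 := Real.measurable_cosh
  have h3 := Real.continuous_sqrt.measurable
  have h4 := Real.measurable_exp
  fun_prop

lemma measurable_rieszFiber (σ : ℝ) (j : Fin n) :
    Measurable fun q : ℝ × RSpace n × RSpace n => rieszFiber σ j q.1 q.2.1 q.2.2 := by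
  unfold rieszFiber rieszAmp
  have h1 := measurable_heatRate 1
  have h2 := measurable_heatAmp n 1
  fun_prop

lemma memLp_gaussian {c : ℝ} (hc : 0 < c) (ξ : RSpace n) :
    MemLp (fun ξ' : RSpace n => Real.exp (-c * ‖ξ' - ξ‖ ^ 2)) 2 := by
  rw [memLp_two_iff_integrable_sq (Continuous.aestronglyMeasurable (by fun_prop))]
  refine ((integrable_gaussian (n := n) (b := 2 * c) (by positivity)).comp_sub_right ξ).congr
    (ae_of_all _ fun ξ' => ?_)
  simp only
  rw [← Real.exp_nat_mul]
  congr 1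
  push_cast
  ring

lemma memLp_inv_one_add_sq : MemLp (fun l : ℝ => (1 + l ^ 2)⁻¹) 2 := by
  have hc : Continuous fun l : ℝ => (1 + l ^ 2)⁻¹ := by
    have : ∀ l : ℝ, 1 + l ^ 2 ≠ 0 := fun l => by positivity
    fun_prop (disch := assumption)
  rw [memLp_two_iff_integrable_sq hc.aestronglyMeasurable]
  refine integrable_inv_one_add_sq.mono' (hc.pow 2).aestronglyMeasurable (ae_of_all _ fun l => ?_)
  rw [Real.norm_of_nonneg (by positivity), sq]
  exact mul_le_of_le_one_left (by positivity) (inv_le_one_of_one_le₀ (by nlinarith [sq_nonneg l]))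

/-- The partial Fourier transform, along the curves, of the integral of `Z̃_j p₁` over `x`. -/
lemma integral_rieszDensity_curve (hn : n ≠ 0) {σ : ℝ} (hσ : σ ^ 2 = 1) (j : Fin n) {r : ℝ}
    (hr : r ≠ 0) (ξ : RSpace n) (η : ℝ) (p : RSpace n × ℝ) :
    ((|(r ^ n * r ^ 2)⁻¹| * r⁻¹ : ℝ) : ℂ) *
        ∫ x : RSpace n, rieszDensity σ j ((curveEquiv hr ξ η).symm (x, p)) =
      ∫ l : ℝ, ((2 * Real.pi : ℝ) : ℂ)⁻¹ * (Complex.exp (-Complex.I * l * η) *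
        rieszKernel σ j (r ^ 2) l ξ p.1) * Complex.exp (Complex.I * l * p.2) := by
  have hr2 : r ^ 2 ≠ 0 := pow_ne_zero 2 hr
  set y := r⁻¹ • (p.1 - ξ) with hy
  set τ : RSpace n → ℝ := fun x =>
    (r ^ 2)⁻¹ * (η - p.2) - r⁻¹ * inner ℝ x (ξ + p.1) / 2 with hτ
  set J : RSpace n × ℝ → ℂ := fun q =>
    Complex.exp (-Complex.I * ((q.2 * r ^ 2 : ℝ) : ℂ) * τ q.1) *
      rieszFiber σ j (q.2 * r ^ 2) q.1 y with hJ
  have e1 : ∀ x : RSpace n, rieszDensity σ j ((curveEquiv hr ξ η).symm (x, p)) =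
      (r ^ 2 : ℝ) * ∫ l : ℝ, J (x, l) := by
    intro x
    have h := Measure.integral_comp_mul_right (fun l : ℝ =>
      Complex.exp (-Complex.I * l * τ x) * rieszFiber σ j l x y) (r ^ 2)
    simp only [hJ]
    rw [h, rieszDensity_eq_integral, Complex.real_smul, ← mul_assoc, ← Complex.ofReal_mul,
      abs_of_pos (by positivity), mul_inv_cancel₀ hr2, Complex.ofReal_one, one_mul]
    rfl
  have hJm : Measurable J := by
    have h1 := measurable_rieszFiber (n := n) σ j
    have h2 : Measurable fun q : RSpace n × ℝ => rieszFiber σ j (q.2 * r ^ 2) q.1 y :=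
      h1.comp (g := fun q : ℝ × RSpace n × RSpace n => rieszFiber σ j q.1 q.2.1 q.2.2)
        (f := fun q : RSpace n × ℝ => (q.2 * r ^ 2, q.1, y)) (by fun_prop)
    refine Measurable.mul (Continuous.measurable ?_) h2
    simp only [hτ]
    fun_prop
  have hJi : Integrable J (volume.prod volume) := by
    have hA : Integrable fun l : ℝ => ‖(rieszAmp n σ (l * r ^ 2) : ℂ)‖ :=
      ((rapidDecay_rieszAmp hn σ).integrable.comp_mul_right' hr2).norm
    refine (((integrable_gaussian (n := n) (b := 1 / 16) (by norm_num)).mul_prod hA).const_mul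
      (4 * (1 + |σ|) * Real.exp (-(1 / 16) * ‖y‖ ^ 2))).mono' hJm.aestronglyMeasurable ?_
    filter_upwards [Measure.quasiMeasurePreserving_snd.ae ae_ne_zero] with q hq
    simp only [hJ]
    rw [norm_mul, show -Complex.I * ((q.2 * r ^ 2 : ℝ) : ℂ) * (τ q.1 : ℂ) =
      ((-(q.2 * r ^ 2 * τ q.1) : ℝ) : ℂ) * Complex.I by push_cast; ring,
      Complex.norm_exp_ofReal_mul_I, one_mul]
    refine (norm_rieszFiber_le σ j (by positivity) q.1 y).trans (le_of_eq ?_)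
    ring
  simp_rw [e1]
  rw [integral_const_mul, integral_integral_swap hJi, ← integral_const_mul, ← integral_const_mul]
  refine integral_congr_ae ?_
  filter_upwards [ae_ne_zero] with l hl
  have e2 : ∀ x : RSpace n, J (x, l) = Complex.exp (-Complex.I * l * (η - p.2)) *
      (Complex.exp (Complex.I * ((l * r / 2 * inner ℝ x (ξ + p.1) : ℝ) : ℂ)) *
        rieszFiber σ j (l * r ^ 2) x y) := by
    intro x
    simp only [hJ]
    rw [← mul_assoc, ← Complex.exp_add]
    congr 2
    have hrc : (r : ℂ) ≠ 0 := by exact_mod_cast hr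
    simp only [hτ]
    push_cast
    field_simp
    ring
  simp_rw [e2]
  rw [integral_const_mul, integral_rieszFiber hσ j hr hl,
    show -Complex.I * (l : ℂ) * (η - p.2) = -Complex.I * l * η + Complex.I * l * p.2 by ring,
    Complex.exp_add]
  have hc : |(r ^ n * r ^ 2)⁻¹| * r⁻¹ * (r ^ 2 * ((2 * Real.pi)⁻¹ * |r| ^ n * r *
      rieszKernel σ j (r ^ 2) l ξ p.1)) = (2 * Real.pi)⁻¹ * rieszKernel σ j (r ^ 2) l ξ p.1 := by
    have h3 : |r| ≠ 0 := abs_ne_zero.2 hr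
    rw [abs_inv, abs_mul, abs_pow, abs_of_pos (by positivity : 0 < r ^ 2)]
    field_simp
  have hc' := congrArg (fun x : ℝ => (x : ℂ)) hc
  push_cast at hc' ⊢
  linear_combination (Complex.exp (-Complex.I * l * η) * Complex.exp (Complex.I * l * p.2)) * hc'

lemma sq_mem_Ioo_of_mem_truncationSet {ε r : ℝ} (hε : 0 < ε) (hr : r ∈ truncationSet ε) :
    r ^ 2 ∈ Set.Ioo (ε ^ 2) (1 / ε ^ 2) := by
  rw [← sq_abs r, ← one_div_pow]
  exact ⟨pow_lt_pow_left₀ hr.1 hε.le two_ne_zero, pow_lt_pow_left₀ hr.2 (abs_nonneg r) two_ne_zero⟩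

/-- For fixed `r`, the integral over the Heisenberg group becomes, by Parseval's formula, an
integral of the partial Fourier transform of `f` against the kernel of `A_j(λ) e^{-r²H(λ)}`. -/
lemma integral_hilbertIntegrand_mul (hn : n ≠ 0) {ε : ℝ} (hε : 0 < ε) {σ : ℝ} (hσ : σ ^ 2 = 1)
    (j : Fin n) {f F : RSpace n × ℝ → ℂ} (hf : MemLp f 2) (hF : IsPartialFourier f F)
    (ξ : RSpace n) (η : ℝ) {r : ℝ} (hr : r ∈ truncationSet ε)
    (hint : Integrable fun h : Heis n => hilbertIntegrand h f ξ η r * rieszDensity σ j h) :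
    ∫ h : Heis n, hilbertIntegrand h f ξ η r * rieszDensity σ j h =
      ((2 * Real.pi : ℝ) : ℂ)⁻¹ * ∫ p : RSpace n × ℝ, F p *
        (Complex.exp (-Complex.I * p.2 * η) * rieszKernel σ j (r ^ 2) p.2 ξ p.1) := by
  have hr0 := ne_zero_of_mem_truncationSet hε hr
  obtain ⟨K, hK0, hK⟩ := exists_abs_rieszKernel_le hn hε hσ j
  set u : RSpace n × RSpace n × ℝ → ℂ := fun q =>
    f q.2 / r * rieszDensity σ j ((curveEquiv hr0 ξ η).symm q) with hu
  have e0 : (fun h : Heis n => hilbertIntegrand h f ξ η r * rieszDensity σ j h) =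
      fun h => u (curveEquiv hr0 ξ η h) := by
    funext h
    simp only [hu, MeasurableEquiv.symm_apply_apply]
    rfl
  have hui : Integrable u (volume.prod volume) := by
    rw [e0] at hint
    exact (integrable_comp_curveEquiv hr0 ξ η).1 hint
  set m : RSpace n × ℝ → ℂ := fun p => ((2 * Real.pi : ℝ) : ℂ)⁻¹ *
    (Complex.exp (-Complex.I * p.2 * η) * rieszKernel σ j (r ^ 2) p.2 ξ p.1) with hm
  have e1 : ∀ p : RSpace n × ℝ, ((|(r ^ n * r ^ 2)⁻¹| : ℝ) : ℂ) * ∫ x : RSpace n, u (x, p) =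
      f p * ∫ l : ℝ, m (p.1, l) * Complex.exp (Complex.I * l * p.2) := by
    intro p
    simp only [hm]
    rw [← integral_rieszDensity_curve hn hσ j hr0 ξ η p]
    simp only [hu]
    rw [integral_const_mul]
    push_cast
    ring
  have hmm : Measurable m := by
    have h1 : Measurable fun p : RSpace n × ℝ => rieszKernel σ j (r ^ 2) p.2 ξ p.1 :=
      (measurable_rieszKernel (n := n) σ j).comp
        (f := fun p : RSpace n × ℝ => (r ^ 2, p.2, ξ, p.1)) (by fun_prop)
    simp only [hm]
    fun_prop
  have hfk : Integrable fun p : RSpace n × ℝ =>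
      f p * ∫ l : ℝ, m (p.1, l) * Complex.exp (Complex.I * l * p.2) := by
    simp_rw [← e1]
    exact hui.integral_prod_right.const_mul _
  have hpar := integral_mul_eq_integral_partialFourier hf hF hmm.aestronglyMeasurable
    (memLp_gaussian (c := ε ^ 2 / 16) (by positivity) ξ)
    (memLp_inv_one_add_sq.const_mul ((2 * Real.pi)⁻¹ * K))
    (integrable_inv_one_add_sq.const_mul ((2 * Real.pi)⁻¹ * K)) ?_ hfk
  · rw [e0, integral_comp_curveEquiv, Measure.volume_eq_prod (RSpace n) (RSpace n × ℝ),
      integral_prod_symm u hui, Complex.real_smul, ← integral_const_mul]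
    simp_rw [e1]
    rw [hpar, ← integral_const_mul]
    refine integral_congr_ae (ae_of_all _ fun p => ?_)
    simp only [hm]
    ring
  · filter_upwards [Measure.quasiMeasurePreserving_snd.ae ae_ne_zero] with p hp
    simp only [hm]
    rw [norm_mul, norm_mul, show -Complex.I * (p.2 : ℂ) * (η : ℂ) =
      ((-(p.2 * η) : ℝ) : ℂ) * Complex.I by push_cast; ring, Complex.norm_exp_ofReal_mul_I,
      one_mul, norm_inv, Complex.norm_real, Complex.norm_real,
      Real.norm_of_nonneg Real.two_pi_pos.le, Real.norm_eq_abs]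
    calc _ ≤ (2 * Real.pi)⁻¹ * (K * (Real.exp (-(ε ^ 2 / 16) * ‖p.1 - ξ‖ ^ 2) *
          (1 + p.2 ^ 2)⁻¹)) := by
          gcongr
          exact hK _ (sq_mem_Ioo_of_mem_truncationSet hε hr) _ hp ξ p.1
      _ = _ := by ring

/-! ### Differentiation of the truncated inverse square root -/

lemma abs_mehlerKernel_le {ε : ℝ} (hε : 0 < ε) {s l : ℝ}
    (hs : s ∈ Set.Ioo (ε ^ 2) (1 / ε ^ 2)) (hl : l ≠ 0) (ξ ξ' : RSpace n) :
    |mehlerKernel s l ξ ξ'| ≤ ε⁻¹ ^ n * Real.exp (-(ε ^ 2 / 8) * ‖ξ' - ξ‖ ^ 2) := by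
  have hε2 : 0 < ε ^ 2 := by positivity
  have hs0 : 0 < s := hε2.trans hs.1
  have hμ : 2 * (l * s) ≠ 0 := by positivity
  have h1 : √(l / (2 * Real.pi * Real.sinh (2 * (l * s)))) ≤ ε⁻¹ := by
    refine Real.sqrt_le_iff.2 ⟨by positivity, ?_⟩
    have a1 := norm_zDivSinh_le (z := ((2 * (l * s) : ℝ) : ℂ)) (by simp)
    rw [zDivSinh_ofReal hμ, Complex.norm_real] at a1
    have a2 := (le_abs_self _).trans a1
    have a3 : l / (2 * Real.pi * Real.sinh (2 * (l * s))) =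
        2 * (l * s) / Real.sinh (2 * (l * s)) * (4 * Real.pi * s)⁻¹ := by
      have hS : Real.sinh (2 * (l * s)) ≠ 0 := by simpa [Real.sinh_eq_zero] using hμ
      field_simp
      ring
    rw [a3, inv_pow]
    calc _ ≤ 2 * (4 * Real.pi * s)⁻¹ := by gcongr
      _ = (2 * Real.pi * s)⁻¹ := by field_simp; ring
      _ ≤ _ := by
        refine inv_anti₀ hε2 (hs.1.le.trans ?_)
        nlinarith [Real.pi_gt_three]
  have h2 : ε ^ 2 / 2 ≤ l * (Real.cosh (l * s) / Real.sinh (l * s)) := by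
    refine le_trans ?_ (inv_two_mul_le_heatRate hs0 hl)
    have : ε ^ 2 ≤ s⁻¹ := by
      rw [le_inv_comm₀ hε2 hs0, ← one_div]
      exact hs.2.le
    linarith
  have h3 := mul_tanh_pos hs0 hl
  rw [mehlerKernel, abs_of_nonneg (by positivity)]
  refine mul_le_mul (pow_le_pow_left₀ (Real.sqrt_nonneg _) h1 n) (Real.exp_le_exp.2 ?_)
    (Real.exp_nonneg _) (by positivity)
  rw [norm_sub_rev ξ ξ']
  nlinarith [mul_nonneg h3.le (sq_nonneg ‖ξ + ξ'‖),
    mul_le_mul_of_nonneg_right h2 (sq_nonneg ‖ξ' - ξ‖)]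

lemma hasDerivAt_norm_sq_add_smul (v : RSpace n) (j : Fin n) (t : ℝ) :
    HasDerivAt (fun t : ℝ => ‖v + t • EuclideanSpace.single j (1 : ℝ)‖ ^ 2)
      (2 * (v + t • EuclideanSpace.single j (1 : ℝ)) j) t := by
  have h := (((hasDerivAt_id t).smul_const (EuclideanSpace.single j (1 : ℝ))).const_add v).norm_sq
  simpa [EuclideanSpace.inner_single_right] using h

/-- `∂_j = (A_j(λ)* - A_j(λ)) / 2` on the Mehler kernel. -/
lemma hasDerivAt_mehlerKernel (s l : ℝ) (j : Fin n) (ξ ξ' : RSpace n) (t : ℝ) :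
    HasDerivAt (fun t : ℝ => mehlerKernel s l (ξ + t • EuclideanSpace.single j (1 : ℝ)) ξ')
      ((rieszKernel (-1) j s l (ξ + t • EuclideanSpace.single j (1 : ℝ)) ξ' -
        rieszKernel 1 j s l (ξ + t • EuclideanSpace.single j (1 : ℝ)) ξ') / 2) t := by
  have h1 := hasDerivAt_norm_sq_add_smul (ξ + ξ') j t
  have h2 := hasDerivAt_norm_sq_add_smul (ξ - ξ') j t
  simp_rw [add_right_comm ξ ξ', sub_add_eq_add_sub ξ ξ'] at h1 h2
  have h := ((((h1.const_mul (Real.sinh (l * s) / Real.cosh (l * s))).add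
    (h2.const_mul (Real.cosh (l * s) / Real.sinh (l * s)))).const_mul (-(l / 4))).exp).const_mul
    (√(l / (2 * Real.pi * Real.sinh (2 * (l * s)))) ^ n)
  convert! h using 1
  simp only [rieszKernel, rieszFactor, mehlerKernel, Pi.add_apply]
  ring

lemma gaussian_shift_le {c : ℝ} (hc : 0 ≤ c) (ξ ξ' v : RSpace n) (hv : ‖v‖ ≤ 1) :
    Real.exp (-c * ‖ξ' - (ξ + v)‖ ^ 2) ≤ Real.exp c * Real.exp (-(c / 2) * ‖ξ' - ξ‖ ^ 2) := by
  rw [← Real.exp_add, Real.exp_le_exp]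
  have h : ‖ξ' - ξ‖ ≤ ‖ξ' - (ξ + v)‖ + ‖v‖ := by
    refine le_trans (le_of_eq ?_) (norm_add_le _ _)
    congr 1
    abel
  have h2 : ‖ξ' - ξ‖ ^ 2 ≤ 2 * ‖ξ' - (ξ + v)‖ ^ 2 + 2 := by
    nlinarith [norm_nonneg (ξ' - ξ), norm_nonneg (ξ' - (ξ + v)), norm_nonneg v,
      sq_nonneg (‖ξ' - (ξ + v)‖ - ‖v‖)]
  nlinarith

/-- The measure `ds dξ'` on `(ε², ε⁻²) × ℝⁿ`. -/
abbrev timeSpaceMeasure (n : ℕ) (ε : ℝ) : Measure (ℝ × RSpace n) :=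
  (volume.restrict (Set.Ioo (ε ^ 2) (1 / ε ^ 2))).prod volume

lemma ae_timeSpaceMeasure (n : ℕ) (ε : ℝ) :
    ∀ᵐ q ∂(timeSpaceMeasure n ε), q.1 ∈ Set.Ioo (ε ^ 2) (1 / ε ^ 2) :=
  Measure.quasiMeasurePreserving_fst.ae (ae_restrict_mem measurableSet_Ioo)

lemma rpow_neg_half_le {ε s : ℝ} (hε : 0 < ε) (hs : ε ^ 2 < s) : s ^ (-(1 / 2) : ℝ) ≤ ε⁻¹ := by
  have hs0 : 0 < s := (by positivity : 0 < ε ^ 2).trans hs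
  rw [Real.rpow_neg hs0.le, ← Real.sqrt_eq_rpow]
  exact inv_anti₀ hε (Real.le_sqrt_of_sq_le hs.le)

/-- A kernel with Gaussian decay, integrated against an `L²` function. -/
lemma integrable_mul_kernel {ε : ℝ} (hε : 0 < ε) {φ : RSpace n → ℂ} (hφ : MemLp φ 2)
    {k : ℝ × RSpace n → ℝ} (hk : Measurable k) {c K : ℝ} (hc : 0 < c) {ξ : RSpace n}
    (hK : ∀ s ∈ Set.Ioo (ε ^ 2) (1 / ε ^ 2), ∀ ξ',
      |k (s, ξ')| ≤ K * Real.exp (-c * ‖ξ' - ξ‖ ^ 2)) :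
    Integrable (fun q : ℝ × RSpace n =>
      φ q.2 * ((k q * q.1 ^ (-(1 / 2) : ℝ) : ℝ) : ℂ)) (timeSpaceMeasure n ε) := by
  have h1 : Integrable fun ξ' : RSpace n => ‖φ ξ'‖ * Real.exp (-c * ‖ξ' - ξ‖ ^ 2) :=
    hφ.norm.integrable_mul (memLp_gaussian hc ξ)
  have h2 : Integrable (fun _ : ℝ => ε⁻¹ * K)
      (volume.restrict (Set.Ioo (ε ^ 2) (1 / ε ^ 2))) := integrable_const _
  refine (h2.mul_prod h1).mono' (hφ.1.comp_snd.mul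
    (Measurable.aestronglyMeasurable (by fun_prop))) ?_
  filter_upwards [ae_timeSpaceMeasure n ε] with q hq
  have hq0 : 0 < q.1 := (by positivity : 0 < ε ^ 2).trans hq.1
  have h3 := rpow_neg_half_le hε hq.1
  have h4 := Real.rpow_nonneg hq0.le (-(1 / 2))
  rw [norm_mul, Complex.norm_real, norm_mul, Real.norm_eq_abs, Real.norm_of_nonneg h4]
  calc _ ≤ ‖φ q.2‖ * (K * Real.exp (-c * ‖q.2 - ξ‖ ^ 2) * ε⁻¹) := by
        gcongr
        · exact (abs_nonneg _).trans (hK _ hq q.2)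
        · exact hK _ hq q.2
    _ = _ := by ring

lemma measurable_mehlerKernel (n : ℕ) :
    Measurable fun q : ℝ × ℝ × RSpace n × RSpace n =>
      mehlerKernel q.1 q.2.1 q.2.2.1 q.2.2.2 := by
  unfold mehlerKernel
  have h1 := Real.measurable_sinh
  have h2 := Real.measurable_cosh
  have h3 := Real.continuous_sqrt.measurable
  have h4 := Real.measurable_exp
  fun_prop

lemma integrable_mul_mehlerKernel {ε : ℝ} (hε : 0 < ε) {l : ℝ} (hl : l ≠ 0) {φ : RSpace n → ℂ}
    (hφ : MemLp φ 2) (ξ : RSpace n) :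
    Integrable (fun q : ℝ × RSpace n =>
      φ q.2 * ((mehlerKernel q.1 l ξ q.2 * q.1 ^ (-(1 / 2) : ℝ) : ℝ) : ℂ)) (timeSpaceMeasure n ε) :=
  integrable_mul_kernel hε hφ (k := fun q => mehlerKernel q.1 l ξ q.2)
    ((measurable_mehlerKernel n).comp (f := fun q : ℝ × RSpace n => (q.1, l, ξ, q.2))
      (by fun_prop)) (c := ε ^ 2 / 8) (by positivity)
    (fun s hs ξ' => abs_mehlerKernel_le hε hs hl ξ ξ')

lemma truncatedInvSqrt_eq {ε : ℝ} (hε : 0 < ε) {l : ℝ} (hl : l ≠ 0) {φ : RSpace n → ℂ}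
    (hφ : MemLp φ 2) (ξ : RSpace n) :
    truncatedInvSqrt ε l φ ξ = ((√Real.pi)⁻¹ : ℂ) * ∫ q, φ q.2 *
      ((mehlerKernel q.1 l ξ q.2 * q.1 ^ (-(1 / 2) : ℝ) : ℝ) : ℂ) ∂(timeSpaceMeasure n ε) := by
  rw [truncatedInvSqrt, integral_prod _ (integrable_mul_mehlerKernel hε hl hφ ξ)]
  congr 1
  refine setIntegral_congr_fun measurableSet_Ioo fun s hs => ?_
  have hs0 : 0 < s := (by positivity : 0 < ε ^ 2).trans hs.1
  simp only
  rw [hermiteSemigroup_eq_integral hs0 hl hφ, ← integral_mul_const]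
  refine integral_congr_ae (ae_of_all _ fun ξ' => ?_)
  simp only
  push_cast
  ring

lemma measurable_rieszKernel_slice (σ : ℝ) (j : Fin n) (l : ℝ) (ξ : RSpace n) :
    Measurable fun q : ℝ × RSpace n => rieszKernel σ j q.1 l ξ q.2 :=
  (measurable_rieszKernel (n := n) σ j).comp
    (f := fun q : ℝ × RSpace n => (q.1, l, ξ, q.2)) (by fun_prop)

lemma integrable_mul_rieszKernel (hn : n ≠ 0) {ε : ℝ} (hε : 0 < ε) {σ : ℝ} (hσ : σ ^ 2 = 1)
    (j : Fin n) {l : ℝ} (hl : l ≠ 0) {φ : RSpace n → ℂ} (hφ : MemLp φ 2) (ξ : RSpace n) :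
    Integrable (fun q : ℝ × RSpace n =>
      φ q.2 * ((rieszKernel σ j q.1 l ξ q.2 * q.1 ^ (-(1 / 2) : ℝ) : ℝ) : ℂ))
      (timeSpaceMeasure n ε) := by
  obtain ⟨K, hK0, hK⟩ := exists_abs_rieszKernel_le hn hε hσ j
  refine integrable_mul_kernel hε hφ (k := fun q => rieszKernel σ j q.1 l ξ q.2)
    (measurable_rieszKernel_slice σ j l ξ) (c := ε ^ 2 / 16) (K := K * (1 + l ^ 2)⁻¹)
    (by positivity) fun s hs ξ' => (hK s hs l hl ξ ξ').trans (le_of_eq (by ring))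

/-- Differentiation of `H(λ)^{-1/2} φ`, truncated, under the integral sign. The bounds on
`rieszKernel` serve for both the existence of the derivative and its domination, because
`∂_j` is half the difference of `A_j(λ)*` and `A_j(λ)`. -/
lemma hasLineDerivAt_truncatedInvSqrt (hn : n ≠ 0) {ε : ℝ} (hε : 0 < ε) (j : Fin n) {l : ℝ}
    (hl : l ≠ 0) {φ : RSpace n → ℂ} (hφ : MemLp φ 2) (ξ : RSpace n) :
    HasLineDerivAt ℝ (truncatedInvSqrt ε l φ) (((√Real.pi)⁻¹ : ℂ) * ∫ q, φ q.2 *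
      (((rieszKernel (-1) j q.1 l ξ q.2 - rieszKernel 1 j q.1 l ξ q.2) / 2 *
        q.1 ^ (-(1 / 2) : ℝ) : ℝ) : ℂ) ∂(timeSpaceMeasure n ε)) ξ
      (EuclideanSpace.single j (1 : ℝ)) := by
  obtain ⟨K₁, hK₁0, hK₁⟩ := exists_abs_rieszKernel_le (n := n) hn hε (σ := 1) (by norm_num) j
  obtain ⟨K₂, hK₂0, hK₂⟩ := exists_abs_rieszKernel_le (n := n) hn hε (σ := -1) (by norm_num) j
  set c := ε ^ 2 / 16 with hc
  have hc0 : 0 < c := by positivity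
  -- `D t` is the derivative of the Mehler kernel at `ξ + t e_j`; for `|t| < 1` the Gaussian
  -- centered there is dominated by one centered at `ξ` of half the rate.
  set D : ℝ → ℝ × RSpace n → ℝ := fun t q =>
    (rieszKernel (-1) j q.1 l (ξ + t • EuclideanSpace.single j (1 : ℝ)) q.2 -
      rieszKernel 1 j q.1 l (ξ + t • EuclideanSpace.single j (1 : ℝ)) q.2) / 2 with hD
  have hDm : ∀ t, Measurable (D t) := fun t =>
    ((measurable_rieszKernel_slice (-1) j l _).sub
      (measurable_rieszKernel_slice 1 j l _)).div_const 2
  have hDle : ∀ t ∈ Metric.ball (0 : ℝ) 1, ∀ s ∈ Set.Ioo (ε ^ 2) (1 / ε ^ 2), ∀ ξ',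
      |D t (s, ξ')| ≤ (K₁ + K₂) * Real.exp c * Real.exp (-(c / 2) * ‖ξ' - ξ‖ ^ 2) := by
    intro t ht s hs ξ'
    have hv : ‖t • EuclideanSpace.single j (1 : ℝ)‖ ≤ 1 := by
      rw [norm_smul]
      simpa using (mem_ball_zero_iff.1 ht).le
    have a1 := hK₁ s hs l hl (ξ + t • EuclideanSpace.single j (1 : ℝ)) ξ'
    have a2 := hK₂ s hs l hl (ξ + t • EuclideanSpace.single j (1 : ℝ)) ξ'
    have a3 := gaussian_shift_le hc0.le ξ ξ' _ hv
    have a4 : Real.exp (-c * ‖ξ' - (ξ + t • EuclideanSpace.single j (1 : ℝ))‖ ^ 2) *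
        (1 + l ^ 2)⁻¹ ≤ Real.exp c * Real.exp (-(c / 2) * ‖ξ' - ξ‖ ^ 2) :=
      (mul_le_of_le_one_right (Real.exp_nonneg _)
        (inv_le_one_of_one_le₀ (by nlinarith [sq_nonneg l]))).trans a3
    simp only [hD]
    rw [abs_div, abs_two]
    have a5 := abs_sub (rieszKernel (-1) j s l (ξ + t • EuclideanSpace.single j (1 : ℝ)) ξ')
      (rieszKernel 1 j s l (ξ + t • EuclideanSpace.single j (1 : ℝ)) ξ')
    have a6 := mul_le_mul_of_nonneg_left a4 hK₁0
    have a7 := mul_le_mul_of_nonneg_left a4 hK₂0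
    have a8 : 0 ≤ (K₁ + K₂) * Real.exp c * Real.exp (-(c / 2) * ‖ξ' - ξ‖ ^ 2) := by positivity
    linarith
  have h0 : (0 : ℝ) ∈ Metric.ball (0 : ℝ) 1 := Metric.mem_ball_self one_pos
  have hDi : ∀ t ∈ Metric.ball (0 : ℝ) 1, Integrable (fun q : ℝ × RSpace n =>
      φ q.2 * ((D t q * q.1 ^ (-(1 / 2) : ℝ) : ℝ) : ℂ)) (timeSpaceMeasure n ε) := fun t ht =>
    integrable_mul_kernel hε hφ (hDm t) (half_pos hc0) (hDle t ht)
  have hbi := integrable_mul_kernel hε hφ (k := fun q : ℝ × RSpace n =>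
      (K₁ + K₂) * Real.exp c * Real.exp (-(c / 2) * ‖q.2 - ξ‖ ^ 2)) (by fun_prop) (half_pos hc0)
      (K := (K₁ + K₂) * Real.exp c) (ξ := ξ)
      (fun s hs ξ' => le_of_eq (abs_of_nonneg (by positivity)))
  have key := hasDerivAt_integral_of_dominated_loc_of_deriv_le (𝕜 := ℝ) (μ := timeSpaceMeasure n ε)
    (F := fun t q => φ q.2 * ((mehlerKernel q.1 l (ξ + t • EuclideanSpace.single j (1 : ℝ)) q.2 *
      q.1 ^ (-(1 / 2) : ℝ) : ℝ) : ℂ))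
    (F' := fun t q => φ q.2 * ((D t q * q.1 ^ (-(1 / 2) : ℝ) : ℝ) : ℂ))
    (x₀ := 0) (Metric.ball_mem_nhds 0 one_pos)
    (Eventually.of_forall fun t => (integrable_mul_mehlerKernel hε hl hφ _).1)
    (integrable_mul_mehlerKernel hε hl hφ _) (hDi 0 h0).1 ?_ hbi.norm
    (ae_of_all _ fun q t _ => ?_)
  · have h := key.2.const_mul ((√Real.pi)⁻¹ : ℂ)
    simp only [hD, zero_smul, add_zero] at h
    rw [HasLineDerivAt]
    simp_rw [truncatedInvSqrt_eq hε hl hφ]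
    exact h
  · filter_upwards [ae_timeSpaceMeasure n ε] with q hq t ht
    have hq0 : 0 < q.1 := (by positivity : 0 < ε ^ 2).trans hq.1
    rw [norm_mul, norm_mul, Complex.norm_real, Complex.norm_real, norm_mul, norm_mul]
    gcongr
    rw [Real.norm_eq_abs]
    exact (hDle t ht q.1 hq q.2).trans (le_abs_self _)
  · have h := (((hasDerivAt_mehlerKernel q.1 l j ξ q.2 t).mul_const
      (q.1 ^ (-(1 / 2) : ℝ))).ofReal_comp).const_mul (φ q.2)
    exact h

/-- `(-σ ∂/∂ξ_j + λ ξ_j) π^{-1/2} ∫ e^{-sH(λ)} φ s^{-1/2} ds` as an absolutely convergent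
integral. -/
lemma lineDeriv_truncatedInvSqrt_add (hn : n ≠ 0) {ε : ℝ} (hε : 0 < ε) (σ : ℝ)
    (j : Fin n) {l : ℝ} (hl : l ≠ 0) {φ : RSpace n → ℂ} (hφ : MemLp φ 2) (ξ : RSpace n) :
    -σ * lineDeriv ℝ (truncatedInvSqrt ε l φ) ξ (EuclideanSpace.single j (1 : ℝ)) +
        l * ξ j * truncatedInvSqrt ε l φ ξ =
      ((√Real.pi)⁻¹ : ℂ) * ∫ q, φ q.2 *
        ((rieszKernel σ j q.1 l ξ q.2 * q.1 ^ (-(1 / 2) : ℝ) : ℝ) : ℂ) ∂(timeSpaceMeasure n ε) := by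
  rw [(hasLineDerivAt_truncatedInvSqrt hn hε j hl hφ ξ).lineDeriv, truncatedInvSqrt_eq hε hl hφ]
  have hK : ∀ q : ℝ × RSpace n, rieszKernel σ j q.1 l ξ q.2 =
      l * ξ j * mehlerKernel q.1 l ξ q.2 - σ *
        ((rieszKernel (-1) j q.1 l ξ q.2 - rieszKernel 1 j q.1 l ξ q.2) / 2) := by
    intro q
    simp only [rieszKernel, rieszFactor]
    ring
  have i1 := integrable_mul_mehlerKernel hε hl hφ ξ
  have i2 : Integrable (fun q : ℝ × RSpace n => φ q.2 *
      (((rieszKernel (-1) j q.1 l ξ q.2 - rieszKernel 1 j q.1 l ξ q.2) / 2 *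
        q.1 ^ (-(1 / 2) : ℝ) : ℝ) : ℂ)) (timeSpaceMeasure n ε) := by
    have a := (integrable_mul_rieszKernel hn hε (σ := -1) (by norm_num) j hl hφ ξ).sub
      (integrable_mul_rieszKernel hn hε (σ := 1) (by norm_num) j hl hφ ξ)
    refine (a.div_const 2).congr (ae_of_all _ fun q => ?_)
    simp only [Pi.sub_apply]
    push_cast
    ring
  rw [integral_congr_ae (g := fun q : ℝ × RSpace n => (l * ξ j : ℂ) * (φ q.2 *
    ((mehlerKernel q.1 l ξ q.2 * q.1 ^ (-(1 / 2) : ℝ) : ℝ) : ℂ)) - σ * (φ q.2 *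
      (((rieszKernel (-1) j q.1 l ξ q.2 - rieszKernel 1 j q.1 l ξ q.2) / 2 *
        q.1 ^ (-(1 / 2) : ℝ) : ℝ) : ℂ))) (μ := timeSpaceMeasure n ε)
    (f := fun q : ℝ × RSpace n => φ q.2 *
        ((rieszKernel σ j q.1 l ξ q.2 * q.1 ^ (-(1 / 2) : ℝ) : ℝ) : ℂ))
    (ae_of_all _ fun q => ?_), integral_sub (i1.const_mul _) (i2.const_mul _), integral_const_mul,
    integral_const_mul]
  · ring
  · simp only
    rw [hK q]
    push_cast
    ring

/-! ### The truncated Riesz transforms as integrals in the frequency variable -/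

lemma memLp_slice_left {g : RSpace n × ℝ → ℂ} (hg : MemLp g 2) :
    ∀ᵐ l : ℝ, MemLp (fun ξ => g (ξ, l)) 2 := by
  have h1 : Integrable (fun p => ‖g p‖ ^ 2) (volume.prod volume) :=
    hg.integrable_norm_pow (by norm_num)
  have h2 : AEStronglyMeasurable (fun q : ℝ × RSpace n => g q.swap) (volume.prod volume) :=
    AEStronglyMeasurable.prod_swap (f := g) hg.1
  filter_upwards [h1.prod_left_ae, h2.prodMk_left] with l a b
  exact (memLp_two_iff_integrable_sq_norm b).2 a

/-- `partialFourier` is defined by choice; by Plancherel's theorem the choice is not vacuous. -/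
lemma exists_partialFourier_eq {f : RSpace n × ℝ → ℂ} (hf : MemLp f 2) :
    ∃ F, IsPartialFourier f F ∧ ∀ l, partialFourier f l = fun ξ => F (ξ, l) := by
  have h := exists_isPartialFourier hf
  refine ⟨h.choose, h.choose_spec, fun l => ?_⟩
  funext ξ
  rw [partialFourier, dif_pos h]

/-- The integrand of `(-σ ∂/∂ξ_j + λ ξ_j) H(λ)^{-1/2} f^λ (ξ) e^{-iλη}` after truncation, as a
function of `(s, (ξ', λ))`. -/
def rieszTriple (σ : ℝ) (j : Fin n) (F : RSpace n × ℝ → ℂ) (ξ : RSpace n) (η : ℝ)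
    (q : ℝ × RSpace n × ℝ) : ℂ :=
  F q.2 * (Complex.exp (-Complex.I * q.2.2 * η) * rieszKernel σ j q.1 q.2.2 ξ q.2.1) *
    ((q.1 ^ (-(1 / 2) : ℝ) : ℝ) : ℂ)

lemma integrable_rieszTriple (hn : n ≠ 0) {ε : ℝ} (hε : 0 < ε) {σ : ℝ} (hσ : σ ^ 2 = 1)
    (j : Fin n) {F : RSpace n × ℝ → ℂ} (hF : MemLp F 2) (ξ : RSpace n) (η : ℝ) :
    Integrable (rieszTriple σ j F ξ η)
      ((volume.restrict (Set.Ioo (ε ^ 2) (1 / ε ^ 2))).prod volume) := by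
  obtain ⟨K, hK0, hK⟩ := exists_abs_rieszKernel_le hn hε hσ j
  have h1 : Integrable fun p : RSpace n × ℝ =>
      ‖F p‖ * (Real.exp (-(ε ^ 2 / 16) * ‖p.1 - ξ‖ ^ 2) * (1 + p.2 ^ 2)⁻¹) :=
    hF.norm.integrable_mul (memLp_mul_prod (memLp_gaussian (c := ε ^ 2 / 16) (by positivity) ξ)
      memLp_inv_one_add_sq)
  have h2 : Integrable (fun _ : ℝ => ε⁻¹ * K)
      (volume.restrict (Set.Ioo (ε ^ 2) (1 / ε ^ 2))) := integrable_const _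
  have hm : Measurable fun q : ℝ × RSpace n × ℝ => rieszKernel σ j q.1 q.2.2 ξ q.2.1 :=
    (measurable_rieszKernel (n := n) σ j).comp
      (f := fun q : ℝ × RSpace n × ℝ => (q.1, q.2.2, ξ, q.2.1)) (by fun_prop)
  refine (h2.mul_prod h1).mono' ((hF.1.comp_snd.mul
    (Measurable.aestronglyMeasurable (by fun_prop))).mul
    (Measurable.aestronglyMeasurable (by fun_prop))) ?_
  have hne : ∀ᵐ p : RSpace n × ℝ, p.2 ≠ 0 := Measure.quasiMeasurePreserving_snd.ae ae_ne_zero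
  filter_upwards [Measure.quasiMeasurePreserving_fst.ae (ae_restrict_mem measurableSet_Ioo),
    Measure.quasiMeasurePreserving_snd.ae hne] with q hq hq2
  have hq0 : 0 < q.1 := (by positivity : 0 < ε ^ 2).trans hq.1
  have h3 := rpow_neg_half_le hε hq.1
  have h4 := Real.rpow_nonneg hq0.le (-(1 / 2))
  have h5 := hK _ hq _ hq2 ξ q.2.1
  rw [rieszTriple, norm_mul, norm_mul, norm_mul, show -Complex.I * (q.2.2 : ℂ) * (η : ℂ) =
      ((-(q.2.2 * η) : ℝ) : ℂ) * Complex.I by push_cast; ring, Complex.norm_exp_ofReal_mul_I,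
    one_mul, Complex.norm_real, Complex.norm_real, Real.norm_eq_abs, Real.norm_of_nonneg h4]
  calc _ ≤ ‖F q.2‖ * (K * (Real.exp (-(ε ^ 2 / 16) * ‖q.2.1 - ξ‖ ^ 2) * (1 + q.2.2 ^ 2)⁻¹)) *
        ε⁻¹ := by gcongr
    _ = _ := by ring

/-- The integrand of the truncated Riesz transform is almost everywhere the partial integral of
`rieszTriple`. -/
lemma ae_eq_integral_rieszTriple (hn : n ≠ 0) {ε : ℝ} (hε : 0 < ε) (σ : ℝ)
    (j : Fin n) {F : RSpace n × ℝ → ℂ} (hF : MemLp F 2) (ξ : RSpace n) (η : ℝ) :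
    (fun l : ℝ => Complex.exp (-Complex.I * l * η) *
      (-σ * lineDeriv ℝ (truncatedInvSqrt ε l fun ξ => F (ξ, l)) ξ
        (EuclideanSpace.single j (1 : ℝ)) +
        l * ξ j * truncatedInvSqrt ε l (fun ξ => F (ξ, l)) ξ)) =ᵐ[volume]
    fun l : ℝ => ((√Real.pi)⁻¹ : ℂ) * ∫ q, rieszTriple σ j F ξ η (q.1, q.2, l)
      ∂(timeSpaceMeasure n ε) := by
  filter_upwards [ae_ne_zero, memLp_slice_left hF] with l hl hs
  rw [lineDeriv_truncatedInvSqrt_add hn hε σ j hl hs, mul_left_comm, ← integral_const_mul]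
  congr 1
  refine integral_congr_ae (ae_of_all _ fun q => ?_)
  simp only [rieszTriple]
  push_cast
  ring

lemma measurePreserving_assoc_timeSpace (n : ℕ) (ε : ℝ) :
    MeasurePreserving (MeasurableEquiv.prodAssoc : (ℝ × RSpace n) × ℝ ≃ᵐ ℝ × RSpace n × ℝ)
      ((timeSpaceMeasure n ε).prod volume)
      ((volume.restrict (Set.Ioo (ε ^ 2) (1 / ε ^ 2))).prod volume) :=
  measurePreserving_prodAssoc _ _ _

lemma integrable_rieszTriple_assoc (hn : n ≠ 0) {ε : ℝ} (hε : 0 < ε) {σ : ℝ} (hσ : σ ^ 2 = 1)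
    (j : Fin n) {F : RSpace n × ℝ → ℂ} (hF : MemLp F 2) (ξ : RSpace n) (η : ℝ) :
    Integrable (fun q : (ℝ × RSpace n) × ℝ => rieszTriple σ j F ξ η (q.1.1, q.1.2, q.2))
      ((timeSpaceMeasure n ε).prod volume) :=
  (measurePreserving_assoc_timeSpace n ε).integrable_comp_of_integrable
    (integrable_rieszTriple hn hε hσ j hF ξ η)

/-- Fubini's theorem: the integral in `s` is taken last. -/
lemma integral_integral_rieszTriple (hn : n ≠ 0) {ε : ℝ} (hε : 0 < ε) {σ : ℝ} (hσ : σ ^ 2 = 1)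
    (j : Fin n) {F : RSpace n × ℝ → ℂ} (hF : MemLp F 2) (ξ : RSpace n) (η : ℝ) :
    ∫ l : ℝ, ∫ q, rieszTriple σ j F ξ η (q.1, q.2, l) ∂(timeSpaceMeasure n ε) =
      ∫ s in Set.Ioo (ε ^ 2) (1 / ε ^ 2), (∫ p : RSpace n × ℝ, F p *
        (Complex.exp (-Complex.I * p.2 * η) * rieszKernel σ j s p.2 ξ p.1)) *
        ((s ^ (-(1 / 2) : ℝ) : ℝ) : ℂ) := by
  have h1 := integrable_rieszTriple hn hε hσ j hF ξ η
  have h2 := integrable_rieszTriple_assoc hn hε hσ j hF ξ η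
  have h3 := (measurePreserving_assoc_timeSpace n ε).integral_comp'
    (g := rieszTriple σ j F ξ η)
  rw [← integral_prod_symm _ h2]
  refine h3.trans ?_
  rw [integral_prod _ h1]
  refine integral_congr_ae (ae_of_all _ fun s => ?_)
  simp only [rieszTriple]
  rw [integral_mul_const]

/-! ### The substitution `s = r²` -/

lemma mem_truncationSet_iff {ε r : ℝ} (hε : 0 < ε) (hr : 0 < r) :
    r ∈ truncationSet ε ↔ r ^ 2 ∈ Set.Ioo (ε ^ 2) (1 / ε ^ 2) := by
  refine ⟨sq_mem_Ioo_of_mem_truncationSet hε, fun h => ?_⟩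
  rw [← one_div_pow] at h
  have h2 : (0 : ℝ) ≤ 1 / ε := by positivity
  exact ⟨by rw [abs_of_pos hr]; exact lt_of_pow_lt_pow_left₀ 2 hr.le h.1,
    by rw [abs_of_pos hr]; exact lt_of_pow_lt_pow_left₀ 2 h2 h.2⟩

/-- The substitution `s = r²`; the two signs of `r` make up for the factor in
`dr = ½ s^{-1/2} ds`. -/
lemma setIntegral_truncationSet_comp_sq {ε : ℝ} (hε : 0 < ε) {u : ℝ → ℂ}
    (hu : IntegrableOn (fun r => u (r ^ 2)) (truncationSet ε)) :
    ∫ r in truncationSet ε, u (r ^ 2) =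
      ∫ s in Set.Ioo (ε ^ 2) (1 / ε ^ 2), u s * ((s ^ (-(1 / 2) : ℝ) : ℝ) : ℂ) := by
  set k : ℝ → ℂ := (truncationSet ε).indicator fun r => u (r ^ 2) with hk
  have hki : Integrable k := hu.integrable_indicator (measurableSet_truncationSet ε)
  have hneg : ∀ r, k (-r) = k r := by
    intro r
    have hmem : -r ∈ truncationSet ε ↔ r ∈ truncationSet ε := by
      change ε < |-r| ∧ |-r| < 1 / ε ↔ ε < |r| ∧ |r| < 1 / ε
      rw [abs_neg]
    by_cases hr : r ∈ truncationSet ε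
    · simp only [hk, Set.indicator_of_mem hr, Set.indicator_of_mem (hmem.2 hr), neg_sq]
    · simp only [hk, Set.indicator_of_notMem hr, Set.indicator_of_notMem (fun h => hr (hmem.1 h))]
  -- The integrand is even in `r`.
  have h1 : ∫ r, k r = 2 * ∫ r in Set.Ioi (0 : ℝ), k r := by
    rw [← intervalIntegral.integral_Iic_add_Ioi (b := 0) hki.integrableOn hki.integrableOn]
    have h := integral_comp_neg_Iic 0 k
    simp_rw [hneg, neg_zero] at h
    rw [h, two_mul]
  set g : ℝ → ℂ := (Set.Ioo (ε ^ 2) (1 / ε ^ 2)).indicator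
    fun s => u s * ((s ^ (-(1 / 2) : ℝ) : ℝ) : ℂ) with hg
  have h2 := integral_comp_rpow_Ioi g (p := 2) two_ne_zero
  have h3 : ∫ s in Set.Ioi (0 : ℝ), g s = ∫ s in Set.Ioo (ε ^ 2) (1 / ε ^ 2),
      u s * ((s ^ (-(1 / 2) : ℝ) : ℝ) : ℂ) := by
    rw [hg, setIntegral_indicator measurableSet_Ioo, Set.inter_eq_self_of_subset_right]
    exact fun s hs => (by positivity : 0 < ε ^ 2).trans hs.1
  rw [← integral_indicator (measurableSet_truncationSet ε), ← hk, h1, ← h3, ← h2,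
    ← integral_const_mul]
  refine setIntegral_congr_fun measurableSet_Ioi fun r hr => ?_
  have hr0 : 0 < r := hr
  have e1 : r ^ (2 : ℝ) = r ^ 2 := by norm_cast
  have e2 : (2 : ℝ) * r ^ ((2 : ℝ) - 1) * (r ^ 2) ^ (-(1 / 2) : ℝ) = 2 := by
    rw [← Real.rpow_natCast, ← Real.rpow_mul hr0.le, mul_assoc, ← Real.rpow_add hr0]
    norm_num
  rw [e1, abs_two]
  by_cases h : r ∈ truncationSet ε
  · simp only [hk, hg, Set.indicator_of_mem h,
      Set.indicator_of_mem ((mem_truncationSet_iff hε hr0).1 h)]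
    rw [Complex.real_smul, mul_left_comm, ← Complex.ofReal_mul, e2, mul_comm]
    norm_num
  · simp only [hk, hg, Set.indicator_of_notMem h,
      Set.indicator_of_notMem (fun h' => h ((mem_truncationSet_iff hε hr0).2 h')), mul_zero,
      smul_zero]

/-! ### The representation formulas -/

/-- Both representation formulas at once: `σ = 1` is the formula for `A_j(λ)` and `Z̃_j`, and
`σ = -1` the one for `A_j(λ)*` and `Z̃*_j`. -/
lemma integrable_and_representation (hn : n ≠ 0) {ε : ℝ} (hε : 0 < ε) {σ : ℝ} (hσ : σ ^ 2 = 1)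
    (j : Fin n) {f : RSpace n × ℝ → ℂ} (hf : MemLp f 2) (ξ : RSpace n) (η : ℝ) :
    Integrable (fun l : ℝ => Complex.exp (-Complex.I * l * η) *
      (-σ * lineDeriv ℝ (truncatedInvSqrt ε l (partialFourier f l)) ξ
        (EuclideanSpace.single j (1 : ℝ)) +
        l * ξ j * truncatedInvSqrt ε l (partialFourier f l) ξ)) ∧
    Integrable (fun h : Heis n => truncatedHilbert ε h f ξ η * rieszDensity σ j h) ∧
    ((2 * Real.pi : ℝ) : ℂ)⁻¹ * (∫ l : ℝ, Complex.exp (-Complex.I * l * η) *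
      (-σ * lineDeriv ℝ (truncatedInvSqrt ε l (partialFourier f l)) ξ
        (EuclideanSpace.single j (1 : ℝ)) +
        l * ξ j * truncatedInvSqrt ε l (partialFourier f l) ξ)) =
      ((√Real.pi)⁻¹ : ℂ) * ∫ h : Heis n, truncatedHilbert ε h f ξ η * rieszDensity σ j h := by
  obtain ⟨F, hF, hFeq⟩ := exists_partialFourier_eq hf
  simp_rw [hFeq]
  have hG := continuous_rieszDensity hn σ j
  obtain ⟨K, hK⟩ := exists_norm_rieszDensity_le hn σ j
  have hae := ae_eq_integral_rieszTriple hn hε σ j hF.1 ξ η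
  refine ⟨?_, integrable_truncatedHilbert_mul hε hf ξ η hG hK, ?_⟩
  · exact ((integrable_rieszTriple_assoc hn hε hσ j hF.1 ξ η).integral_prod_right.const_mul
      _).congr hae.symm
  rw [integral_congr_ae hae, integral_const_mul, integral_integral_rieszTriple hn hε hσ j hF.1,
    integral_truncatedHilbert_mul hε hf ξ η hG hK]
  set u : ℝ → ℂ := fun s => ∫ p : RSpace n × ℝ, F p *
        (Complex.exp (-Complex.I * p.2 * η) * rieszKernel σ j s p.2 ξ p.1) with hu
  have hint := integrable_hilbertIntegrand_mul hε hf ξ η hG hK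
  have hr : (fun r => ∫ h : Heis n, hilbertIntegrand h f ξ η r * rieszDensity σ j h)
      =ᵐ[volume.restrict (truncationSet ε)] fun r => ((2 * Real.pi : ℝ) : ℂ)⁻¹ * u (r ^ 2) := by
    filter_upwards [hint.prod_left_ae, ae_restrict_mem (measurableSet_truncationSet ε)] with r h1 h2
    exact integral_hilbertIntegrand_mul hn hε hσ j hf hF ξ η h2 h1
  have hui : IntegrableOn (fun r => u (r ^ 2)) (truncationSet ε) := by
    have hpi : ((2 * Real.pi : ℝ) : ℂ) ≠ 0 := by exact_mod_cast Real.two_pi_pos.ne'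
    refine ((hint.integral_prod_right.congr hr).const_mul ((2 * Real.pi : ℝ) : ℂ)).congr
      (ae_of_all _ fun r => ?_)
    simp only
    rw [mul_inv_cancel_left₀ hpi]
  rw [integral_congr_ae hr, integral_const_mul, setIntegral_truncationSet_comp_sq hε hui]
  ring

end Grushin

end

theorem mainTheorem4 (n : ℕ) (j : Fin n) :
    -- `p_s` is the heat kernel of the sub-Laplacian
    Grushin.IsHeatKernel (Grushin.heatKernel n) ∧
    ∀ (ε : ℝ), 0 < ε → ∀ f : Grushin.RSpace n × ℝ → ℂ, MemLp f 2 volume →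
      ∀ (ξ : Grushin.RSpace n) (η : ℝ),
        -- all integrals converge absolutely
        (∀ᵐ h : Grushin.Heis n,
          IntegrableOn (Grushin.hilbertIntegrand h f ξ η) (Grushin.truncationSet ε)) ∧
        Integrable (Grushin.rieszIntegrand ε j f ξ η) ∧
        Integrable (Grushin.rieszStarIntegrand ε j f ξ η) ∧
        Integrable (fun h : Grushin.Heis n =>
          Grushin.truncatedHilbert ε h f ξ η *
            Grushin.fieldZTilde j (Grushin.heatKernel n 1) h) ∧
        Integrable (fun h : Grushin.Heis n =>
          Grushin.truncatedHilbert ε h f ξ η *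
            Grushin.fieldZTildeStar j (Grushin.heatKernel n 1) h) ∧
        -- the two representation formulas
        Grushin.truncatedRiesz ε j f ξ η =
          ((Real.sqrt Real.pi)⁻¹ : ℂ) * ∫ h : Grushin.Heis n,
            Grushin.truncatedHilbert ε h f ξ η *
              Grushin.fieldZTilde j (Grushin.heatKernel n 1) h ∧
        Grushin.truncatedRieszStar ε j f ξ η =
          ((Real.sqrt Real.pi)⁻¹ : ℂ) * ∫ h : Grushin.Heis n,
            Grushin.truncatedHilbert ε h f ξ η *
              Grushin.fieldZTildeStar j (Grushin.heatKernel n 1) h := by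
  have hn : n ≠ 0 := (Fin.pos j).ne'
  refine ⟨Grushin.isHeatKernel_heatKernel hn, fun ε hε f hf ξ η => ?_⟩
  have h1 := Grushin.integrable_and_representation hn hε (σ := 1) (by norm_num) j hf ξ η
  have h2 := Grushin.integrable_and_representation hn hε (σ := -1) (by norm_num) j hf ξ η
  have e1 : Grushin.rieszIntegrand ε j f ξ η = fun l : ℝ => Complex.exp (-Complex.I * l * η) *
      (-((1 : ℝ) : ℂ) * lineDeriv ℝ (Grushin.truncatedInvSqrt ε l (Grushin.partialFourier f l)) ξ
        (EuclideanSpace.single j (1 : ℝ)) +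
        l * ξ j * Grushin.truncatedInvSqrt ε l (Grushin.partialFourier f l) ξ) := by
    funext l
    rw [Grushin.rieszIntegrand, Grushin.hermiteRiesz, Grushin.creation, Complex.ofReal_one,
      neg_one_mul]
  have e2 : Grushin.rieszStarIntegrand ε j f ξ η = fun l : ℝ => Complex.exp (-Complex.I * l * η) *
      (-((-1 : ℝ) : ℂ) * lineDeriv ℝ (Grushin.truncatedInvSqrt ε l (Grushin.partialFourier f l)) ξ
        (EuclideanSpace.single j (1 : ℝ)) +
        l * ξ j * Grushin.truncatedInvSqrt ε l (Grushin.partialFourier f l) ξ) := by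
    funext l
    rw [Grushin.rieszStarIntegrand, Grushin.hermiteRieszStar, Grushin.annihilation,
      Complex.ofReal_neg, neg_neg, Complex.ofReal_one, one_mul]
  simp_rw [Grushin.fieldZTilde_heatKernel hn, Grushin.fieldZTildeStar_heatKernel hn,
    Grushin.truncatedRiesz, Grushin.truncatedRieszStar, e1, e2]
  exact ⟨Grushin.ae_integrableOn_hilbertIntegrand hε hf ξ η, h1.1, h2.1, h1.2.1, h2.2.1, h1.2.2,
    h2.2.2⟩
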